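/- Let $A$ be a unital C*-algebra. Write $T(A)$ for the set of tracial states of $A$ with the weak-* topology, and $\operatorname{Aff}T(A)$ for the additive group of continuous affine functions $T(A)\to\mathbb R$ with the uniform norm topology; for self-adjoint $a\in A$ put $\hat a(\tau)=\tau(a)$, and for self-adjoint $b=(b_{ij})\in M_n(A)$ put $\hat b(\tau)=\sum_i\tau(b_{ii})$. For $1\le n<\infty$ let $GL_n(A)$ and $U_n(A)$ be the groups of invertible and of unitary elements of $M_n(A)$ with the norm topology, and let $GL_\infty(A)$, $U_\infty(A)$ be their inductive limits along $x\mapsto x\oplus 1$, with the inductive limit topology. For a group $G$ with a topology, $DG$ is the derived subgroup, $CG$ the closure of $DG$, and $G^0$ the connected component of the identity; write $CGL_n^0(A)=C(GL_n(A)^0)$ and $CU_n^0(A)=C(U_n(A)^0)$. Put $\overline K_1^{\mathrm{alg}}(A)=GL_\infty(A)/CGL_\infty(A)$ and $\overline K_1^{\mathrm{alg},u}(A)=U_\infty(A)/CU_\infty(A)$. All quotients carry the quotient topology. Every element of $\operatorname{Aff}T(A)$ is of the form $\hat a$ with $a\in A$ self-adjoint, and for every $n\in\{1,2,\dots\}\cup\{\infty\}$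 there is a split short exact sequence of topological groups $$0\to U_n(A)/CU_n^0(A)\xrightarrow{\ \iota\ } GL_n(A)/CGL_n^0(A)\xrightarrow{\ \chi\ }\operatorname{Aff}T(A)\to 0,$$ with $\iota$ induced by the inclusion, $\chi([x])=\widehat{\log|x|}$, and splitting $s(\hat a)=[e^a]$ for self-adjoint $a\in A$ (where $e^a\in GL_1(A)$ is regarded in $GL_n(A)$ as $e^a\oplus 1$). That is: all the groups, including those with $n=\infty$, are topological groups, $\iota,\chi,s$ are well-defined continuous homomorphisms, $\iota$ is injective and open onto its image, $\chi$ is surjective and open, $\operatorname{im}\iota=\ker\chi$, and $\chi\circ s=\mathrm{id}$. Likewise, with the same formulas, there is a split short exact sequence of topological groups $$0\to\overline K_1^{\mathrm{alg},u}(A)\xrightarrow{\ \iota\ }\overline K_1^{\mathrm{alg}}(A)\xrightarrow{\ \chi\ }\operatorname{Aff}T(A)\to 0,$$ and $(v,f)\mapsto\iota(v)s(f)$ is an isomorphism of topological groups $$\overline K_1^{\mathrm{alg},u}(A)\oplus\operatorname{Aff}T(A)\cong\overline K_1^{\mathrm{alg}}(A),$$ which is natural with respect to unital *-homomorphisms $A\to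 B$ of unital C*-algebras. -/

import Mathlib

universe u v

open Topology

noncomputable section

/-! ### Groups with a topology for which translations and inversion are continuous

The inductive limit groups below need not be topological groups, but their translations and
inversion are continuous. -/

section Quasi

theorem continuous_conj_of_separately {G : Type u} [Group G] [TopologicalSpace G]
    [SeparatelyContinuousMul G] (g : G) : Continuous fun x : G => g * x * g⁻¹ :=
  (SeparatelyContinuousMul.continuous_mul_const (a := g⁻¹)).comp
    (SeparatelyContinuousMul.continuous_const_mul (a := g))

variable (G : Type u) [Group G] [TopologicalSpace G] [SeparatelyContinuousMul G] [ContinuousInv G]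

/-- The connected component `G⁰` of the identity. -/
def idComponent : Subgroup G where
  carrier := connectedComponent (1 : G)
  one_mem' := mem_connectedComponent
  mul_mem' := by
    intro g h hg hh
    have h1 : g * h ∈ connectedComponent (g * 1) :=
      (SeparatelyContinuousMul.continuous_const_mul (a := g)).image_connectedComponent_subset 1
        ⟨h, hh, rfl⟩
    rw [mul_one] at h1
    rwa [connectedComponent_eq hg]
  inv_mem' := by
    intro g hg
    have h1 := (continuous_inv (G := G)).image_connectedComponent_subset 1 ⟨g, hg, rfl⟩
    rwa [inv_one] at h1

instance idComponent_normal : (idComponent G).Normal where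
  conj_mem := by
    intro n hn g
    have h1 := (continuous_conj_of_separately g).image_connectedComponent_subset 1 ⟨n, hn, rfl⟩
    rwa [mul_one, mul_inv_cancel] at h1

variable {G} in
/-- The closure of a subgroup, as a subgroup. -/
def closureSubgroup (H : Subgroup G) : Subgroup G where
  carrier := closure (H : Set G)
  one_mem' := subset_closure H.one_mem
  mul_mem' := by
    intro a b ha hb
    have key : ∀ x ∈ H, ∀ y ∈ closure (H : Set G), x * y ∈ closure (H : Set G) := fun x hx y hy =>
      map_mem_closure (SeparatelyContinuousMul.continuous_const_mul (a := x)) hy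
        fun z hz => H.mul_mem hx hz
    have := map_mem_closure (SeparatelyContinuousMul.continuous_mul_const (a := b)) ha
      (t := closure (H : Set G)) fun x hx => key x hx b hb
    rwa [closure_closure] at this
  inv_mem' := by
    intro a ha
    exact map_mem_closure continuous_inv ha fun z hz => H.inv_mem hz

instance closureSubgroup_normal (H : Subgroup G) [H.Normal] : (closureSubgroup H).Normal where
  conj_mem n hn g := by
    have h : ∀ m ∈ (H : Set G), g * m * g⁻¹ ∈ (H : Set G) := fun m hm =>
      Subgroup.Normal.conj_mem (H := H) inferInstance m hm g
    exact map_mem_closure (f := fun x => g * x * g⁻¹) (continuous_conj_of_separately g) hn h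

/-- `CG`: the closure of the derived subgroup of `G`. -/
abbrev CG : Subgroup G := closureSubgroup (commutator G)

/-- `CG⁰`: the closure of the derived subgroup of the connected component `G⁰` of the identity
(as `G⁰` is closed, it does not matter whether the closure is taken in `G⁰` or in `G`). -/
abbrev CG0 : Subgroup G := closureSubgroup ⁅idComponent G, idComponent G⁆

variable {G} in
theorem CG_le_comap {H : Type v} [Group H] [TopologicalSpace H] [SeparatelyContinuousMul H]
    [ContinuousInv H] (f : G →* H) (hf : Continuous f) : CG G ≤ (CG H).comap f := by
  intro x hx
  refine map_mem_closure hf hx fun y hy => ?_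
  have h : (commutator G).map f ≤ commutator H := by
    rw [commutator_def, commutator_def, Subgroup.map_commutator]
    exact Subgroup.commutator_mono le_top le_top
  exact h ⟨y, hy, rfl⟩

end Quasi

/-! ### Inductive limits of sequences of topological groups

`DirectLimit G f` is the quotient of the disjoint union `Σ n, G n`; the quotient topology it
carries is the inductive limit topology. -/

section Limit

variable {G : ℕ → Type u} [∀ n, Group (G n)]
  (f : ∀ m n : ℕ, m ≤ n → G m →* G n) [DirectedSystem G (f · · ·)]

/-- The canonical homomorphism from a stage of the sequence to the limit. -/
def limitOf (n : ℕ) : G n →* DirectLimit G f where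
  toFun x := ⟦⟨n, x⟩⟧
  map_one' := (DirectLimit.one_def n).symm
  map_mul' x y := (DirectLimit.mul_def n x y).symm

theorem limitOf_map (m n : ℕ) (h : m ≤ n) (x : G m) : limitOf f n (f m n h x) = limitOf f m x :=
  DirectLimit.mk_apply (f := f) m n x h

theorem exists_limitOf (x : DirectLimit G f) : ∃ n y, limitOf f n y = x := by
  obtain ⟨n, y, rfl⟩ := DirectLimit.exists_eq_mk f x
  exact ⟨n, y, rfl⟩

variable [∀ n, TopologicalSpace (G n)]

theorem continuous_limitOf (n : ℕ) : Continuous (limitOf f n) :=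
  continuous_quotient_mk'.comp continuous_sigmaMk

theorem continuous_limit_dom {X : Type v} [TopologicalSpace X] {g : DirectLimit G f → X}
    (h : ∀ n, Continuous fun x : G n => g (limitOf f n x)) : Continuous g :=
  isQuotientMap_quotient_mk'.continuous_iff.2 (continuous_sigma h)

theorem limit_separatelyContinuousMul [∀ n, IsTopologicalGroup (G n)]
    (hf : ∀ m n h, Continuous (f m n h)) :
    SeparatelyContinuousMul (DirectLimit G f) where
  continuous_const_mul := by
    intro a
    obtain ⟨m, y, rfl⟩ := exists_limitOf f a
    refine continuous_limit_dom f fun n => ?_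
    have : (fun x : G n => limitOf f m y * limitOf f n x) = fun x =>
        limitOf f (max m n) (f m _ (le_max_left m n) y * f n _ (le_max_right m n) x) := by
      funext x
      rw [map_mul, limitOf_map, limitOf_map]
    rw [this]
    exact (continuous_limitOf f _).comp (continuous_const.mul (hf _ _ _))
  continuous_mul_const := by
    intro a
    obtain ⟨m, y, rfl⟩ := exists_limitOf f a
    refine continuous_limit_dom f fun n => ?_
    have : (fun x : G n => limitOf f n x * limitOf f m y) = fun x =>
        limitOf f (max m n) (f n _ (le_max_right m n) x * f m _ (le_max_left m n) y) := by
      funext x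
      rw [map_mul, limitOf_map, limitOf_map]
    rw [this]
    exact (continuous_limitOf f _).comp ((hf _ _ _).mul continuous_const)

theorem limit_continuousInv [∀ n, IsTopologicalGroup (G n)] : ContinuousInv (DirectLimit G f) where
  continuous_inv := by
    refine continuous_limit_dom f fun n => ?_
    have : (fun x : G n => (limitOf f n x)⁻¹) = fun x => limitOf f n x⁻¹ := by
      funext x
      rw [map_inv]
    rw [this]
    exact (continuous_limitOf f _).comp continuous_inv

variable {H : ℕ → Type v} [∀ n, Group (H n)] [∀ n, TopologicalSpace (H n)]
  (g : ∀ m n : ℕ, m ≤ n → H m →* H n) [DirectedSystem H (g · · ·)]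

/-- The homomorphism of limits induced by a compatible sequence of homomorphisms. -/
def limitMap (r : ∀ n, G n →* H n)
    (hr : ∀ m n (h : m ≤ n) (x : G m), g m n h (r m x) = r n (f m n h x)) :
    DirectLimit G f →* DirectLimit H g :=
  MonoidHom.mk' (DirectLimit.map f g (fun n => r n) hr) fun x y => by
    obtain ⟨n, a, b, rfl, rfl⟩ := DirectLimit.exists_eq_mk₂ f x y
    rw [DirectLimit.mul_def]
    simp only [DirectLimit.map_def, map_mul]
    rw [DirectLimit.mul_def]

theorem continuous_limitMap (r : ∀ n, G n →* H n)
    (hr : ∀ m n (h : m ≤ n) (x : G m), g m n h (r m x) = r n (f m n h x))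
    (hc : ∀ n, Continuous (r n)) : Continuous (limitMap f g r hr) :=
  continuous_limit_dom f fun n => (continuous_limitOf g n).comp (hc n)

end Limit

/-! ### Traces -/

section Trace

variable (A : Type u) [CStarAlgebra A]

open scoped ComplexOrder in
/-- The tracial states `T(A)`, with the weak-* topology. -/
def TracialState : Set (WeakDual ℂ A) :=
  {τ | τ 1 = 1 ∧ (∀ a, 0 ≤ τ (star a * a)) ∧ ∀ a b, τ (a * b) = τ (b * a)}

/-- `Aff T(A)`: the continuous affine functions `T(A) → ℝ`. As `T(A)` is compact, the topology of
`C(T(A), ℝ)` is that of the uniform norm. -/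
def AffT : Submodule ℝ C(TracialState A, ℝ) where
  carrier := {f | ∀ (ρ σ τ : TracialState A) (t : ℝ), 0 ≤ t → t ≤ 1 →
    (ρ : WeakDual ℂ A) = (t : ℂ) • (σ : WeakDual ℂ A) + ((1 - t : ℝ) : ℂ) • (τ : WeakDual ℂ A) →
    f ρ = t * f σ + (1 - t) * f τ}
  add_mem' := by
    intro f g hf hg ρ σ τ t h0 h1 h
    simp only [ContinuousMap.add_apply, hf ρ σ τ t h0 h1 h, hg ρ σ τ t h0 h1 h]
    ring
  zero_mem' := by
    intro ρ σ τ t h0 h1 h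
    simp
  smul_mem' := by
    intro c f hf ρ σ τ t h0 h1 h
    simp only [ContinuousMap.smul_apply, hf ρ σ τ t h0 h1 h, smul_eq_mul]
    ring

variable {A}

open scoped ComplexOrder in
theorem TracialState.isClosed : IsClosed (TracialState A) := by
  have ev : ∀ a : A, Continuous fun τ : WeakDual ℂ A => τ a := WeakDual.eval_continuous
  have e : TracialState A = {τ | τ 1 = 1} ∩ ((⋂ a : A, {τ | 0 ≤ τ (star a * a)}) ∩
      ⋂ a : A, ⋂ b : A, {τ | τ (a * b) = τ (b * a)}) := by
    ext τ
    simp [TracialState]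
  rw [e]
  exact (isClosed_eq (ev 1) continuous_const).inter
    ((isClosed_iInter fun a => isClosed_le continuous_const (ev _)).inter
      (isClosed_iInter fun a => isClosed_iInter fun b => isClosed_eq (ev _) (ev _)))

open scoped ComplexOrder in
theorem TracialState.norm_apply_le (τ : TracialState A) (a : A) :
    ‖(τ : WeakDual ℂ A) a‖ ≤ 4 * ‖a‖ := by
  let _ := CStarAlgebra.spectralOrder A
  have _ := CStarAlgebra.spectralOrderedRing A
  let l : A →ₗ[ℂ] ℂ := (WeakDual.toStrongDual (τ : WeakDual ℂ A)).toLinearMap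
  have hl : ∀ x : A, 0 ≤ x → 0 ≤ l x := fun x hx => by
    obtain ⟨y, rfl⟩ := CStarAlgebra.nonneg_iff_eq_star_mul_self.1 hx
    exact τ.2.2.1 y
  let p : A →ₚ[ℂ] ℂ := PositiveLinearMap.mk₀ l hl
  obtain ⟨x, hx0, hxn, hx⟩ := CStarAlgebra.exists_sum_four_nonneg a
  have h1 : ‖p 1‖ = 1 := by
    change ‖(τ : WeakDual ℂ A) 1‖ = 1
    rw [τ.2.1, norm_one]
  change ‖p a‖ ≤ _
  conv_lhs => rw [hx]
  simp only [map_sum, map_smul]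
  refine (norm_sum_le _ _).trans ?_
  refine (Finset.sum_le_sum (g := fun _ => ‖a‖) fun i _ => ?_).trans (by simp)
  rw [norm_smul, norm_pow, Complex.norm_I, one_pow, one_mul]
  refine (p.norm_apply_le_of_nonneg _ (hx0 i)).trans ?_
  rw [h1, one_mul]
  exact hxn i

instance : CompactSpace (TracialState A) := by
  rw [← isCompact_iff_compactSpace]
  refine (WeakDual.isCompact_closedBall (𝕜 := ℂ) (E := A) 0 4).of_isClosed_subset
    TracialState.isClosed fun τ hτ => ?_
  rw [Set.mem_preimage, mem_closedBall_zero_iff]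
  exact ContinuousLinearMap.opNorm_le_bound _ (by norm_num) (TracialState.norm_apply_le ⟨τ, hτ⟩)

/-- `â(τ) = τ(a)`; for self-adjoint `a` the number `τ(a)` is real. -/
def hat (a : A) : AffT A :=
  ⟨⟨fun τ => ((τ : WeakDual ℂ A) a).re,
    Complex.continuous_re.comp ((WeakDual.eval_continuous a).comp continuous_subtype_val)⟩, by
    intro ρ σ τ t h0 h1 h
    simp only [ContinuousMap.coe_mk, h]
    change ((t : ℂ) * (σ : WeakDual ℂ A) a + ((1 - t : ℝ) : ℂ) * (τ : WeakDual ℂ A) a).re = _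
    rw [Complex.add_re, Complex.re_ofReal_mul, Complex.re_ofReal_mul]⟩

variable {B : Type v} [CStarAlgebra B]

theorem continuous_starAlgHom (φ : A →⋆ₐ[ℂ] B) : Continuous φ :=
  (NonUnitalStarAlgHom.instContinuousLinearMapClassComplex
    (F := A →⋆ₐ[ℂ] B) (A := A) (B := B)).map_continuous φ

/-- The state `τ ∘ φ`, as a functional. -/
def WeakDual.compStarAlgHom (φ : A →⋆ₐ[ℂ] B) (τ : WeakDual ℂ B) : WeakDual ℂ A :=
  StrongDual.toWeakDual ((WeakDual.toStrongDual τ).comp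
    ⟨φ.toAlgHom.toLinearMap, continuous_starAlgHom φ⟩)

theorem WeakDual.compStarAlgHom_apply (φ : A →⋆ₐ[ℂ] B) (τ : WeakDual ℂ B) (a : A) :
    WeakDual.compStarAlgHom φ τ a = τ (φ a) := rfl

/-- `T(φ) : T(B) → T(A)`, `τ ↦ τ ∘ φ`. -/
def TracialState.comap (φ : A →⋆ₐ[ℂ] B) : C(TracialState B, TracialState A) where
  toFun τ := ⟨WeakDual.compStarAlgHom φ τ, by
    refine ⟨?_, fun a => ?_, fun a b => ?_⟩
    · rw [WeakDual.compStarAlgHom_apply, map_one]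
      exact τ.2.1
    · rw [WeakDual.compStarAlgHom_apply, map_mul, map_star]
      exact τ.2.2.1 _
    · rw [WeakDual.compStarAlgHom_apply, WeakDual.compStarAlgHom_apply, map_mul φ, map_mul φ]
      exact τ.2.2.2 _ _⟩
  continuous_toFun := by
    refine Continuous.subtype_mk (WeakDual.continuous_of_continuous_eval fun a => ?_) _
    exact (WeakDual.eval_continuous (φ a)).comp continuous_subtype_val

/-- `Aff T(φ) : Aff T(A) → Aff T(B)`, `f ↦ f ∘ T(φ)`. -/
def AffT.map (φ : A →⋆ₐ[ℂ] B) : AffT A →+ AffT B where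
  toFun f := ⟨(f : C(TracialState A, ℝ)).comp (TracialState.comap φ), by
    intro ρ σ τ t h0 h1 h
    refine f.2 _ _ _ t h0 h1 ?_
    refine DFunLike.ext _ _ fun a => ?_
    exact congrArg (fun μ : WeakDual ℂ B => μ (φ a)) h⟩
  map_zero' := rfl
  map_add' _ _ := rfl

end Trace

/-! ### Matrices, and the groups `GL_n(A)` and `U_n(A)` -/

section Matrices

/-- The C*-algebra `M_n(A)`. -/
def Mat (A : Type u) (n : ℕ) : Type u := CStarMatrix (Fin n) (Fin n) A

instance (A : Type u) [CStarAlgebra A] [PartialOrder A] [StarOrderedRing A] (n : ℕ) :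
    CStarAlgebra (Mat A n) := inferInstanceAs (CStarAlgebra (CStarMatrix (Fin n) (Fin n) A))

instance (A : Type u) [CStarAlgebra A] [PartialOrder A] [StarOrderedRing A] (n : ℕ) :
    PartialOrder (Mat A n) := inferInstanceAs (PartialOrder (CStarMatrix (Fin n) (Fin n) A))

instance (A : Type u) [CStarAlgebra A] [PartialOrder A] [StarOrderedRing A] (n : ℕ) :
    StarOrderedRing (Mat A n) := inferInstanceAs (StarOrderedRing (CStarMatrix (Fin n) (Fin n) A))

/-- The matrix with given entries. -/
def Mat.of {A : Type u} {n : ℕ} (x : Fin n → Fin n → A) : Mat A n := CStarMatrix.ofMatrix x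

theorem Mat.of_apply {A : Type u} {n : ℕ} (x : Fin n → Fin n → A) (i j : Fin n) :
    Mat.of x i j = x i j := rfl

theorem Mat.ext {A : Type u} {n : ℕ} {x y : Mat A n} (h : ∀ i j, x i j = y i j) : x = y :=
  funext fun i => funext fun j => h i j

/-- The matrix `x ⊕ 1` in `M_n(A)`, for `x` in `M_m(A)` and `m ≤ n`. -/
def padMat {A : Type u} [CStarAlgebra A] {m : ℕ} (n : ℕ) (x : Mat A m) : Mat A n := Mat.of fun i j =>
  if h : (i : ℕ) < m ∧ (j : ℕ) < m then x ⟨i, h.1⟩ ⟨j, h.2⟩ else if i = j then 1 else 0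

theorem padMat_apply {A : Type u} [CStarAlgebra A] {m n : ℕ} (x : Mat A m) (i j : Fin n) : padMat n x i j =
    if h : (i : ℕ) < m ∧ (j : ℕ) < m then x ⟨i, h.1⟩ ⟨j, h.2⟩ else if i = j then 1 else 0 := rfl

variable (A : Type u) [CStarAlgebra A] [PartialOrder A] [StarOrderedRing A]

/-- `GL_n(A)`. -/
abbrev GLn (n : ℕ) : Type u := (Mat A n)ˣ

/-- `U_n(A)`. -/
abbrev Un (n : ℕ) : Type u := unitary (Mat A n)

theorem Mat.mul_apply {n : ℕ} (x y : Mat A n) (i j : Fin n) :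
    (x * y) i j = ∑ k, x i k * y k j := rfl

theorem Mat.one_apply {n : ℕ} (i j : Fin n) : (1 : Mat A n) i j = if i = j then 1 else 0 := rfl

theorem Mat.star_apply {n : ℕ} (x : Mat A n) (i j : Fin n) : (star x) i j = star (x j i) := rfl

theorem Mat.continuous_apply {n : ℕ} (i j : Fin n) : Continuous fun x : Mat A n => x i j :=
  (_root_.continuous_apply j).comp
    (_root_.continuous_apply (A := fun _ : Fin n => Fin n → A) i)

theorem Mat.continuous_of_apply {n : ℕ} {X : Type v} [TopologicalSpace X] {f : X → Mat A n}
    (h : ∀ i j, Continuous fun x => f x i j) : Continuous f :=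
  continuous_pi (A := fun _ : Fin n => Fin n → A) fun i => continuous_pi fun j => h i j

/-- `x ↦ x ⊕ 1` from `M_m(A)` to `M_n(A)`, for `m ≤ n`. -/
def pad (m n : ℕ) (hmn : m ≤ n) : Mat A m →⋆* Mat A n where
  toFun x := padMat n x
  map_one' := by
    refine Mat.ext fun i j => ?_
    simp only [padMat_apply, Mat.one_apply, Fin.ext_iff]
    split_ifs <;> rfl
  map_mul' x y := by
    obtain ⟨d, rfl⟩ := Nat.exists_eq_add_of_le hmn
    refine Mat.ext fun i j => ?_
    rw [Mat.mul_apply, Fin.sum_univ_add]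
    simp only [padMat_apply]
    refine Fin.addCases (fun i => ?_) (fun i => ?_) i <;>
      refine Fin.addCases (fun j => ?_) (fun j => ?_) j
    · have h : ∀ x : Fin d, ¬ (m + (x : ℕ) = (j : ℕ)) := fun x => by omega
      simp [Fin.ext_iff, Mat.mul_apply, h]
    · have h : ∀ x : Fin m, ¬ ((x : ℕ) = m + (j : ℕ)) := fun x => by omega
      have h' : ∀ x : Fin d, ¬ ((i : ℕ) = m + (x : ℕ)) := fun x => by omega
      simp [Fin.ext_iff, h, h']
    · have h : ∀ x : Fin m, ¬ (m + (i : ℕ) = (x : ℕ)) := fun x => by omega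
      have h' : ∀ x : Fin d, ¬ (m + (x : ℕ) = (j : ℕ)) := fun x => by omega
      simp [Fin.ext_iff, h, h']
    · have h : ∀ x : Fin m, ¬ ((x : ℕ) = m + (j : ℕ)) := fun x => by omega
      simp only [Fin.val_natAdd, Fin.val_castAdd, Fin.ext_iff]
      simp [← Fin.ext_iff, h, eq_comm]
  map_star' x := by
    refine Mat.ext fun i j => ?_
    rw [Mat.star_apply, padMat_apply, padMat_apply]
    by_cases h : (i : ℕ) < m ∧ (j : ℕ) < m
    · rw [dif_pos h, dif_pos h.symm, Mat.star_apply]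
    · rw [dif_neg h, dif_neg fun h' => h h'.symm]
      by_cases hij : i = j
      · rw [if_pos hij, if_pos hij.symm, star_one]
      · rw [if_neg hij, if_neg (Ne.symm hij), star_zero]

theorem pad_apply {m n : ℕ} (hmn : m ≤ n) (x : Mat A m) : pad A m n hmn x = padMat n x := rfl

theorem continuous_pad (m n : ℕ) (hmn : m ≤ n) : Continuous (pad A m n hmn) := by
  refine Mat.continuous_of_apply A fun i j => ?_
  simp only [pad_apply, padMat_apply]
  by_cases h : (i : ℕ) < m ∧ (j : ℕ) < m
  · simp only [dif_pos h]
    exact Mat.continuous_apply A _ _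
  · simp only [dif_neg h]
    exact continuous_const

theorem pad_self {m : ℕ} (x : Mat A m) : pad A m m le_rfl x = x := by
  refine Mat.ext fun i j => ?_
  rw [pad_apply, padMat_apply, dif_pos ⟨i.2, j.2⟩]

theorem pad_pad {l m n : ℕ} (hlm : l ≤ m) (hmn : m ≤ n) (x : Mat A l) :
    pad A m n hmn (pad A l m hlm x) = pad A l n (hlm.trans hmn) x := by
  refine Mat.ext fun i j => ?_
  simp only [pad_apply, padMat_apply, Fin.ext_iff]
  split_ifs <;> first | rfl | omega

/-- `x ↦ x ⊕ 1` from `GL_m(A)` to `GL_n(A)`. -/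
def GLpad (m n : ℕ) (hmn : m ≤ n) : GLn A m →* GLn A n := Units.map (pad A m n hmn).toMonoidHom

/-- `u ↦ u ⊕ 1` from `U_m(A)` to `U_n(A)`. -/
def Upad (m n : ℕ) (hmn : m ≤ n) : Un A m →* Un A n := (Unitary.map (pad A m n hmn)).toMonoidHom

instance GLpad_directed : DirectedSystem (GLn A) (GLpad A · · ·) where
  map_self _ _ := Units.ext (pad_self A _)
  map_map _ _ _ hij hjk _ := Units.ext (pad_pad A hij hjk _)

instance Upad_directed : DirectedSystem (fun n => Un A n) (Upad A · · ·) where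
  map_self _ _ := Subtype.ext (pad_self A _)
  map_map _ _ _ hij hjk _ := Subtype.ext (pad_pad A hij hjk _)

/-- `GL_∞(A)`, with the inductive limit topology. -/
abbrev GLinf : Type u := DirectLimit (GLn A) (GLpad A)

/-- `U_∞(A)`, with the inductive limit topology. -/
abbrev Uinf : Type u := DirectLimit (fun n => Un A n) (Upad A)

instance : SeparatelyContinuousMul (GLinf A) :=
  limit_separatelyContinuousMul _ fun m n h => (continuous_pad A m n h).units_map _

instance : ContinuousInv (GLinf A) := limit_continuousInv _

instance : SeparatelyContinuousMul (Uinf A) :=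
  limit_separatelyContinuousMul _ fun m n h => Continuous.subtype_map (continuous_pad A m n h)
    fun _ hx => Unitary.map_mem (pad A m n h) hx

instance : ContinuousInv (Uinf A) := limit_continuousInv _

/-- The class of an element of `GL_n(A)` in `GL_∞(A)`. -/
abbrev GLof (n : ℕ) : GLn A n →* GLinf A := limitOf (GLpad A) n

/-- The class of an element of `U_n(A)` in `U_∞(A)`. -/
abbrev Uof (n : ℕ) : Un A n →* Uinf A := limitOf (Upad A) n

/-- The Hausdorffized algebraic `K₁`-group `GL_∞(A) / CGL_∞(A)`, with the quotient topology. -/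
abbrev K1 : Type u := GLinf A ⧸ CG (GLinf A)

/-- The Hausdorffized unitary algebraic `K₁`-group `U_∞(A) / CU_∞(A)`, with the quotient
topology. -/
abbrev K1u : Type u := Uinf A ⧸ CG (Uinf A)

variable {A}

/-- `â` for `a` in `M_n(A)`, where a trace is extended to matrices as the sum of its values on the
diagonal entries. -/
def hatMat {n : ℕ} (b : Mat A n) : AffT A := hat (∑ i, b i i)

/-- The function `(log |x|)^` on `T(A)`, for `x` in `GL_n(A)`. -/
def hatLogAbs {n : ℕ} (x : GLn A n) : AffT A := hatMat (CFC.log (CFC.abs (x : Mat A n)))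

/-- The exponential of an element of `A`, as an invertible element. -/
def expUnit (a : A) : Aˣ where
  val := NormedSpace.exp a
  inv := NormedSpace.exp (-a)
  val_inv := by
    let _ : NormedAlgebra ℚ A := NormedAlgebra.restrictScalars ℚ ℂ A
    rw [← NormedSpace.exp_add_of_commute (Commute.neg_right (Commute.refl a)), add_neg_cancel,
      NormedSpace.exp_zero]
  inv_val := by
    let _ : NormedAlgebra ℚ A := NormedAlgebra.restrictScalars ℚ ℂ A
    rw [← NormedSpace.exp_add_of_commute (Commute.neg_left (Commute.refl a)), neg_add_cancel,
      NormedSpace.exp_zero]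

variable (A) in
/-- `x ↦ x ⊕ 1` from `GL(A)` to `GL_n(A)`, for `n ≥ 1`. -/
def GLone (n : ℕ) : Aˣ →* GLn A n := Units.map
  { toFun := fun x => Mat.of fun i j => if i = j then if (i : ℕ) = 0 then x else 1 else 0
    map_one' := by
      refine Mat.ext fun i j => ?_
      simp only [Mat.of_apply, Mat.one_apply, ite_self]
    map_mul' := fun x y => by
      refine Mat.ext fun i j => ?_
      simp only [Mat.of_apply, Mat.mul_apply, ite_mul, zero_mul, Finset.sum_ite_eq,
        Finset.mem_univ, if_true]
      split_ifs <;> simp }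

end Matrices

/-! ### Functoriality -/

section Functor

variable {A : Type u} [CStarAlgebra A] [PartialOrder A] [StarOrderedRing A]
  {B : Type v} [CStarAlgebra B] [PartialOrder B] [StarOrderedRing B]

/-- A unital *-homomorphism, applied to every entry of a matrix. -/
def Mat.map (φ : A →⋆ₐ[ℂ] B) (n : ℕ) : Mat A n →⋆* Mat B n where
  toFun x := Mat.of fun i j => φ (x i j)
  map_one' := by
    refine Mat.ext fun i j => ?_
    rw [Mat.of_apply, Mat.one_apply, Mat.one_apply]
    split_ifs
    · exact map_one φ
    · exact map_zero φ
  map_mul' x y := by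
    refine Mat.ext fun i j => ?_
    rw [Mat.of_apply, Mat.mul_apply, Mat.mul_apply, map_sum]
    exact Finset.sum_congr rfl fun k _ => map_mul φ _ _
  map_star' x := by
    refine Mat.ext fun i j => ?_
    rw [Mat.of_apply, Mat.star_apply, Mat.star_apply, Mat.of_apply]
    exact map_star φ _

theorem Mat.map_apply (φ : A →⋆ₐ[ℂ] B) {n : ℕ} (x : Mat A n) (i j : Fin n) :
    Mat.map φ n x i j = φ (x i j) := rfl

theorem Mat.continuous_map (φ : A →⋆ₐ[ℂ] B) (n : ℕ) : Continuous (Mat.map φ n) :=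
  Mat.continuous_of_apply B fun i j =>
    (continuous_starAlgHom φ).comp (Mat.continuous_apply A i j)

theorem Mat.map_pad (φ : A →⋆ₐ[ℂ] B) {m n : ℕ} (h : m ≤ n) (x : Mat A m) :
    pad B m n h (Mat.map φ m x) = Mat.map φ n (pad A m n h x) := by
  refine Mat.ext fun i j => ?_
  simp only [pad_apply, Mat.map_apply, padMat_apply]
  split_ifs
  · rfl
  · exact (map_one φ).symm
  · exact (map_zero φ).symm

/-- `GL_∞(φ)`. -/
def GLinf.map (φ : A →⋆ₐ[ℂ] B) : GLinf A →* GLinf B :=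
  limitMap (GLpad A) (GLpad B) (fun n => Units.map (Mat.map φ n).toMonoidHom)
    fun _ _ h _ => Units.ext (Mat.map_pad φ h _)

/-- `U_∞(φ)`. -/
def Uinf.map (φ : A →⋆ₐ[ℂ] B) : Uinf A →* Uinf B :=
  limitMap (Upad A) (Upad B) (fun n => (Unitary.map (Mat.map φ n)).toMonoidHom)
    fun _ _ h _ => Subtype.ext (Mat.map_pad φ h _)

theorem GLinf.continuous_map (φ : A →⋆ₐ[ℂ] B) : Continuous (GLinf.map φ) :=
  continuous_limitMap _ _ _ _ fun n => (Mat.continuous_map φ n).units_map _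

theorem Uinf.continuous_map (φ : A →⋆ₐ[ℂ] B) : Continuous (Uinf.map φ) :=
  continuous_limitMap _ _ _ _ fun n => Continuous.subtype_map (Mat.continuous_map φ n)
    fun _ hx => Unitary.map_mem (Mat.map φ n) hx

/-- The map on Hausdorffized algebraic `K₁` induced by `φ`. -/
def K1.map (φ : A →⋆ₐ[ℂ] B) : K1 A →* K1 B :=
  QuotientGroup.map _ _ (GLinf.map φ) (CG_le_comap _ (GLinf.continuous_map φ))

/-- The map on Hausdorffized unitary algebraic `K₁` induced by `φ`. -/
def K1u.map (φ : A →⋆ₐ[ℂ] B) : K1u A →* K1u B :=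
  QuotientGroup.map _ _ (Uinf.map φ) (CG_le_comap _ (Uinf.continuous_map φ))

end Functor

/-! ### Split short exact sequences of topological groups -/

/-- `1 → U → G → Q → 1`, with maps `ι` and `χ`, is a short exact sequence of topological groups,
and the continuous homomorphism `s` splits it: `ι` is a topological embedding onto the kernel of
the continuous and open surjection `χ`, and `χ ∘ s = id`. -/
structure IsSplitShortExact {U G Q : Type*} [Group U] [TopologicalSpace U] [Group G]
    [TopologicalSpace G] [Group Q] [TopologicalSpace Q] (ι : U →* G) (χ : G →* Q) (s : Q →* G) :
    Prop where
  topologicalGroup_left : IsTopologicalGroup U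
  topologicalGroup_middle : IsTopologicalGroup G
  topologicalGroup_right : IsTopologicalGroup Q
  isEmbedding : IsEmbedding ι
  range_eq_ker : ι.range = χ.ker
  surjective : Function.Surjective χ
  continuous : Continuous χ
  isOpenMap : IsOpenMap χ
  continuous_splitting : Continuous s
  splitting : ∀ q, χ (s q) = q

end

/-! Every invertible `x` is `u e^{log|x|}` with `u` unitary. Modulo the closed derived subgroup of
the identity component, the unitary part becomes multiplicative and the exponential part remembers
only the trace of `log|x|`, so the polar decomposition turns into a direct product. Three facts
carry this.

The trace determines the class of an exponential. Exponentials lie in the identity component, so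
their classes commute, and the quotient by a closed subgroup is Hausdorff; Trotter's formula
therefore makes `a ↦ [e^a]` additive (`mk_expUnit_add`, `mk_expUnitary_add`). This map is invariant
under conjugation by the identity component, so it kills commutators (`expQuot_mul_comm`,
`expUnitaryQuot_I_smul_commutator`) and, its kernel being closed, the closed span of the elements
`x⋆x - xx⋆`. That span contains every self-adjoint element on which all traces vanish
(`mem_traceNull_of_hat_eq_zero`). The reason is a Jordan decomposition: a bounded tracial functional
is a difference of positive ones, so the distance from `a` to the span is at most `3‖â‖`. With a
separation argument, the same estimate shows that the functions `â` exhaust `Aff T(A)`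
(`exists_hat_eq`), with self-adjoint lifts of controlled norm.

The determinant `x ↦ τ(log|x|)` is multiplicative (`trace_log_abs_mul`): along `y⋆ e^{tk} y` the
trace of the logarithm has the constant derivative `τ(k)`.

The unitary part is multiplicative modulo commutators (`mk_polar_mul`): along `e^{ta} y` the
logarithmic derivative of the unitary part is `i c` with `c` self-adjoint and of trace zero, so by
the first fact the curve never leaves its coset.

`exists_split` assembles these; the norm-controlled lifts give the continuity of the splitting.
Polar parts and determinants are compatible with `x ↦ x ⊕ 1`, hence pass to the limit. There joint
continuity of multiplication is not automatic. It comes from `isOpenMap_mk_expInf`: the classes of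
exponentials form a continuous open homomorphic image of the additive group `A`. -/

noncomputable section

/-! ### Positive parts of bounded tracial functionals -/

section TracialFunctionals

variable {M : Type u} [CStarAlgebra M] [PartialOrder M] [StarOrderedRing M]

/-- The supremum of a functional over the positive elements below `a`. -/
def posSup (φ : M →ₗ[ℝ] ℝ) (a : M) : ℝ := sSup (φ '' Set.Icc 0 a)

theorem bddAbove_image_Icc {φ : M →ₗ[ℝ] ℝ} {C : ℝ} (hC0 : 0 ≤ C) (hC : ∀ x, |φ x| ≤ C * ‖x‖)
    (a : M) : BddAbove (φ '' Set.Icc 0 a) := by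
  refine ⟨C * ‖a‖, ?_⟩
  rintro _ ⟨b, ⟨hb, hba⟩, rfl⟩
  exact (le_abs_self _).trans ((hC b).trans (mul_le_mul_of_nonneg_left
    (CStarAlgebra.norm_le_norm_of_nonneg_of_le hb hba) hC0))

omit [StarOrderedRing M] in
theorem posSup_le {φ : M →ₗ[ℝ] ℝ} {a : M} (ha : 0 ≤ a) {c : ℝ}
    (h : ∀ b, 0 ≤ b → b ≤ a → φ b ≤ c) : posSup φ a ≤ c := by
  refine csSup_le ⟨_, 0, ⟨le_rfl, ha⟩, rfl⟩ ?_
  rintro _ ⟨b, ⟨hb, hba⟩, rfl⟩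
  exact h b hb hba

theorem le_posSup {φ : M →ₗ[ℝ] ℝ} {C : ℝ} (hC0 : 0 ≤ C) (hC : ∀ x, |φ x| ≤ C * ‖x‖) {a b : M}
    (hb : 0 ≤ b) (hba : b ≤ a) : φ b ≤ posSup φ a :=
  le_csSup (bddAbove_image_Icc hC0 hC a) ⟨b, ⟨hb, hba⟩, rfl⟩

theorem posSup_nonneg {φ : M →ₗ[ℝ] ℝ} {C : ℝ} (hC0 : 0 ≤ C) (hC : ∀ x, |φ x| ≤ C * ‖x‖) {a : M}
    (ha : 0 ≤ a) : 0 ≤ posSup φ a := by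
  simpa using le_posSup hC0 hC le_rfl ha

theorem posSup_le_norm {φ : M →ₗ[ℝ] ℝ} {C : ℝ} (hC0 : 0 ≤ C) (hC : ∀ x, |φ x| ≤ C * ‖x‖) {a : M}
    (ha : 0 ≤ a) : posSup φ a ≤ C * ‖a‖ :=
  posSup_le ha fun b hb hba => (le_abs_self _).trans ((hC b).trans (mul_le_mul_of_nonneg_left
    (CStarAlgebra.norm_le_norm_of_nonneg_of_le hb hba) hC0))

/-- A Riesz decomposition up to equivalence under a tracial functional. -/
theorem exists_riesz_decomposition {φ : M →ₗ[ℝ] ℝ} {C : ℝ} (hC0 : 0 ≤ C)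
    (hC : ∀ x, |φ x| ≤ C * ‖x‖)
    (ht : ∀ x, φ (star x * x) = φ (x * star x)) {a₁ a₂ b : M} (h₁ : 0 ≤ a₁) (h₂ : 0 ≤ a₂)
    (hb : 0 ≤ b) (hba : b ≤ a₁ + a₂) {δ : ℝ} (hδ : 0 < δ) :
    ∃ b₁ b₂, 0 ≤ b₁ ∧ b₁ ≤ a₁ ∧ 0 ≤ b₂ ∧ b₂ ≤ a₂ ∧ φ b ≤ φ b₁ + φ b₂ + C * δ := by
  set d := a₁ + a₂ with hd
  have hd0 : 0 ≤ d := add_nonneg h₁ h₂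
  have hsp : IsStrictlyPositive (d + algebraMap ℝ M δ) :=
    IsStrictlyPositive.nonneg_add hd0 (by
      rw [IsStrictlyPositive.iff_of_unital]
      refine ⟨?_, (IsUnit.mk0 δ hδ.ne').map _⟩
      rw [Algebra.algebraMap_eq_smul_one]
      exact smul_nonneg hδ.le zero_le_one)
  -- `c` stands in for `d^{-1/2}`, which need not exist; the price is the defect `δ c²` in `c d c =
  -- 1 - δ c²`.
  set c := (d + algebraMap ℝ M δ) ^ (-(1 / 2) : ℝ) with hc
  have hc0 : 0 ≤ c := CFC.rpow_nonneg
  have hcs : star c = c := (IsSelfAdjoint.of_nonneg hc0).star_eq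
  have hcc : c * (d + algebraMap ℝ M δ) * c = 1 := CFC.conjugate_rpow_neg_one_half _ hsp
  have hcd : c * d * c = 1 - δ • (c * c) := by
    rw [mul_add, add_mul, Algebra.algebraMap_eq_smul_one] at hcc
    rw [eq_sub_iff_add_eq, ← hcc]
    simp
  set β := CFC.sqrt b with hβ
  have hβs : star β = β := (IsSelfAdjoint.of_nonneg (CFC.sqrt_nonneg b)).star_eq
  have hβb : β * β = b := CFC.sqrt_mul_sqrt_self b hb
  have hcdc : c * d * c ≤ 1 := by
    rw [hcd, sub_le_self_iff]
    refine smul_nonneg hδ.le ?_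
    have := star_mul_self_nonneg c
    rwa [hcs] at this
  have hcbc : c * b * c ≤ 1 := by
    refine le_trans ?_ hcdc
    have := star_left_conjugate_le_conjugate hba c
    rwa [hcs] at this
  have hcbc0 : 0 ≤ c * b * c := by
    have := star_left_conjugate_nonneg hb c
    rwa [hcs] at this
  -- For `x = α c β` with `α = √a`, `x⋆x` is `β c a c β`, while `xx⋆ = α (c b c) α` lies below `a`
  -- because `c b c ≤ 1`. Traciality exchanges the two. The elements `x⋆x` for `a₁` and `a₂` add up
  -- to `β (c d c) β = b - δ β c² β`.
  have key : ∀ a : M, 0 ≤ a → a ≤ d → ∃ b' : M, 0 ≤ b' ∧ b' ≤ a ∧ φ b' = φ (β * c * a * c * β) := by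
    intro a ha had
    set α := CFC.sqrt a with hα
    have hαs : star α = α := (IsSelfAdjoint.of_nonneg (CFC.sqrt_nonneg a)).star_eq
    have hαa : α * α = a := CFC.sqrt_mul_sqrt_self a ha
    refine ⟨α * (c * b * c) * α, ?_, ?_, ?_⟩
    · have := star_left_conjugate_nonneg hcbc0 α
      rwa [hαs] at this
    · have := star_left_conjugate_le_conjugate hcbc α
      rwa [hαs, mul_one, hαa] at this
    · have := ht (α * c * β)
      simp only [star_mul, hαs, hβs, hcs] at this
      rw [show β * (c * α) * (α * c * β) = β * c * (α * α) * c * β by simp only [mul_assoc],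
        show α * c * β * (β * (c * α)) = α * (c * (β * β) * c) * α by simp only [mul_assoc],
        hαa, hβb] at this
      exact this.symm
  obtain ⟨b₁, h1, h1', e1⟩ := key a₁ h₁ (le_add_of_nonneg_right h₂)
  obtain ⟨b₂, h2, h2', e2⟩ := key a₂ h₂ (le_add_of_nonneg_left h₁)
  refine ⟨b₁, b₂, h1, h1', h2, h2', ?_⟩
  have e3 : φ b = φ b₁ + φ b₂ + δ * φ (β * (c * c) * β) := by
    have e0 : ∀ z : M, δ * φ z = φ (δ • z) := fun z => by rw [map_smul, smul_eq_mul]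
    rw [e1, e2, e0, ← map_add, ← map_add]
    congr 1
    have : β * c * a₁ * c * β + β * c * a₂ * c * β = β * (c * d * c) * β := by
      rw [hd]; noncomm_ring
    rw [this, hcd, ← hβb]
    simp only [mul_sub, sub_mul, mul_one, mul_smul_comm, smul_mul_assoc]
    abel
  rw [e3]
  -- `β c² β` and `c b c` are `y⋆y` and `yy⋆` for `y = c β`, so they have the same norm.
  have hn : ‖β * (c * c) * β‖ ≤ 1 := by
    have e4 : β * (c * c) * β = star (c * β) * (c * β) := by
      simp only [star_mul, hβs, hcs, mul_assoc]
    rw [e4, CStarRing.norm_star_mul_self, ← CStarRing.norm_self_mul_star]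
    have e5 : c * β * star (c * β) = c * b * c := by
      rw [← hβb]; simp only [star_mul, hβs, hcs, mul_assoc]
    rw [e5]
    exact (CStarAlgebra.norm_le_one_iff_of_nonneg _ hcbc0).2 hcbc
  have : φ (β * (c * c) * β) ≤ C :=
    (le_abs_self _).trans ((hC _).trans (mul_le_of_le_one_right hC0 hn))
  have := mul_le_mul_of_nonneg_left this hδ.le
  linarith

/-- Subadditivity is the hard half: an element below `a₁ + a₂` is split by
`exists_riesz_decomposition`. The choice `δ = ε / (C + 1)` keeps the error below `ε` even when `C =
0`. -/
theorem posSup_add {φ : M →ₗ[ℝ] ℝ} {C : ℝ} (hC0 : 0 ≤ C) (hC : ∀ x, |φ x| ≤ C * ‖x‖)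
    (ht : ∀ x, φ (star x * x) = φ (x * star x)) {a₁ a₂ : M} (h₁ : 0 ≤ a₁) (h₂ : 0 ≤ a₂) :
    posSup φ (a₁ + a₂) = posSup φ a₁ + posSup φ a₂ := by
  apply le_antisymm
  · refine posSup_le (add_nonneg h₁ h₂) fun b hb hba => ?_
    refine le_of_forall_pos_le_add fun ε hε => ?_
    obtain ⟨b₁, b₂, p1, q1, p2, q2, h⟩ := exists_riesz_decomposition hC0 hC ht h₁ h₂ hb hba
      (δ := ε / (C + 1)) (by positivity)
    have e1 := le_posSup hC0 hC p1 q1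
    have e2 := le_posSup hC0 hC p2 q2
    have e3 : C * (ε / (C + 1)) ≤ ε := by
      rw [mul_div_assoc', div_le_iff₀ (by positivity)]
      nlinarith
    linarith
  · rw [← le_sub_iff_add_le]
    refine posSup_le h₁ fun b hb hba => ?_
    rw [le_sub_iff_add_le, ← le_sub_iff_add_le']
    refine posSup_le h₂ fun c hc hca => ?_
    rw [le_sub_iff_add_le', ← map_add]
    exact le_posSup hC0 hC (add_nonneg hb hc) (add_le_add hba hca)

/-- This is traciality for `x = √b u`. -/
theorem unitary_conj_functional {φ : M →ₗ[ℝ] ℝ} (ht : ∀ x, φ (star x * x) = φ (x * star x))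
    {b : M} (hb : 0 ≤ b) (u : unitary M) : φ (star (u : M) * b * u) = φ b := by
  have hβs : star (CFC.sqrt b) = CFC.sqrt b :=
    (IsSelfAdjoint.of_nonneg (CFC.sqrt_nonneg b)).star_eq
  have hβb : CFC.sqrt b * CFC.sqrt b = b := CFC.sqrt_mul_sqrt_self b hb
  have := ht (CFC.sqrt b * (u : M))
  simp only [star_mul, hβs] at this
  rw [show star (u : M) * CFC.sqrt b * (CFC.sqrt b * u) =
      star (u : M) * (CFC.sqrt b * CFC.sqrt b) * u by simp only [mul_assoc],
    show CFC.sqrt b * (u : M) * (star (u : M) * CFC.sqrt b) =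
      CFC.sqrt b * ((u : M) * star (u : M)) * CFC.sqrt b by simp only [mul_assoc],
    Unitary.mul_star_self_of_mem u.2, mul_one, hβb] at this
  exact this

/-- Conjugation carries the order interval below `a` into the one below `u⋆ a u` without changing
`φ`; conjugating back by `u⋆` gives the other inequality. -/
theorem posSup_unitary_conj {φ : M →ₗ[ℝ] ℝ} {C : ℝ} (hC0 : 0 ≤ C) (hC : ∀ x, |φ x| ≤ C * ‖x‖)
    (ht : ∀ x, φ (star x * x) = φ (x * star x)) {a : M} (ha : 0 ≤ a) (u : unitary M) :
    posSup φ (star (u : M) * a * u) = posSup φ a := by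
  have key : ∀ (a : M) (u : unitary M), 0 ≤ a → posSup φ a ≤ posSup φ (star (u : M) * a * u) := by
    intro a u ha
    refine posSup_le ha fun b hb hba => ?_
    rw [← unitary_conj_functional ht hb u]
    exact le_posSup hC0 hC (star_left_conjugate_nonneg hb _) (star_left_conjugate_le_conjugate hba _)
  refine le_antisymm ?_ (key a u ha)
  have := key (star (u : M) * a * u) (star u) (star_left_conjugate_nonneg ha _)
  rw [show star ((star u : unitary M) : M) * (star (u : M) * a * u) * ((star u : unitary M) : M) =
    ((u : M) * star (u : M)) * a * ((u : M) * star (u : M)) by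
      simp only [Unitary.coe_star, star_star, mul_assoc], Unitary.mul_star_self_of_mem u.2,
    one_mul, mul_one] at this
  exact this

/-- The positive part of a bounded tracial functional, extended to all of `M`. -/
def posPartFun {φ : M →ₗ[ℝ] ℝ} {C : ℝ} (hC0 : 0 ≤ C) (hC : ∀ x, |φ x| ≤ C * ‖x‖)
    (ht : ∀ x, φ (star x * x) = φ (x * star x)) : M →+ ℝ :=
  AddMonoidHom.mk' (fun x => posSup φ ((realPart x : M) + algebraMap ℝ M ‖x‖) -
    posSup φ (algebraMap ℝ M ‖x‖)) fun x y => by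
      have pos : ∀ x : M, 0 ≤ (realPart x : M) + algebraMap ℝ M ‖x‖ := fun x => by
        have h1 := IsSelfAdjoint.neg_algebraMap_norm_le_self (realPart x).2
        have h2 : algebraMap ℝ M ‖(realPart x : M)‖ ≤ algebraMap ℝ M ‖x‖ :=
          algebraMap_mono M (realPart.norm_le x)
        rw [← neg_le_iff_add_nonneg]
        exact (neg_le_neg h2).trans h1
      have pos' : ∀ x : M, 0 ≤ algebraMap ℝ M ‖x‖ := fun x =>
        algebraMap_nonneg M (norm_nonneg x)
      have e1 := posSup_add hC0 hC ht (pos (x + y)) (add_nonneg (pos' x) (pos' y))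
      have e2 := posSup_add hC0 hC ht (pos x) (add_nonneg (pos y) (pos' (x + y)))
      have e3 := posSup_add hC0 hC ht (pos y) (pos' (x + y))
      have e4 := posSup_add hC0 hC ht (pos' x) (pos' y)
      -- Every summand is positive, so `posSup` is additive on both sides of this regrouping;
      -- cancelling the scalar terms leaves the additivity of the difference.
      have e5 : (realPart (x + y) : M) + algebraMap ℝ M ‖x + y‖ +
          (algebraMap ℝ M ‖x‖ + algebraMap ℝ M ‖y‖) = (realPart x : M) + algebraMap ℝ M ‖x‖ +
          ((realPart y : M) + algebraMap ℝ M ‖y‖ + algebraMap ℝ M ‖x + y‖) := by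
        rw [map_add, AddSubgroup.coe_add]; abel
      rw [e5, e2, e3, e4] at e1
      linarith

theorem posPartFun_of_nonneg {φ : M →ₗ[ℝ] ℝ} {C : ℝ} (hC0 : 0 ≤ C) (hC : ∀ x, |φ x| ≤ C * ‖x‖)
    (ht : ∀ x, φ (star x * x) = φ (x * star x)) {a : M} (ha : 0 ≤ a) :
    posPartFun hC0 hC ht a = posSup φ a := by
  change posSup φ ((realPart a : M) + algebraMap ℝ M ‖a‖) - posSup φ (algebraMap ℝ M ‖a‖) = _
  rw [(IsSelfAdjoint.of_nonneg ha).coe_realPart,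
    posSup_add hC0 hC ht ha (algebraMap_nonneg M (norm_nonneg a))]
  ring

theorem abs_posPartFun_le {φ : M →ₗ[ℝ] ℝ} {C : ℝ} (hC0 : 0 ≤ C) (hC : ∀ x, |φ x| ≤ C * ‖x‖)
    (ht : ∀ x, φ (star x * x) = φ (x * star x)) (x : M) :
    |posPartFun hC0 hC ht x| ≤ 2 * C * ‖x‖ := by
  have h1 := IsSelfAdjoint.neg_algebraMap_norm_le_self (realPart x).2
  have h2 : algebraMap ℝ M ‖(realPart x : M)‖ ≤ algebraMap ℝ M ‖x‖ :=
    algebraMap_mono M (realPart.norm_le x)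
  have pos : 0 ≤ (realPart x : M) + algebraMap ℝ M ‖x‖ := by
    rw [← neg_le_iff_add_nonneg]
    exact (neg_le_neg h2).trans h1
  have pos' : 0 ≤ algebraMap ℝ M ‖x‖ := algebraMap_nonneg M (norm_nonneg x)
  have n1 : ‖algebraMap ℝ M ‖x‖‖ ≤ ‖x‖ := by
    cases subsingleton_or_nontrivial M
    · rw [Subsingleton.elim (algebraMap ℝ M ‖x‖) 0, norm_zero]
      exact norm_nonneg x
    · rw [norm_algebraMap', norm_norm]
  have n2 : ‖(realPart x : M) + algebraMap ℝ M ‖x‖‖ ≤ 2 * ‖x‖ := by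
    refine (norm_add_le _ _).trans ?_
    have := realPart.norm_le x
    have e : ‖(realPart x : M)‖ = ‖realPart x‖ := rfl
    linarith
  have a1 := posSup_le_norm hC0 hC pos
  have a2 := posSup_le_norm hC0 hC pos'
  have a3 := posSup_nonneg hC0 hC pos
  have a4 := posSup_nonneg hC0 hC pos'
  have b1 := mul_le_mul_of_nonneg_left n2 hC0
  have b2 := mul_le_mul_of_nonneg_left n1 hC0
  have b3 := mul_nonneg hC0 (norm_nonneg x)
  change |posSup φ ((realPart x : M) + algebraMap ℝ M ‖x‖) - posSup φ (algebraMap ℝ M ‖x‖)| ≤ _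
  rw [abs_le]
  constructor <;> linarith

-- For self-adjoint `x`, invariance under the star gives `χ(i x) = χ(-i x)`, so `χ(i x) = 0` and the
-- complexification has no imaginary part at `x`.
omit [PartialOrder M] [StarOrderedRing M] in
theorem StrongDual.extendRCLike_of_isSelfAdjoint (χ : StrongDual ℝ M)
    (hs : ∀ x, χ (star x) = χ x) {x : M} (hx : IsSelfAdjoint x) :
    (χ.extendRCLike : StrongDual ℂ M) x = (χ x : ℂ) := by
  have h : χ (Complex.I • x) = 0 := by
    have := hs (Complex.I • x)
    rw [star_smul, hx.star_eq, Complex.star_def, Complex.conj_I, neg_smul, map_neg] at this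
    linarith
  refine (Module.Dual.extendRCLike_apply (𝕜 := ℂ) χ.toLinearMap x).trans ?_
  change (χ x : ℂ) - Complex.I * (χ (Complex.I • x) : ℂ) = χ x
  rw [h]
  simp

/-- A positive bounded functional which is invariant under unitary conjugation is tracial, hence
is controlled by the tracial states. -/
theorem abs_le_of_forall_tracialState (χ : StrongDual ℝ M) (hs : ∀ x, χ (star x) = χ x)
    (hpos : ∀ x, 0 ≤ x → 0 ≤ χ x)
    (hu : ∀ x, 0 ≤ x → ∀ u : unitary M, χ (star (u : M) * x * u) = χ x) {a : M}
    (ha : IsSelfAdjoint a) {m : ℝ}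
    (hm : ∀ τ : TracialState M, |((τ : WeakDual ℂ M) a).re| ≤ m) : |χ a| ≤ χ 1 * m := by
  have h10 : 0 ≤ χ 1 := hpos 1 zero_le_one
  rcases h10.eq_or_lt with h1 | h1
  -- Here `χ` cannot be normalised to a state, but positivity at `‖a‖ ± a` together with `χ 1 = 0`
  -- forces `χ a = 0`.
  · have e1 := hpos _ (sub_nonneg.2 ha.le_algebraMap_norm_self)
    have e2 := hpos _ (sub_nonneg.2 ha.neg_algebraMap_norm_le_self)
    rw [map_sub, Algebra.algebraMap_eq_smul_one] at e1 e2
    rw [map_neg] at e2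
    rw [map_smul, ← h1, smul_zero] at e1 e2
    rw [← h1, zero_mul, abs_le]
    constructor <;> linarith
  · let ψ : StrongDual ℂ M := χ.extendRCLike
    have hψ : ∀ {x : M}, IsSelfAdjoint x → ψ x = (χ x : ℂ) := fun hx =>
      StrongDual.extendRCLike_of_isSelfAdjoint χ hs hx
    have hψu : ∀ (x : M) (u : unitary M), ψ (star (u : M) * x * u) = ψ x := by
      intro x u
      have hx : x ∈ Submodule.span ℂ {a : M | 0 ≤ a} := by
        rw [CStarAlgebra.span_nonneg]; trivial
      induction hx using Submodule.span_induction with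
      | mem x hx =>
        have hx : 0 ≤ x := hx
        rw [hψ (.of_nonneg (star_left_conjugate_nonneg hx _)), hψ (.of_nonneg hx), hu x hx u]
      | zero => simp
      | add x y _ _ hx hy => rw [mul_add, add_mul, map_add, map_add, hx, hy]
      | smul c x _ hx => rw [mul_smul_comm, smul_mul_assoc, map_smul, map_smul, hx]
    -- The unitaries span `M`, and for a unitary `u` the element `x u` is the conjugate `u⋆ (u x)
    -- u`.
    have htr : ∀ x y : M, ψ (x * y) = ψ (y * x) := by
      intro x y
      have hy : y ∈ Submodule.span ℂ (unitary M : Set M) := by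
        rw [CStarAlgebra.span_unitary]; trivial
      induction hy using Submodule.span_induction with
      | mem u hu' =>
        have := hψu (u * x) ⟨u, hu'⟩
        rw [← this]
        congr 1
        rw [← mul_assoc, Unitary.star_mul_self_of_mem hu', one_mul]
      | zero => simp
      | add y z _ _ hy hz => rw [mul_add, add_mul, map_add, map_add, hy, hz]
      | smul c y _ hy => rw [mul_smul_comm, smul_mul_assoc, map_smul, map_smul, hy]
    let τ : WeakDual ℂ M := StrongDual.toWeakDual (((χ 1)⁻¹ : ℂ) • ψ)
    have hτ : ∀ x, τ x = ((χ 1)⁻¹ : ℂ) * ψ x := fun x => rfl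
    have hτT : τ ∈ TracialState M := by
      refine ⟨?_, fun x => ?_, fun x y => ?_⟩
      · rw [hτ, hψ (.one M), inv_mul_cancel₀]
        exact_mod_cast h1.ne'
      · rw [hτ, hψ (.star_mul_self x)]
        have := hpos _ (star_mul_self_nonneg x)
        rw [← Complex.ofReal_inv, ← Complex.ofReal_mul]
        exact_mod_cast mul_nonneg (inv_nonneg.2 h10) this
      · rw [hτ, hτ, htr]
    have := hm ⟨τ, hτT⟩
    change |(τ a).re| ≤ m at this
    rw [hτ, hψ ha, ← Complex.ofReal_inv, ← Complex.ofReal_mul, Complex.ofReal_re, abs_mul,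
      abs_inv, abs_of_pos h1, inv_mul_le_iff₀ h1] at this
    exact this

/-- Bounded tracial functionals are controlled by the tracial states. -/
theorem abs_le_three_mul_of_forall_tracialState (φ : M →ₗ[ℝ] ℝ) {C : ℝ} (hC0 : 0 ≤ C)
    (hC : ∀ x, |φ x| ≤ C * ‖x‖) (hs : ∀ x, φ (star x) = φ x)
    (ht : ∀ x, φ (star x * x) = φ (x * star x)) {a : M} (ha : IsSelfAdjoint a) {m : ℝ}
    (hm0 : 0 ≤ m) (hm : ∀ τ : TracialState M, |((τ : WeakDual ℂ M) a).re| ≤ m) :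
    |φ a| ≤ 3 * C * m := by
  let P := posPartFun hC0 hC ht
  have hPc : Continuous P := by
    refine AddMonoidHomClass.continuous_of_bound P (2 * C) fun x => ?_
    rw [Real.norm_eq_abs]
    exact abs_posPartFun_le hC0 hC ht x
  let χ : StrongDual ℝ M := P.toRealLinearMap hPc
  have hχ : ∀ {x : M}, 0 ≤ x → χ x = posSup φ x := fun hx => posPartFun_of_nonneg hC0 hC ht hx
  have hχs : ∀ x, χ (star x) = χ x := by
    intro x
    change posSup φ ((realPart (star x) : M) + algebraMap ℝ M ‖star x‖) -
      posSup φ (algebraMap ℝ M ‖star x‖) = posSup φ ((realPart x : M) + algebraMap ℝ M ‖x‖) -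
      posSup φ (algebraMap ℝ M ‖x‖)
    rw [norm_star, show realPart (star x) = realPart x by
      ext; simp [realPart_apply_coe, add_comm]]
  let η : StrongDual ℝ M := φ.mkContinuous C hC
  have hη : ∀ x, η x = φ x := fun _ => rfl
  -- Jordan decomposition: `χ` and `χ - φ` are both positive and unitarily invariant, with values at
  -- `1` at most `C` and `2C`. This is the origin of the factor 3.
  have e1 := abs_le_of_forall_tracialState χ hχs (fun x hx => by
    rw [hχ hx]; exact posSup_nonneg hC0 hC hx) (fun x hx u => by
    rw [hχ hx, hχ (star_left_conjugate_nonneg hx _), posSup_unitary_conj hC0 hC ht hx]) ha hm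
  have e2 := abs_le_of_forall_tracialState (χ - η) (fun x => by
    rw [sub_apply, sub_apply, hχs, hη, hη, hs])
    (fun x hx => by
    rw [sub_apply, hχ hx, hη, sub_nonneg]
    exact le_posSup hC0 hC hx le_rfl) (fun x hx u => by
    rw [sub_apply, sub_apply, hχ hx,
      hχ (star_left_conjugate_nonneg hx _), posSup_unitary_conj hC0 hC ht hx, hη, hη,
      unitary_conj_functional ht hx]) ha hm
  rw [sub_apply, sub_apply, hη, hη] at e2
  have n1 : ‖(1 : M)‖ ≤ 1 := by
    cases subsingleton_or_nontrivial M
    · rw [Subsingleton.elim (1 : M) 0, norm_zero]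
      exact zero_le_one
    · rw [norm_one]
  have e3 : χ 1 ≤ C := by
    rw [hχ zero_le_one]
    exact (posSup_le_norm hC0 hC zero_le_one).trans (mul_le_of_le_one_right hC0 n1)
  have e4 : |φ 1| ≤ C := (hC 1).trans (mul_le_of_le_one_right hC0 n1)
  have e5 := (abs_le.1 e4).1
  have e6 : |φ a| ≤ |χ a| + |χ a - φ a| := by
    have := abs_sub (χ a) (χ a - φ a)
    rwa [sub_sub_cancel] at this
  have e7 := mul_le_mul_of_nonneg_right e3 hm0
  have e8 : (χ 1 - φ 1) * m ≤ 2 * C * m := mul_le_mul_of_nonneg_right (by linarith) hm0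
  linarith

end TracialFunctionals

/-! ### Continuous affine functions on the trace space -/

section AffineFunctions

variable {M : Type u} [CStarAlgebra M]

theorem hat_apply (a : M) (τ : TracialState M) :
    (hat a : C(TracialState M, ℝ)) τ = ((τ : WeakDual ℂ M) a).re := rfl

theorem AffT.ext {f g : AffT M}
    (h : ∀ τ, (f : C(TracialState M, ℝ)) τ = (g : C(TracialState M, ℝ)) τ) : f = g :=
  Subtype.ext (ContinuousMap.ext h)

/-- The map `a ↦ â` as a real linear map. -/
def hatHom : M →ₗ[ℝ] AffT M where
  toFun := hat
  map_add' a b := AffT.ext fun τ => by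
    change ((τ : WeakDual ℂ M) (a + b)).re = ((τ : WeakDual ℂ M) a).re + ((τ : WeakDual ℂ M) b).re
    rw [map_add, Complex.add_re]
  map_smul' r a := AffT.ext fun τ => by
    change ((τ : WeakDual ℂ M) (r • a)).re = r * ((τ : WeakDual ℂ M) a).re
    rw [← Complex.coe_smul, map_smul, smul_eq_mul, Complex.re_ofReal_mul]

theorem hatHom_apply (a : M) : hatHom a = hat a := rfl

theorem norm_hat_le (a : M) : ‖hat a‖ ≤ 4 * ‖a‖ := by
  refine (ContinuousMap.norm_le _ (by positivity)).2 fun τ => ?_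
  change ‖((τ : WeakDual ℂ M) a).re‖ ≤ _
  rw [Real.norm_eq_abs]
  exact (Complex.abs_re_le_norm _).trans (TracialState.norm_apply_le τ a)

theorem continuous_hat : Continuous (hat : M → AffT M) :=
  AddMonoidHomClass.continuous_of_bound (hatHom : M →ₗ[ℝ] AffT M) 4 norm_hat_le

theorem abs_apply_le_norm_hat (a : M) (τ : TracialState M) :
    |((τ : WeakDual ℂ M) a).re| ≤ ‖hat a‖ :=
  ContinuousMap.norm_coe_le_norm (hat a : C(TracialState M, ℝ)) τ

variable (M) in
/-- The closed real span of the elements `x⋆x - xx⋆`. -/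
def traceNull : Submodule ℝ M :=
  (Submodule.span ℝ (Set.range fun x : M => star x * x - x * star x)).topologicalClosure

theorem traceNull_induction {p : M → Prop} (hp : IsClosed {x | p x}) (h0 : p 0)
    (hadd : ∀ x y, p x → p y → p (x + y)) (hsmul : ∀ (r : ℝ) x, p x → p (r • x))
    (h : ∀ x : M, p (star x * x - x * star x)) {a : M} (ha : a ∈ traceNull M) : p a := by
  refine closure_minimal (t := {x | p x}) (fun x hx => ?_) hp ha
  induction hx using Submodule.span_induction with
  | mem x hx => obtain ⟨y, rfl⟩ := hx; exact h y
  | zero => exact h0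
  | add x y _ _ hx hy => exact hadd x y hx hy
  | smul r x _ hx => exact hsmul r x hx

theorem isSelfAdjoint_of_mem_traceNull {a : M} (ha : a ∈ traceNull M) : IsSelfAdjoint a :=
  traceNull_induction (p := IsSelfAdjoint) (isClosed_eq continuous_star continuous_id) (.zero M)
    (fun _ _ hx hy => hx.add hy) (fun r _ hx => (IsSelfAdjoint.all r).smul hx)
    (fun x => (IsSelfAdjoint.star_mul_self x).sub (.mul_star_self x)) ha

theorem hat_eq_zero_of_mem_traceNull {a : M} (ha : a ∈ traceNull M) : hat a = 0 := by
  refine traceNull_induction (p := fun a => hat a = 0)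
    (isClosed_eq continuous_hat continuous_const) (map_zero hatHom) (fun x y hx hy => ?_)
    (fun r x hx => ?_) (fun x => ?_) ha
  · rw [← hatHom_apply, map_add, hatHom_apply, hatHom_apply, hx, hy, add_zero]
  · rw [← hatHom_apply, map_smul, hatHom_apply, hx, smul_zero]
  · refine AffT.ext fun τ => ?_
    rw [hat_apply, map_sub, τ.2.2.2 (star x) x, sub_self]
    rfl

variable [PartialOrder M] [StarOrderedRing M]

/-- By Hahn–Banach, the norm of `a` in the quotient by `traceNull M` is attained by a contractive
functional. Its pullback, composed with the real part, is tracial, so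
`abs_le_three_mul_of_forall_tracialState` bounds the quotient norm by `3‖â‖`. -/
theorem exists_sub_mem_traceNull {a : M} (ha : IsSelfAdjoint a) {ε : ℝ} (hε : 0 < ε) :
    ∃ b : M, IsSelfAdjoint b ∧ a - b ∈ traceNull M ∧ ‖b‖ < 3 * ‖hat a‖ + ε := by
  have : IsClosed (traceNull M : Set M) := Submodule.isClosed_topologicalClosure _
  obtain ⟨g, hg1, hg⟩ := exists_dual_vector'' ℝ ((traceNull M).mkQ a)
  have hn : ∀ x : M, ‖(traceNull M).mkQ x‖ ≤ ‖x‖ := fun x => Submodule.Quotient.norm_mk_le _ x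
  let f : M →ₗ[ℝ] ℝ := g.toLinearMap ∘ₗ (traceNull M).mkQ
  have hf : ∀ x, |f x| ≤ ‖x‖ := fun x =>
    (g.le_opNorm _).trans ((mul_le_mul hg1 (hn x) (norm_nonneg _) zero_le_one).trans
      (one_mul _).le)
  let φ : M →ₗ[ℝ] ℝ := f ∘ₗ (selfAdjoint.submodule ℝ M).subtype ∘ₗ realPart
  have hφ : ∀ x, φ x = f (realPart x : M) := fun _ => rfl
  have hφs : ∀ {x}, IsSelfAdjoint x → φ x = f x := fun {x} hx => by rw [hφ, hx.coe_realPart]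
  have hφ0 : ∀ x, |φ x| ≤ 1 * ‖x‖ := fun x => by
    rw [one_mul]; exact (hf _).trans (realPart.norm_le x)
  have key := abs_le_three_mul_of_forall_tracialState φ zero_le_one hφ0 (fun x => by
      rw [hφ, hφ, show realPart (star x) = realPart x by
        ext; simp [realPart_apply_coe, add_comm]])
    (fun x => by
      rw [hφs (.star_mul_self x), hφs (.mul_star_self x), ← sub_eq_zero, ← map_sub]
      change g ((traceNull M).mkQ _) = 0
      rw [Submodule.mkQ_apply, (Submodule.Quotient.mk_eq_zero _).2, map_zero]
      exact Submodule.le_topologicalClosure _ (Submodule.subset_span ⟨x, rfl⟩)) ha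
    (norm_nonneg (hat a)) (abs_apply_le_norm_hat a)
  have e : φ a = ‖(traceNull M).mkQ a‖ := by rw [hφs ha]; exact hg
  rw [e, abs_of_nonneg (norm_nonneg _), mul_one] at key
  obtain ⟨b, hb, hbn⟩ := Submodule.Quotient.norm_mk_lt ((traceNull M).mkQ a) hε
  have hab : a - b ∈ traceNull M := (Submodule.Quotient.eq _).1 hb.symm
  refine ⟨b, ?_, hab, by linarith⟩
  have := ha.sub (isSelfAdjoint_of_mem_traceNull hab)
  rwa [sub_sub_cancel] at this

theorem mem_traceNull_of_hat_eq_zero {a : M} (ha : IsSelfAdjoint a) (h : hat a = 0) :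
    a ∈ traceNull M := by
  have hc : IsClosed (traceNull M : Set M) := Submodule.isClosed_topologicalClosure _
  refine hc.closure_subset (Metric.mem_closure_iff.2 fun ε hε => ?_)
  obtain ⟨b, -, hab, hb⟩ := exists_sub_mem_traceNull ha hε
  refine ⟨a - b, hab, ?_⟩
  rw [dist_eq_norm, sub_sub_cancel]
  simpa [h] using hb

/-- The norm control is used twice: for the surjectivity of `a ↦ â` and for the continuity of the
splitting. -/
theorem exists_hat_eq_norm_lt {a : M} (ha : IsSelfAdjoint a) {ε : ℝ} (hε : 0 < ε) :
    ∃ b : M, IsSelfAdjoint b ∧ hat b = hat a ∧ ‖b‖ < 3 * ‖hat a‖ + ε := by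
  obtain ⟨b, hb, hab, hn⟩ := exists_sub_mem_traceNull ha hε
  refine ⟨b, hb, ?_, hn⟩
  have := hat_eq_zero_of_mem_traceNull hab
  rw [← hatHom_apply, map_sub, sub_eq_zero] at this
  exact this.symm

open scoped ComplexOrder in
omit [PartialOrder M] [StarOrderedRing M] in
/-- A tracial state is real on self-adjoint elements. -/
theorem TracialState.apply_eq_re (τ : TracialState M) {a : M} (ha : IsSelfAdjoint a) :
    (τ : WeakDual ℂ M) a = (((τ : WeakDual ℂ M) a).re : ℂ) := by
  let _ := CStarAlgebra.spectralOrder M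
  have _ := CStarAlgebra.spectralOrderedRing M
  obtain ⟨y, hy⟩ := CStarAlgebra.nonneg_iff_eq_star_mul_self.1
    (sub_nonneg.2 ha.le_algebraMap_norm_self)
  have h := τ.2.2.1 y
  rw [← hy, map_sub, Algebra.algebraMap_eq_smul_one, ← Complex.coe_smul, map_smul, τ.2.1,
    smul_eq_mul, mul_one, Complex.le_def] at h
  have h2 := h.2
  simp only [Complex.sub_im, Complex.ofReal_im, Complex.zero_im] at h2
  apply Complex.ext
  · rfl
  · rw [Complex.ofReal_im]
    linarith

open scoped ComplexOrder in
omit [PartialOrder M] [StarOrderedRing M] in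
/-- A continuous affine function on the trace space is uniformly approximated by functions `â`. -/
theorem exists_norm_hat_sub_lt (f : AffT M) {ε : ℝ} (hε : 0 < ε) :
    ∃ a : M, IsSelfAdjoint a ∧ ‖f - hat a‖ ≤ ε := by
  cases isEmpty_or_nonempty (TracialState M) with
  | inl h =>
    exact ⟨0, .zero M, (ContinuousMap.norm_le _ hε.le).2 fun τ => h.elim τ⟩
  | inr hne =>
  obtain ⟨τ₀⟩ := hne
  -- The algebraic dual of the self-adjoint part carries the topology of pointwise convergence,
  -- whose continuous functionals are exactly the evaluations at self-adjoint elements.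
  let B : Module.Dual ℝ (selfAdjoint M) →ₗ[ℝ] selfAdjoint M →ₗ[ℝ] ℝ := LinearMap.id
  let e : TracialState M → WeakBilin B := fun τ =>
    (Complex.reLm ∘ₗ ((WeakDual.toStrongDual (τ : WeakDual ℂ M)).toLinearMap.restrictScalars ℝ) ∘ₗ
      (selfAdjoint.submodule ℝ M).subtype : selfAdjoint M →ₗ[ℝ] ℝ)
  have he : ∀ (τ : TracialState M) (a : selfAdjoint M), B (e τ) a = ((τ : WeakDual ℂ M) a).re :=
    fun _ _ => rfl
  have hec : Continuous e := WeakBilin.continuous_of_continuous_eval _ fun a =>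
    Complex.continuous_re.comp ((WeakDual.eval_continuous (a : M)).comp continuous_subtype_val)
  let F : C(TracialState M, ℝ) := f
  let graph : ℝ → Set (WeakBilin B × ℝ) := fun r => Set.range fun τ => (e τ, F τ + r)
  have hK : ∀ r, IsCompact (graph r) := fun r =>
    isCompact_range (hec.prodMk (F.continuous.add continuous_const))
  have hconv : ∀ r, Convex ℝ (graph r) := by
    rintro r _ ⟨σ, rfl⟩ _ ⟨τ, rfl⟩ s t hs ht hst
    obtain rfl : t = 1 - s := by linarith
    let ρ : WeakDual ℂ M := (s : ℂ) • (σ : WeakDual ℂ M) + ((1 - s : ℝ) : ℂ) • (τ : WeakDual ℂ M)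
    have hρa : ∀ a, ρ a = s * (σ : WeakDual ℂ M) a + ((1 - s : ℝ) : ℂ) * (τ : WeakDual ℂ M) a :=
      fun _ => rfl
    have hρ : ρ ∈ TracialState M := by
      refine ⟨?_, fun a => ?_, fun a b => ?_⟩
      · rw [hρa, σ.2.1, τ.2.1]; push_cast; ring
      · rw [hρa]
        exact add_nonneg (mul_nonneg (by exact_mod_cast hs) (σ.2.2.1 a))
          (mul_nonneg (by exact_mod_cast ht) (τ.2.2.1 a))
      · rw [hρa, hρa, σ.2.2.2, τ.2.2.2]
    refine ⟨⟨ρ, hρ⟩, Prod.ext ?_ ?_⟩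
    · refine LinearMap.ext (R := ℝ) (M := selfAdjoint M) fun a => ?_
      change (ρ a).re = s * ((σ : WeakDual ℂ M) a).re + (1 - s) * ((τ : WeakDual ℂ M) a).re
      rw [hρa, Complex.add_re, Complex.re_ofReal_mul, Complex.re_ofReal_mul]
    · have := f.2 ⟨ρ, hρ⟩ σ τ s hs (by linarith) rfl
      change F ⟨ρ, hρ⟩ + r = s * (F σ + r) + (1 - s) * (F τ + r)
      have e' : F ⟨ρ, hρ⟩ = s * F σ + (1 - s) * F τ := this
      rw [e']; ring
  have hdisj : Disjoint (graph 0) (graph ε) := by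
    rw [Set.disjoint_left]
    rintro _ ⟨σ, rfl⟩ ⟨τ, hτ⟩
    rw [Prod.mk.injEq] at hτ
    have : σ = τ := by
      refine Subtype.ext (DFunLike.ext _ _ fun a => ?_)
      have key : ∀ b : selfAdjoint M, (σ : WeakDual ℂ M) b = (τ : WeakDual ℂ M) b := fun b => by
        rw [TracialState.apply_eq_re σ b.2, TracialState.apply_eq_re τ b.2, ← he, ← he, hτ.1]
      rw [← realPart_add_I_smul_imaginaryPart a, map_add, map_add, map_smul, map_smul, key, key]
    subst this
    linarith [hτ.2]
  have : T2Space (WeakBilin B) := (WeakBilin.isEmbedding (B := B) fun x y h => h).t2Space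
  -- A hyperplane separates the graphs of `F` and `F + ε`. Once it is known not to be vertical (`0 <
  -- c`), it is the graph of the function `(u - â) / c`, which lies between the two.
  obtain ⟨L, u, v, h1, huv, h2⟩ := geometric_hahn_banach_compact_closed (hconv 0) (hK 0) (hconv ε)
    (hK ε).isClosed hdisj
  obtain ⟨a, ha⟩ := LinearMap.dualEmbedding_surjective B
    (L.comp (ContinuousLinearMap.inl ℝ (WeakBilin B) ℝ))
  have hLa : ∀ τ : TracialState M, L (e τ, 0) = ((τ : WeakDual ℂ M) a).re := fun τ =>
    (DFunLike.congr_fun ha (e τ)).symm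
  set c := L (0, 1) with hc
  have hL : ∀ (τ : TracialState M) (r : ℝ), L (e τ, r) = ((τ : WeakDual ℂ M) a).re + r * c := by
    intro τ r
    rw [← hLa, hc, ← smul_eq_mul, ← map_smul, ← map_add]
    simp
  have h1' : ∀ τ : TracialState M, ((τ : WeakDual ℂ M) a).re + F τ * c < u := fun τ => by
    have := h1 _ ⟨τ, rfl⟩
    rwa [hL, add_zero] at this
  have h2' : ∀ τ : TracialState M, u < ((τ : WeakDual ℂ M) a).re + (F τ + ε) * c := fun τ => by
    have := h2 _ ⟨τ, rfl⟩
    rw [hL] at this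
    exact huv.trans this
  have hc0 : 0 < c := by
    have := (h1' τ₀).trans (h2' τ₀)
    have : 0 < ε * c := by linarith
    exact (pos_iff_pos_of_mul_pos this).1 hε
  refine ⟨c⁻¹ • (u • 1 - (a : M)), (IsSelfAdjoint.all _).smul (((IsSelfAdjoint.all _).smul
    (.one M)).sub a.2), (ContinuousMap.norm_le _ hε.le).2 fun τ => ?_⟩
  have e1 : ((τ : WeakDual ℂ M) (c⁻¹ • (u • 1 - (a : M)))).re =
      c⁻¹ * (u - ((τ : WeakDual ℂ M) a).re) := by
    have := τ.2.1
    rw [← Complex.coe_smul, map_smul, map_sub, ← Complex.coe_smul u, map_smul, τ.2.1, smul_eq_mul,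
      smul_eq_mul, mul_one, Complex.re_ofReal_mul, Complex.sub_re, Complex.ofReal_re]
  change ‖F τ - ((τ : WeakDual ℂ M) (c⁻¹ • (u • 1 - (a : M)))).re‖ ≤ ε
  have p1 := h1' τ
  have p2 := h2' τ
  rw [e1, Real.norm_eq_abs, abs_le, ← mul_le_mul_iff_of_pos_right hc0,
    ← mul_le_mul_iff_of_pos_right hc0 (b := F τ - _), sub_mul, mul_comm c⁻¹, mul_assoc,
    inv_mul_cancel₀ hc0.ne']
  constructor <;> linarith

/-- The range is dense by `exists_norm_hat_sub_lt`, and each of its elements has a lift of norm at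
most four times its own. As the self-adjoint part is complete, successive approximation reaches all
of the closure. -/
theorem exists_hat_eq (f : AffT M) : ∃ a : M, IsSelfAdjoint a ∧ hat a = f := by
  have hcomp : CompleteSpace (selfAdjoint M) :=
    (isClosed_eq continuous_star continuous_id : IsClosed {x : M | star x = x}).completeSpace_coe
  let T : NormedAddGroupHom (selfAdjoint M) (AffT M) :=
    { toFun := fun a => hat (a : M)
      map_add' := fun a b => map_add hatHom (a : M) (b : M)
      bound' := ⟨4, fun a => norm_hat_le (a : M)⟩ }
  have hT : T.SurjectiveOnWith T.range 4 := by
    rintro _ ⟨a, rfl⟩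
    -- The constant 4 is `3 + 1`, with `ε = ‖T a‖`; this needs `T a ≠ 0`.
    rcases (norm_nonneg (T a)).eq_or_lt with h | h
    · exact ⟨0, by rw [map_zero]; exact (norm_eq_zero.1 h.symm).symm, by simp⟩
    · obtain ⟨b, hb, hba, hn⟩ := exists_hat_eq_norm_lt a.2 h
      refine ⟨⟨b, hb⟩, hba, ?_⟩
      have : ‖b‖ < 3 * ‖T a‖ + ‖T a‖ := hn
      change ‖b‖ ≤ 4 * ‖T a‖
      linarith
  obtain ⟨a, ha, -⟩ := controlled_closure_of_complete (by norm_num) one_pos hT f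
    (Metric.mem_closure_iff.2 fun ε hε => by
      obtain ⟨a, ha, hn⟩ := exists_norm_hat_sub_lt f (half_pos hε)
      refine ⟨hat a, ⟨⟨a, ha⟩, rfl⟩, ?_⟩
      rw [dist_eq_norm]
      exact hn.trans_lt (half_lt_self hε))
  exact ⟨a, a.2, ha⟩

end AffineFunctions

/-! ### Exponentials and logarithms -/

section ExpLog

variable {M : Type u} [CStarAlgebra M]

theorem exp_mul_exp_neg (a : M) : NormedSpace.exp a * NormedSpace.exp (-a) = 1 :=
  (expUnit a).val_inv

theorem exp_neg_mul_exp (a : M) : NormedSpace.exp (-a) * NormedSpace.exp a = 1 :=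
  (expUnit a).inv_val

theorem contDiff_exp : ContDiff ℝ 1 (NormedSpace.exp : M → M) :=
  contDiff_iff_contDiffAt.2 fun x => (NormedSpace.exp_analytic (𝕂 := ℝ) x).contDiffAt

theorem continuous_exp : Continuous (NormedSpace.exp : M → M) := contDiff_exp.continuous

theorem exp_nsmul_pow (n : ℕ) (a : M) : NormedSpace.exp (n • a) = NormedSpace.exp a ^ n := by
  let _ : NormedAlgebra ℚ M := NormedAlgebra.restrictScalars ℚ ℂ M
  exact NormedSpace.exp_nsmul n a

theorem exp_inv_smul_pow {n : ℕ} (hn : n ≠ 0) (a : M) :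
    NormedSpace.exp ((n : ℝ)⁻¹ • a) ^ n = NormedSpace.exp a := by
  rw [← exp_nsmul_pow, ← Nat.cast_smul_eq_nsmul ℝ, smul_smul,
    mul_inv_cancel₀ (Nat.cast_ne_zero.2 hn), one_smul]

theorem isStrictlyPositive_exp [PartialOrder M] [StarOrderedRing M] {a : M}
    (ha : IsSelfAdjoint a) : IsStrictlyPositive (NormedSpace.exp a) :=
  IsUnit.isStrictlyPositive (expUnit a).isUnit ha.exp_nonneg

/-- The power series of `log (1 - x)`. -/
def logOneSub (r : M) : M :=
  -- The constant coefficient is `-0⁻¹ = 0`, as it should be.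
  FormalMultilinearSeries.ofScalarsSum (fun n : ℕ => -(n : ℝ)⁻¹) r

theorem hasFPowerSeriesOnBall_logOneSub : HasFPowerSeriesOnBall (logOneSub : M → M)
    (FormalMultilinearSeries.ofScalars M fun n : ℕ => -(n : ℝ)⁻¹) 0 1 := by
  have h : 1 ≤ (FormalMultilinearSeries.ofScalars M fun n : ℕ => -(n : ℝ)⁻¹).radius := by
    have := FormalMultilinearSeries.inv_le_ofScalars_radius_of_tendsto M
      (fun n : ℕ => -(n : ℝ)⁻¹) (r := 1) one_ne_zero (by
        have h := tendsto_natCast_div_add_atTop (1 : ℝ)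
        refine h.congr' ?_
        filter_upwards [Filter.eventually_gt_atTop 0] with n hn
        simp only [norm_neg, norm_inv, Nat.succ_eq_add_one, RCLike.norm_natCast]
        rw [inv_div_inv]
        push_cast
        rfl)
    simpa using this
  exact (FormalMultilinearSeries.hasFPowerSeriesOnBall _ (one_pos.trans_le h)).mono one_pos h

theorem differentiableAt_logOneSub {r : M} (hr : ‖r‖ < 1) : DifferentiableAt ℝ logOneSub r := by
  refine (hasFPowerSeriesOnBall_logOneSub.analyticAt_of_mem ?_).differentiableAt
  rw [Metric.mem_eball, edist_zero_right, ← ofReal_norm]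
  exact ENNReal.ofReal_lt_one.2 hr

/-- The partial sums converge uniformly to `log (1 - x)` on the spectrum, so their functional
calculi converge to that of the limit; they also converge to the norm-convergent series. -/
theorem log_one_sub_eq {r : M} (hr : ‖r‖ < 1) (hs : IsSelfAdjoint r) :
    CFC.log (1 - r) = logOneSub r := by
  obtain ⟨q, hrq, hq⟩ := exists_between hr
  have hq0 : 0 ≤ q := (norm_nonneg r).trans hrq.le
  let q' : NNReal := ⟨q, hq0⟩
  have hsp : ∀ x ∈ spectrum ℝ r, |x| ≤ ‖r‖ := fun x hx => by
    cases subsingleton_or_nontrivial M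
    · simp [spectrum.of_subsingleton] at hx
    · exact spectrum.norm_le_norm_of_mem hx
  let F : ℕ → ℝ → ℝ := fun n x => ∑ k ∈ Finset.range n, -(k : ℝ)⁻¹ * x ^ k
  have hF : TendstoUniformlyOn F (fun x => Real.log (1 - x)) Filter.atTop (spectrum ℝ r) := by
    have h1 := (hasFPowerSeriesOnBall_logOneSub (M := ℂ)).tendstoUniformlyOn (r' := q')
      (by exact_mod_cast hq)
    rw [Metric.tendstoUniformlyOn_iff] at h1 ⊢
    intro ε hε
    filter_upwards [h1 ε hε] with n hn x hx
    have hx1 : |x| < 1 := (hsp x hx).trans_lt hr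
    have := hn x (by
      rw [Metric.mem_ball, dist_zero_right, Complex.norm_real]
      exact (hsp x hx).trans_lt hrq)
    have e1 : FormalMultilinearSeries.partialSum
        (FormalMultilinearSeries.ofScalars ℂ fun n : ℕ => -(n : ℝ)⁻¹) n (x : ℂ) = (F n x : ℝ) := by
      simp only [FormalMultilinearSeries.partialSum, F, FormalMultilinearSeries.ofScalars_apply_eq,
        Complex.real_smul]
      push_cast
      rfl
    have e2 : logOneSub (0 + (x : ℂ)) = (Real.log (1 - x) : ℝ) := by
      rw [zero_add]
      have := (Real.hasSum_pow_div_log_of_abs_lt_one hx1)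
      have h2 : HasSum (fun n : ℕ => -(n : ℝ)⁻¹ * x ^ n) (Real.log (1 - x)) := by
        rw [← hasSum_nat_add_iff' 1]
        simp only [Finset.sum_range_one, Nat.cast_zero, inv_zero, neg_zero, zero_mul, sub_zero]
        have h4 := this.neg
        rw [neg_neg] at h4
        have h5 : (fun k : ℕ => -((k + 1 : ℕ) : ℝ)⁻¹ * x ^ (k + 1)) =
            fun k : ℕ => -(x ^ (k + 1) / ((k : ℝ) + 1)) := by
          funext k; push_cast; ring
        rw [h5]
        exact h4
      have h3 := Complex.hasSum_ofReal.2 h2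
      rw [logOneSub, FormalMultilinearSeries.ofScalarsSum_eq_tsum, ← h3.tsum_eq]
      simp
    rw [e1, e2, Complex.dist_eq, ← Complex.ofReal_sub, Complex.norm_real] at this
    exact this
  have h2 := tendsto_cfc_fun (a := r) hF (Filter.Eventually.of_forall fun n => by
    simp only [F]; fun_prop)
  have e : CFC.log (1 - r) = cfc (fun x => Real.log (1 - x)) r := by
    rw [CFC.log]
    conv_lhs => rw [← cfc_id ℝ r, ← cfc_const_one ℝ r, ← cfc_sub _ _ r]
    rw [← cfc_comp' Real.log (fun x => 1 - id x) r (by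
      refine Real.continuousOn_log.mono ?_
      rintro _ ⟨x, hx, rfl⟩
      have := (abs_lt.1 ((hsp x hx).trans_lt hr)).2
      simp only [id, Set.mem_compl_iff, Set.mem_singleton_iff]
      intro h0
      linarith)]
    rfl
  rw [e]
  refine tendsto_nhds_unique h2 ?_
  have h3 := (hasFPowerSeriesOnBall_logOneSub (M := M)).hasSum (y := r) (by
    rw [Metric.mem_eball, edist_zero_right, ← ofReal_norm]
    exact ENNReal.ofReal_lt_one.2 hr)
  rw [zero_add] at h3
  refine h3.tendsto_sum_nat.congr fun n => ?_
  have h4 : F n = ∑ k ∈ Finset.range n, fun x => -(k : ℝ)⁻¹ * x ^ k := by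
    funext x; simp only [F, Finset.sum_apply]
  rw [h4, cfc_sum _ _ _ fun k _ => by fun_prop]
  refine Finset.sum_congr rfl fun k _ => ?_
  rw [cfc_const_mul _ _ _ (by fun_prop), cfc_pow_id r k, FormalMultilinearSeries.ofScalars_apply_eq]

variable [PartialOrder M] [StarOrderedRing M]

/-- With `ε ≤ p ≤ ‖p‖` and `c = (‖p‖ + 1)⁻¹`, the element `1 - c p` lies between `0` and `1 - c ε`.
Rescaling thus brings any strictly positive element into the range of the series for the logarithm.
-/
theorem exists_norm_one_sub_smul_lt {p : M} (hp : IsStrictlyPositive p) :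
    ∃ c : ℝ, 0 < c ∧ ‖1 - c • p‖ < 1 := by
  cases subsingleton_or_nontrivial M
  · exact ⟨1, one_pos, by rw [Subsingleton.elim (1 - (1 : ℝ) • p) 0, norm_zero]; exact one_pos⟩
  have hsa : IsSelfAdjoint p := .of_nonneg hp.nonneg
  obtain ⟨ε, hε, hεp⟩ := (CFC.exists_pos_algebraMap_le_iff hsa).2 fun x hx => hp.spectrum_pos hx
  refine ⟨(‖p‖ + 1)⁻¹, by positivity, ?_⟩
  set c := (‖p‖ + 1)⁻¹ with hc
  have hc0 : 0 < c := by positivity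
  have hcp : c * ‖p‖ ≤ 1 := by
    rw [hc, inv_mul_le_iff₀ (by positivity)]; linarith
  have h0 : 0 ≤ 1 - c • p := by
    rw [sub_nonneg]
    refine (smul_le_smul_of_nonneg_left hsa.le_algebraMap_norm_self hc0.le).trans ?_
    rw [Algebra.algebraMap_eq_smul_one, smul_smul]
    exact (smul_le_smul_of_nonneg_right hcp zero_le_one).trans (one_smul ℝ (1 : M)).le
  have h1 : 1 - c • p ≤ algebraMap ℝ M (1 - c * ε) := by
    rw [map_sub, map_one, map_mul, Algebra.algebraMap_eq_smul_one (A := M) c, smul_mul_assoc,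
      one_mul]
    exact sub_le_sub_left (smul_le_smul_of_nonneg_left hεp hc0.le) _
  have h2 : ‖1 - c • p‖ ≤ ‖algebraMap ℝ M (1 - c * ε)‖ :=
    CStarAlgebra.norm_le_norm_of_nonneg_of_le h0 h1
  have hεn : ε ≤ ‖p‖ := by
    have h3 := CStarAlgebra.norm_le_norm_of_nonneg_of_le (algebraMap_nonneg M hε.le) hεp
    rwa [norm_algebraMap', Real.norm_eq_abs, abs_of_pos hε] at h3
  rw [norm_algebraMap', Real.norm_eq_abs, abs_of_nonneg (by nlinarith)] at h2
  have := mul_pos hc0 hε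
  linarith

/-- The logarithm is, on self-adjoint elements, locally given by a differentiable function. -/
theorem exists_differentiableAt_eq_log {p₀ : M} (hp : IsStrictlyPositive p₀) :
    ∃ F : M → M, DifferentiableAt ℝ F p₀ ∧ ∀ᶠ p in 𝓝 p₀, IsSelfAdjoint p → CFC.log p = F p := by
  obtain ⟨c, hc, hn⟩ := exists_norm_one_sub_smul_lt hp
  -- `log p = log (c p) - log c`, with `c p = 1 - (1 - c p)`.
  refine ⟨fun p => logOneSub (1 - c • p) - algebraMap ℝ M (Real.log c), ?_, ?_⟩
  · have : DifferentiableAt ℝ (fun p : M => 1 - c • p) p₀ := by fun_prop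
    exact ((differentiableAt_logOneSub hn).comp p₀ this).sub_const _
  · have hcont : ContinuousAt (fun p : M => ‖1 - c • p‖) p₀ := by fun_prop
    filter_upwards [hcont.eventually_lt continuousAt_const hn] with p hp1 hps
    have hu : IsUnit (c • p) := by
      have := isUnit_one_sub_of_norm_lt_one hp1
      rwa [sub_sub_cancel] at this
    have hu' : IsUnit p := (isUnit_smul_iff (Units.mk0 c hc.ne') p).1 hu
    rw [← log_one_sub_eq hp1 ((IsSelfAdjoint.one M).sub ((IsSelfAdjoint.all c).smul hps)),
      sub_sub_cancel, CFC.log_smul p (fun x hx => ?_) hc.ne' hps, add_sub_cancel_left]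
    rintro rfl
    exact spectrum.zero_notMem ℝ hu' hx

theorem DifferentiableAt.cfc_log {p : ℝ → M} {t : ℝ} (hp : DifferentiableAt ℝ p t)
    (hsa : ∀ s, IsSelfAdjoint (p s)) (hpos : IsStrictlyPositive (p t)) :
    DifferentiableAt ℝ (fun s => CFC.log (p s)) t := by
  obtain ⟨F, hF, he⟩ := exists_differentiableAt_eq_log hpos
  refine (hF.comp t hp).congr_of_eventuallyEq ?_
  filter_upwards [hp.continuousAt.eventually he] with s hs
  exact hs (hsa s)

end ExpLog

/-! ### The Fuglede–Kadison determinant -/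

section Determinant

variable {M : Type u} [CStarAlgebra M]

/-- The derivative of a power is a sum of products with `q'` in different positions. Under a trace,
after multiplication by `q⁻ⁿ`, the positions no longer matter. -/
theorem exists_hasDerivAt_pow_of_trace {τ : StrongDual ℂ M} (hτ : ∀ x y, τ (x * y) = τ (y * x))
    {q : ℝ → M} {q' y : M} {t : ℝ} (hq : HasDerivAt q q' t) (hy : y * q t = 1) (hy' : q t * y = 1)
    (n : ℕ) : ∃ d, HasDerivAt (fun s => q s ^ n) d t ∧ τ (y ^ n * d) = n * τ (y * q') := by
  induction n with
  | zero => exact ⟨0, by simpa using hasDerivAt_const t (1 : M), by simp⟩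
  | succ n ih =>
    obtain ⟨d, hd, hd'⟩ := ih
    refine ⟨_, by simpa only [pow_succ] using! hd.fun_mul hq, ?_⟩
    have hyn : y ^ n * q t ^ n = 1 := by
      have hc : Commute y (q t) := by rw [commute_iff_eq, hy, hy']
      rw [← hc.mul_pow, hy, one_pow]
    rw [mul_add, map_add]
    have e1 : τ (y ^ (n + 1) * (d * q t)) = τ (y ^ n * d) := by
      rw [← mul_assoc, hτ, pow_succ', ← mul_assoc, ← mul_assoc, hy', one_mul]
    have e2 : y ^ (n + 1) * (q t ^ n * q') = y * q' := by
      rw [pow_succ', mul_assoc, ← mul_assoc (y ^ n), hyn, one_mul]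
    rw [e1, e2, hd']
    push_cast
    ring

/-- Under a trace, the logarithmic derivative of `exp a(t)` is `a'(t)`. -/
theorem trace_exp_neg_mul_deriv {τ : StrongDual ℂ M} (hτ : ∀ x y, τ (x * y) = τ (y * x))
    {a : ℝ → M} {a' e' : M} {t : ℝ} (ha : HasDerivAt a a' t)
    (he : HasDerivAt (fun s => NormedSpace.exp (a s)) e' t) :
    τ (NormedSpace.exp (-(a t)) * e') = τ a' := by
  let D : ℝ → M := fun r => fderiv ℝ NormedSpace.exp (r • a t) a'
  have hdiff : ∀ x : M, DifferentiableAt ℝ NormedSpace.exp x := fun x =>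
    (contDiff_exp.differentiable one_ne_zero) x
  have hcont : Continuous fun r : ℝ => τ (NormedSpace.exp (-(r • a t)) * D r) := by
    have h1 : Continuous (fderiv ℝ (NormedSpace.exp : M → M)) :=
      contDiff_exp.continuous_fderiv one_ne_zero
    have h2 : Continuous D :=
      (h1.comp (continuous_id.smul continuous_const)).clm_apply continuous_const
    exact τ.continuous.comp ((continuous_exp.comp
      (continuous_id.smul continuous_const).neg).mul h2)
  -- Since `exp a = exp(a/n)ⁿ`, the logarithmic derivative under `τ` can be computed at the base
  -- point `a/n` for every `n`. As `n` grows the base point tends to `0`, where the derivative of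
  -- `exp` is the identity.
  have hn : ∀ n : ℕ, n ≠ 0 →
      τ (NormedSpace.exp (-((n : ℝ)⁻¹ • a t)) * D (n : ℝ)⁻¹) = τ (NormedSpace.exp (-(a t)) * e') := by
    intro n hn
    have hq : HasDerivAt (fun s => NormedSpace.exp ((n : ℝ)⁻¹ • a s)) ((n : ℝ)⁻¹ • D (n : ℝ)⁻¹) t := by
      have := (hdiff ((n : ℝ)⁻¹ • a t)).hasFDerivAt.comp_hasDerivAt t (ha.const_smul (n : ℝ)⁻¹)
      rw [map_smul] at this
      exact this
    obtain ⟨d, hd, hd'⟩ := exists_hasDerivAt_pow_of_trace hτ hq (exp_neg_mul_exp _)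
      (exp_mul_exp_neg _) n
    simp only [exp_inv_smul_pow hn] at hd
    rw [hd.unique he, ← smul_neg, exp_inv_smul_pow hn, mul_smul_comm, ← Complex.coe_smul,
      map_smul, smul_eq_mul, ← mul_assoc] at hd'
    rw [hd', Complex.ofReal_inv, Complex.ofReal_natCast,
      mul_inv_cancel₀ (Nat.cast_ne_zero.2 hn), one_mul, smul_neg]
  have h0 : τ (NormedSpace.exp (-((0 : ℝ) • a t)) * D 0) = τ a' := by
    simp only [D, zero_smul, neg_zero, NormedSpace.exp_zero, one_mul]
    rw [(hasFDerivAt_exp_zero (𝕂 := ℝ)).fderiv]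
    rfl
  rw [← h0]
  have h1 := (hcont.tendsto 0).comp (tendsto_inv_atTop_nhds_zero_nat (𝕜 := ℝ))
  refine tendsto_nhds_unique_of_eventuallyEq tendsto_const_nhds h1 ?_
  filter_upwards [Filter.eventually_ne_atTop 0] with n hn0
  exact (hn n hn0).symm

variable [PartialOrder M] [StarOrderedRing M]

/-- This is `trace_exp_neg_mul_deriv` for the curve `exp (log p) = p`, with `exp (-log p(t)) = y`.
-/
theorem trace_deriv_log {τ : StrongDual ℂ M} (hτ : ∀ x y, τ (x * y) = τ (y * x))
    {p : ℝ → M} {p' y : M} {t : ℝ} (hp : HasDerivAt p p' t)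
    (hpos : ∀ s, IsStrictlyPositive (p s)) (hy : y * p t = 1) :
    HasDerivAt (fun s => τ (CFC.log (p s))) (τ (y * p')) t := by
  have h1 := (hp.differentiableAt.cfc_log (fun s => .of_nonneg (hpos s).nonneg) (hpos t)).hasDerivAt
  set l' := deriv (fun s => CFC.log (p s)) t
  have h2 := trace_exp_neg_mul_deriv hτ h1 (e' := p') (by
    simpa only [CFC.exp_log _ (hpos _)] using hp)
  have h3 : y = NormedSpace.exp (-(CFC.log (p t))) := by
    have h4 := exp_mul_exp_neg (CFC.log (p t))
    rw [CFC.exp_log _ (hpos t)] at h4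
    rw [← mul_one y, ← h4, ← mul_assoc, hy, one_mul]
  rw [h3, h2]
  exact ((τ.restrictScalars ℝ).hasFDerivAt.comp_hasDerivAt t h1)

theorem isStrictlyPositive_star_mul_mul {p : M} (hp : IsStrictlyPositive p) (y : Mˣ) :
    IsStrictlyPositive (star (y : M) * p * y) :=
  IsUnit.isStrictlyPositive ((y.isUnit.star.mul hp.isUnit).mul y.isUnit)
    (star_left_conjugate_nonneg hp.nonneg _)

theorem isStrictlyPositive_star_mul_self (y : Mˣ) :
    IsStrictlyPositive (star (y : M) * y) :=
  IsUnit.isStrictlyPositive (y.isUnit.star.mul y.isUnit) (star_mul_self_nonneg _)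

theorem isStrictlyPositive_abs (x : Mˣ) : IsStrictlyPositive (CFC.abs (x : M)) :=
  (isStrictlyPositive_star_mul_self x).sqrt

theorem exp_log_abs (x : Mˣ) : NormedSpace.exp (CFC.log (CFC.abs (x : M))) = CFC.abs (x : M) :=
  CFC.exp_log _ (isStrictlyPositive_abs x)

theorem log_abs_eq (x : Mˣ) :
    CFC.log (CFC.abs (x : M)) = (2 : ℝ)⁻¹ • CFC.log (star (x : M) * x) := by
  have := CFC.log_pow' 2 _ (isStrictlyPositive_abs x)
  rw [pow_two, CFC.abs_mul_abs] at this
  rw [this, ← Nat.cast_smul_eq_nsmul ℝ, smul_smul]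
  norm_num

/-- Multiplicativity of the Fuglede–Kadison determinant. -/
theorem trace_log_abs_mul {τ : StrongDual ℂ M} (hτ : ∀ x y, τ (x * y) = τ (y * x)) (x y : Mˣ) :
    τ (CFC.log (CFC.abs ((x * y : Mˣ) : M))) =
      τ (CFC.log (CFC.abs (x : M))) + τ (CFC.log (CFC.abs (y : M))) := by
  set k := CFC.log (star (x : M) * x) with hk
  have hksa : IsSelfAdjoint k := .log
  -- This curve joins `y⋆y` to `(xy)⋆(xy)`. Under the trace, `p⁻¹ p'` is a conjugate of `k`, so
  -- `τ(log p)` grows at the constant rate `τ(k)`.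
  let p : ℝ → M := fun t => star (y : M) * NormedSpace.exp (t • k) * y
  have hexp : ∀ t : ℝ, HasDerivAt (fun t : ℝ => NormedSpace.exp (t • k))
      (k * NormedSpace.exp (t • k)) t := fun t => hasDerivAt_exp_smul_const' k t
  have hp : ∀ t, HasDerivAt p (star (y : M) * (k * NormedSpace.exp (t • k)) * y) t := fun t =>
    ((hexp t).const_mul _).mul_const _
  have hpos : ∀ t, IsStrictlyPositive (p t) := fun t =>
    isStrictlyPositive_star_mul_mul (isStrictlyPositive_exp ((IsSelfAdjoint.all t).smul hksa)) y
  have hd : ∀ t, HasDerivAt (fun s => τ (CFC.log (p s))) (τ k) t := by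
    intro t
    have h1 := trace_deriv_log hτ (hp t) hpos
      (y := ((y⁻¹ : Mˣ) : M) * NormedSpace.exp (-(t • k)) * star ((y⁻¹ : Mˣ) : M)) (by
        have e1 : star ((y⁻¹ : Mˣ) : M) * star (y : M) = 1 := by
          rw [← star_mul, Units.mul_inv, star_one]
        calc _ = ((y⁻¹ : Mˣ) : M) * (NormedSpace.exp (-(t • k)) *
              ((star ((y⁻¹ : Mˣ) : M) * star (y : M)) * NormedSpace.exp (t • k))) * y := by
                simp only [p, mul_assoc]
          _ = 1 := by rw [e1, one_mul, exp_neg_mul_exp, mul_one, Units.inv_mul])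
    convert h1 using 1
    have e1 : star ((y⁻¹ : Mˣ) : M) * star (y : M) = 1 := by
      rw [← star_mul, Units.mul_inv, star_one]
    have hc : k * NormedSpace.exp (t • k) = NormedSpace.exp (t • k) * k :=
      (((Commute.refl k).smul_right t).exp_right).eq
    symm
    calc _ = τ (((y⁻¹ : Mˣ) : M) * (NormedSpace.exp (-(t • k)) *
              ((star ((y⁻¹ : Mˣ) : M) * star (y : M)) * (k * NormedSpace.exp (t • k))) * y)) := by
                simp only [mul_assoc]
      _ = τ ((NormedSpace.exp (-(t • k)) * NormedSpace.exp (t • k)) * k * (y * ((y⁻¹ : Mˣ) : M))) := by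
          rw [e1, one_mul, hc, hτ]; simp only [mul_assoc]
      _ = τ k := by rw [exp_neg_mul_exp, one_mul, Units.mul_inv, mul_one]
  have hconst : ∀ t : ℝ, HasDerivAt (fun s : ℝ => τ (CFC.log (p s)) - s • τ k) 0 t := fun t => by
    have := (hd t).fun_sub ((hasDerivAt_id t).smul_const (τ k))
    simpa using! this
  have := is_const_of_deriv_eq_zero (fun t => (hconst t).differentiableAt)
    (fun t => (hconst t).deriv) 1 0
  simp only [p, one_smul, zero_smul, NormedSpace.exp_zero, mul_one, sub_zero] at this
  rw [hk, CFC.exp_log _ (isStrictlyPositive_star_mul_self x)] at this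
  rw [log_abs_eq, log_abs_eq, log_abs_eq]
  simp only [← Complex.coe_smul, map_smul]
  rw [← smul_add]
  congr 1
  rw [Units.val_mul, star_mul, show star (y : M) * star (x : M) * ((x : M) * (y : M)) =
    star (y : M) * (star (x : M) * x) * y by simp only [mul_assoc]]
  rw [← this]
  ring

end Determinant

/-! ### Exponentials modulo a closed normal subgroup -/

section ExpQuotient

variable {M : Type u} [CStarAlgebra M]

theorem hasStrictFDerivAt_exp_zero_equiv : HasStrictFDerivAt (NormedSpace.exp : M → M)
    ((ContinuousLinearEquiv.refl ℝ M : M ≃L[ℝ] M) : M →L[ℝ] M) 0 :=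
  hasStrictFDerivAt_exp_zero (𝕂 := ℝ)

theorem exp_image_mem_nhds {V : Set M} (hV : V ∈ 𝓝 0) : NormedSpace.exp '' V ∈ 𝓝 (1 : M) := by
  have := (hasStrictFDerivAt_exp_zero_equiv (M := M)).map_nhds_eq_of_equiv
  rw [NormedSpace.exp_zero] at this
  rw [← this]
  exact Filter.image_mem_map hV

/-- For a curve `g` with `g 0 = 1` and `g' 0 = c`, the powers `g (1/n) ^ n` tend to `exp c`. -/
theorem tendsto_curve_pow {g : ℝ → M} {c : M} (hg : HasDerivAt g c 0) (h0 : g 0 = 1) :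
    Filter.Tendsto (fun n : ℕ => g (n : ℝ)⁻¹ ^ n) Filter.atTop (𝓝 (NormedSpace.exp c)) := by
  have hexp := hasStrictFDerivAt_exp_zero_equiv (M := M)
  -- With `l` a local logarithm, `n l(g(1/n))` is a difference quotient at `0` and tends to `c`;
  -- exponentiating it gives `g(1/n)ⁿ` for large `n`.
  let l : M → M := hexp.localInverse
  have hl1 : l 1 = 0 := by
    have := hexp.localInverse_apply_image
    rwa [NormedSpace.exp_zero] at this
  have hl : HasFDerivAt l ((ContinuousLinearEquiv.refl ℝ M : M ≃L[ℝ] M) : M →L[ℝ] M) (g 0) := by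
    have := hexp.to_localInverse.hasFDerivAt
    rw [NormedSpace.exp_zero] at this
    rw [h0]
    exact this
  have hlg : HasDerivAt (fun t => l (g t)) c 0 := hl.comp_hasDerivAt 0 hg
  have htend : Filter.Tendsto (fun n : ℕ => (n : ℝ)⁻¹) Filter.atTop (𝓝[≠] 0) := by
    refine tendsto_nhdsWithin_iff.2 ⟨tendsto_inv_atTop_nhds_zero_nat, ?_⟩
    filter_upwards [Filter.eventually_ne_atTop 0] with n hn
    simpa using hn
  have h1 := (hasDerivAt_iff_tendsto_slope.1 hlg).comp htend
  have h2 : Filter.Tendsto (fun n : ℕ => NormedSpace.exp (n • l (g (n : ℝ)⁻¹))) Filter.atTop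
      (𝓝 (NormedSpace.exp c)) := by
    refine (continuous_exp.tendsto c).comp (h1.congr fun n => ?_)
    simp only [Function.comp_apply, slope_def_module, h0, hl1, sub_zero, inv_inv,
      Nat.cast_smul_eq_nsmul]
  refine h2.congr' ?_
  have h3 : ∀ᶠ x in 𝓝 (g 0), NormedSpace.exp (l x) = x := by
    have := hexp.eventually_right_inverse
    rwa [NormedSpace.exp_zero, ← h0] at this
  have h4 := (hg.continuousAt.eventually h3)
  filter_upwards [(htend.mono_right nhdsWithin_le_nhds).eventually h4] with n hn
  rw [exp_nsmul_pow, hn]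

theorem hasDerivAt_exp_smul_zero (a : M) :
    HasDerivAt (fun t : ℝ => NormedSpace.exp (t • a)) a 0 := by
  have := hasDerivAt_exp_smul_const' (𝕂 := ℝ) a (0 : ℝ)
  simpa using this

theorem hasDerivAt_exp_mul_exp_zero (a b : M) :
    HasDerivAt (fun t : ℝ => NormedSpace.exp (t • a) * NormedSpace.exp (t • b)) (a + b) 0 := by
  have := (hasDerivAt_exp_smul_zero a).fun_mul (hasDerivAt_exp_smul_zero b)
  simpa using! this

/-- An abstract form of the fact that a one-parameter-subgroup map is additive modulo a closed
normal subgroup containing the relevant commutators. -/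
theorem mk_add_of_trotter {V : Type*} [AddCommGroup V] [Module ℝ V] {G : Type*} [Group G]
    [TopologicalSpace G] [IsTopologicalGroup G] (N : Subgroup G) [N.Normal]
    (hN : IsClosed (N : Set G)) (e : V → G)
    (hpow : ∀ (n : ℕ) a, n ≠ 0 → e ((n : ℝ)⁻¹ • a) ^ n = e a)
    (htrotter : ∀ a b, Filter.Tendsto (fun n : ℕ => (e ((n : ℝ)⁻¹ • a) * e ((n : ℝ)⁻¹ • b)) ^ n)
      Filter.atTop (𝓝 (e (a + b))))
    (hcomm : ∀ a b, (e a : G ⧸ N) * e b = e b * e a) (a b : V) :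
    (e (a + b) : G ⧸ N) = e a * e b := by
  have h1 : Filter.Tendsto
      (fun n : ℕ => (((e ((n : ℝ)⁻¹ • a) * e ((n : ℝ)⁻¹ • b)) ^ n : G) : G ⧸ N))
      Filter.atTop (𝓝 (e (a + b) : G ⧸ N)) :=
    (QuotientGroup.continuous_mk.tendsto _).comp (htrotter a b)
  -- Limits are unique because `N` is closed, and the Trotter sequence is constant in the quotient
  -- since the classes commute.
  have : T3Space (G ⧸ N) := QuotientGroup.instT3Space N (hN := hN)
  refine tendsto_nhds_unique_of_eventuallyEq h1 tendsto_const_nhds ?_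
  filter_upwards [Filter.eventually_ne_atTop 0] with n hn
  rw [QuotientGroup.mk_pow, QuotientGroup.mk_mul, (Commute.mul_pow (hcomm _ _) n),
    ← QuotientGroup.mk_pow, ← QuotientGroup.mk_pow, hpow n a hn, hpow n b hn]

theorem mk_commute_of_mem_idComponent {G : Type*} [Group G] [TopologicalSpace G]
    [IsTopologicalGroup G] {g h : G} (hg : g ∈ idComponent G) (hh : h ∈ idComponent G) :
    (g : G ⧸ CG0 G) * h = h * g := by
  rw [← QuotientGroup.mk_mul, ← QuotientGroup.mk_mul, eq_comm, QuotientGroup.eq]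
  refine subset_closure ?_
  have := Subgroup.commutator_mem_commutator ((idComponent G).inv_mem hg)
    ((idComponent G).inv_mem hh)
  rw [commutatorElement_def] at this
  convert! this using 1
  group

theorem isClosed_CG0 {G : Type*} [Group G] [TopologicalSpace G] [IsTopologicalGroup G] :
    IsClosed (CG0 G : Set G) := isClosed_closure

/-! #### The general linear group -/

theorem continuous_expUnit : Continuous (expUnit : M → Mˣ) :=
  Units.continuous_iff.2 ⟨continuous_exp, continuous_exp.comp continuous_neg⟩

theorem expUnit_zero : expUnit (0 : M) = 1 := Units.ext NormedSpace.exp_zero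

theorem expUnit_mem_idComponent (a : M) : expUnit a ∈ idComponent Mˣ := by
  have h := (isPreconnected_univ (α := ℝ)).image (fun t : ℝ => expUnit (t • a))
    (continuous_expUnit.comp (continuous_id.smul continuous_const)).continuousOn
  refine h.subset_connectedComponent ⟨0, trivial, ?_⟩ ⟨1, trivial, ?_⟩
  · simp only [zero_smul, expUnit_zero]
  · simp only [one_smul]

theorem mk_expUnit_add (a b : M) :
    (expUnit (a + b) : Mˣ ⧸ CG0 Mˣ) = expUnit a * expUnit b := by
  refine mk_add_of_trotter (CG0 Mˣ) isClosed_CG0 expUnit (fun n a hn => Units.ext ?_)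
    (fun a b => ?_) (fun a b => mk_commute_of_mem_idComponent (expUnit_mem_idComponent a)
      (expUnit_mem_idComponent b)) a b
  · rw [Units.val_pow_eq_pow_val]
    exact exp_inv_smul_pow hn a
  · rw [Units.isOpenEmbedding_val.tendsto_nhds_iff]
    have := tendsto_curve_pow (hasDerivAt_exp_mul_exp_zero a b) (by simp)
    refine this.congr fun n => ?_
    simp only [Function.comp_apply, Units.val_pow_eq_pow_val, Units.val_mul]
    rfl

variable (M) in
/-- The exponential map as a homomorphism into `GL / C(GL⁰)`. -/
def expQuot : M →+ Additive (Mˣ ⧸ CG0 Mˣ) where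
  toFun a := Additive.ofMul (expUnit a : Mˣ ⧸ CG0 Mˣ)
  map_zero' := by rw [expUnit_zero]; rfl
  map_add' a b := by rw [mk_expUnit_add]; rfl

theorem expQuot_eq_zero_iff {a : M} : expQuot M a = 0 ↔ expUnit a ∈ CG0 Mˣ :=
  QuotientGroup.eq_one_iff (expUnit a)

theorem isClosed_setOf_expUnit_mem : IsClosed {a : M | expUnit a ∈ CG0 Mˣ} :=
  isClosed_CG0.preimage continuous_expUnit

theorem expUnit_conj (g : Mˣ) (a : M) :
    expUnit ((g : M) * a * ((g⁻¹ : Mˣ) : M)) = g * expUnit a * g⁻¹ := by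
  let _ : NormedAlgebra ℚ M := NormedAlgebra.restrictScalars ℚ ℂ M
  exact Units.ext (NormedSpace.exp_units_conj g a)

/-- For `g` in the identity component, `g b` is the conjugate `g (b g) g⁻¹`, so the two exponentials
have the same class. The general case uses `g = 1 + t a`, which for small `t` is an exponential,
against `t⁻¹ b`: the scalars cancel inside the product, so additivity of `expQuot` suffices. -/
theorem expQuot_mul_comm (a b : M) : expQuot M (a * b) = expQuot M (b * a) := by
  have key : ∀ (g : Mˣ), g ∈ idComponent Mˣ → ∀ b : M,
      expQuot M ((g : M) * b) = expQuot M (b * g) := by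
    intro g hg b
    have h1 := expUnit_conj g (b * g)
    rw [mul_assoc, mul_assoc, Units.mul_inv, mul_one] at h1
    change Additive.ofMul (expUnit ((g : M) * b) : Mˣ ⧸ CG0 Mˣ) = _
    rw [h1, QuotientGroup.mk_mul, QuotientGroup.mk_mul, mk_commute_of_mem_idComponent hg
      (expUnit_mem_idComponent _), mul_assoc, ← QuotientGroup.mk_mul, mul_inv_cancel,
      QuotientGroup.mk_one, mul_one]
    rfl
  have h1 : ∀ᶠ t : ℝ in 𝓝 0, (1 : M) + t • a ∈ (NormedSpace.exp : M → M) '' Set.univ := by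
    have hc : Filter.Tendsto (fun t : ℝ => (1 : M) + t • a) (𝓝 0) (𝓝 1) := by
      have : Continuous fun t : ℝ => (1 : M) + t • a := by fun_prop
      simpa using this.tendsto 0
    exact hc (exp_image_mem_nhds Filter.univ_mem)
  have h2 : ∀ᶠ t : ℝ in 𝓝[≠] 0, t ≠ 0 := eventually_mem_nhdsWithin
  obtain ⟨t, ht, c, -, hc⟩ := (h2.and (h1.filter_mono nhdsWithin_le_nhds)).exists
  have h3 := key (expUnit c) (expUnit_mem_idComponent c) (t⁻¹ • b)
  have e : ((expUnit c : Mˣ) : M) = 1 + t • a := hc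
  rw [e, add_mul, mul_add, one_mul, mul_one, map_add, map_add, smul_mul_smul_comm,
    smul_mul_smul_comm, mul_inv_cancel₀ ht, inv_mul_cancel₀ ht, one_smul, one_smul] at h3
  exact add_left_cancel h3

end ExpQuotient

/-! ### The unitary group and the polar decomposition -/

section UnitaryExp

variable {M : Type u} [CStarAlgebra M]

open selfAdjoint

theorem expUnitary_mem_idComponent (a : selfAdjoint M) : expUnitary a ∈ idComponent (unitary M) := by
  have h := (isPreconnected_univ (α := ℝ)).image (fun t : ℝ => expUnitary (t • a))
    (continuous_expUnitary.comp (continuous_id.smul continuous_const)).continuousOn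
  refine h.subset_connectedComponent ⟨0, trivial, ?_⟩ ⟨1, trivial, ?_⟩
  · simp only [zero_smul, expUnitary_zero]
  · simp only [one_smul]

theorem coe_expUnitary_smul (t : ℝ) (a : selfAdjoint M) :
    ((expUnitary (t • a) : unitary M) : M) = NormedSpace.exp (t • Complex.I • (a : M)) := by
  rw [expUnitary_coe, smul_comm]
  rfl

theorem mk_expUnitary_add (a b : selfAdjoint M) :
    (expUnitary (a + b) : unitary M ⧸ CG0 (unitary M)) = expUnitary a * expUnitary b := by
  refine mk_add_of_trotter (CG0 (unitary M)) isClosed_CG0 expUnitary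
    (fun n a hn => Subtype.ext ?_) (fun a b => ?_) (fun a b => mk_commute_of_mem_idComponent
      (expUnitary_mem_idComponent a) (expUnitary_mem_idComponent b)) a b
  · rw [SubmonoidClass.coe_pow, coe_expUnitary_smul, exp_inv_smul_pow hn]
    rfl
  · rw [IsEmbedding.subtypeVal.tendsto_nhds_iff]
    have := tendsto_curve_pow (hasDerivAt_exp_mul_exp_zero (Complex.I • (a : M))
      (Complex.I • (b : M))) (by simp)
    rw [← smul_add] at this
    refine this.congr fun n => ?_
    simp only [Function.comp_apply, SubmonoidClass.coe_pow, Submonoid.coe_mul, coe_expUnitary_smul]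

variable (M) in
/-- The exponential map as a homomorphism into `U / C(U⁰)`. -/
def expUnitaryQuot : selfAdjoint M →+ Additive (unitary M ⧸ CG0 (unitary M)) where
  toFun a := Additive.ofMul (expUnitary a : unitary M ⧸ CG0 (unitary M))
  map_zero' := by rw [expUnitary_zero]; rfl
  map_add' a b := by rw [mk_expUnitary_add]; rfl

theorem expUnitaryQuot_eq_zero_iff {a : selfAdjoint M} :
    expUnitaryQuot M a = 0 ↔ expUnitary a ∈ CG0 (unitary M) :=
  QuotientGroup.eq_one_iff (expUnitary a)

theorem isClosed_setOf_expUnitaryQuot : IsClosed {a : selfAdjoint M | expUnitaryQuot M a = 0} := by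
  simp only [expUnitaryQuot_eq_zero_iff]
  exact isClosed_CG0.preimage continuous_expUnitary

/-- Conjugation of a self-adjoint element by a unitary. -/
def unitaryConj (u : unitary M) (a : selfAdjoint M) : selfAdjoint M :=
  ⟨(u : M) * a * star (u : M), a.2.conjugate u⟩

theorem expUnitary_unitaryConj (u : unitary M) (a : selfAdjoint M) :
    expUnitary (unitaryConj u a) = u * expUnitary a * u⁻¹ := by
  let _ : NormedAlgebra ℚ M := NormedAlgebra.restrictScalars ℚ ℂ M
  refine Subtype.ext ?_
  have := NormedSpace.exp_units_conj (Unitary.toUnits u) (Complex.I • (a : M))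
  rw [mul_smul_comm, smul_mul_assoc] at this
  exact this

theorem expUnitaryQuot_unitaryConj {u : unitary M} (hu : u ∈ idComponent (unitary M))
    (a : selfAdjoint M) : expUnitaryQuot M (unitaryConj u a) = expUnitaryQuot M a := by
  change Additive.ofMul (expUnitary (unitaryConj u a) : unitary M ⧸ CG0 (unitary M)) = _
  rw [expUnitary_unitaryConj, QuotientGroup.mk_mul, QuotientGroup.mk_mul,
    mk_commute_of_mem_idComponent hu (expUnitary_mem_idComponent _), mul_assoc,
    ← QuotientGroup.mk_mul, mul_inv_cancel, QuotientGroup.mk_one, mul_one]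
  rfl

theorem isSelfAdjoint_I_smul_commutator (b c : selfAdjoint M) :
    IsSelfAdjoint (Complex.I • ((b : M) * c - c * b)) := by
  rw [IsSelfAdjoint, star_smul, star_sub, star_mul, star_mul, b.2.star_eq, c.2.star_eq,
    Complex.star_def, Complex.conj_I, neg_smul, ← smul_neg, neg_sub]

/-- The element `i[b,c]` is the derivative at `0` of the conjugates of `c` by `exp(itb)`. The scaled
difference quotients have the form `u c' u⋆ - c'` and are killed by conjugation invariance; the
kernel is closed. -/
theorem expUnitaryQuot_I_smul_commutator (b c : selfAdjoint M) (s : ℝ) :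
    expUnitaryQuot M (s • ⟨_, isSelfAdjoint_I_smul_commutator b c⟩) = 0 := by
  let d : ℝ → selfAdjoint M := fun t => unitaryConj (expUnitary (t • b)) c
  have hd : HasDerivAt (fun t => (d t : M)) (Complex.I • ((b : M) * c - c * b)) 0 := by
    have h1 := hasDerivAt_exp_smul_zero (Complex.I • (b : M))
    have h2 := (h1.mul_const (c : M)).fun_mul (hasDerivAt_exp_smul_zero (-(Complex.I • (b : M))))
    simp only [zero_smul, NormedSpace.exp_zero, one_mul, mul_one, smul_mul_assoc, mul_neg,
      mul_smul_comm] at h2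
    rw [← sub_eq_add_neg, ← smul_sub] at h2
    convert h2 using 1
    funext t
    change ((expUnitary (t • b) : unitary M) : M) * c * star ((expUnitary (t • b) : unitary M) : M) = _
    rw [coe_expUnitary_smul, NormedSpace.star_exp, star_smul, star_smul, b.2.star_eq,
      Complex.star_def, Complex.conj_I, neg_smul, star_trivial]
  have htend : Filter.Tendsto (fun n : ℕ => (n : ℝ)⁻¹) Filter.atTop (𝓝[≠] 0) := by
    refine tendsto_nhdsWithin_iff.2 ⟨tendsto_inv_atTop_nhds_zero_nat, ?_⟩
    filter_upwards [Filter.eventually_ne_atTop 0] with n hn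
    simpa using hn
  have h1 := (hasDerivAt_iff_tendsto_slope.1 hd).comp htend
  have h2 : Filter.Tendsto (fun n : ℕ => s • (n : ℝ) • (d (n : ℝ)⁻¹ - d 0)) Filter.atTop
      (𝓝 (s • ⟨_, isSelfAdjoint_I_smul_commutator b c⟩)) := ?_
  · refine isClosed_setOf_expUnitaryQuot.mem_of_tendsto h2
      (Filter.Eventually.of_forall fun n => ?_)
    have e : s • (n : ℝ) • (d (n : ℝ)⁻¹ - d 0) = unitaryConj (expUnitary ((n : ℝ)⁻¹ • b))
        ((s * n) • c) - (s * n) • c := by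
      have hd0 : d 0 = c := by
        refine Subtype.ext ?_
        simp [d, unitaryConj]
      rw [hd0, smul_sub, smul_sub, smul_smul, smul_smul]
      congr 1
      refine Subtype.ext ?_
      simp only [d, unitaryConj, selfAdjoint.val_smul, mul_smul_comm, smul_mul_assoc]
    change expUnitaryQuot M _ = 0
    rw [e, map_sub, expUnitaryQuot_unitaryConj (expUnitary_mem_idComponent _), sub_self]
  · rw [IsEmbedding.subtypeVal.tendsto_nhds_iff]
    refine (h1.const_smul s).congr fun n => ?_
    simp only [Function.comp_apply, slope_def_module, sub_zero, inv_inv]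
    rfl

theorem continuous_realPart : Continuous (realPart : M → selfAdjoint M) :=
  AddMonoidHomClass.continuous_of_bound (realPart : M →ₗ[ℝ] selfAdjoint M) 1 fun x => by
    rw [one_mul]; exact realPart.norm_le x

theorem star_mul_self_sub_mul_star_self (x : M) : star x * x - x * star x =
    Complex.I • (((((2 : ℝ) • realPart x : selfAdjoint M)) : M) * imaginaryPart x -
      imaginaryPart x * (((2 : ℝ) • realPart x : selfAdjoint M) : M)) := by
  have h : star x = realPart x - Complex.I • (imaginaryPart x : M) := by
    conv_lhs => rw [← realPart_add_I_smul_imaginaryPart x]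
    rw [star_add, star_smul, (realPart x).2.star_eq, (imaginaryPart x).2.star_eq, Complex.star_def,
      Complex.conj_I, neg_smul, sub_eq_add_neg]
  have h' : star x * x - x * star x =
      (realPart x - Complex.I • (imaginaryPart x : M)) *
        (realPart x + Complex.I • (imaginaryPart x : M)) -
      (realPart x + Complex.I • (imaginaryPart x : M)) *
        (realPart x - Complex.I • (imaginaryPart x : M)) := by
    rw [realPart_add_I_smul_imaginaryPart x, h]
  have h2 : (((2 : ℝ) • realPart x : selfAdjoint M) : M) = realPart x + realPart x := by
    rw [two_smul]; rfl
  rw [h', h2]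
  simp only [smul_mul_assoc, mul_smul_comm, sub_mul, mul_sub, add_mul, mul_add, smul_add, smul_sub]
  abel

/-- For `x = h + ik` the generator `x⋆x - xx⋆` is `i[2h,k]`. All real multiples are treated at once,
so that the induction over the real span needs only additivity. -/
theorem expUnitaryQuot_of_mem_traceNull {a : selfAdjoint M} (ha : (a : M) ∈ traceNull M) (s : ℝ) :
    expUnitaryQuot M (s • a) = 0 := by
  have h := traceNull_induction (p := fun a => ∀ s : ℝ, expUnitaryQuot M (s • realPart a) = 0)
    (by
      simp only [Set.ofPred_forall]
      exact isClosed_iInter fun s =>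
        isClosed_setOf_expUnitaryQuot.preimage (f := fun x : M => s • realPart x)
          (continuous_realPart.const_smul s))
    (fun s => by simp) (fun x y hx hy s => by rw [map_add, smul_add, map_add, hx, hy, add_zero])
    (fun r x hx s => by rw [map_smul realPart r x, smul_smul, hx]) (fun x s => by
      have e : realPart (star x * x - x * star x) = ⟨_, isSelfAdjoint_I_smul_commutator
          ((2 : ℝ) • realPart x) (imaginaryPart x)⟩ := by
        refine Subtype.ext ?_
        rw [IsSelfAdjoint.coe_realPart ((IsSelfAdjoint.star_mul_self x).sub (.mul_star_self x)),
          star_mul_self_sub_mul_star_self]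
      rw [e, expUnitaryQuot_I_smul_commutator]) ha s
  have e : realPart (a : M) = a := Subtype.ext a.2.coe_realPart
  rwa [e] at h

/-- A curve of unitaries whose logarithmic derivative generates one-parameter subgroups in a
closed subgroup stays in this subgroup. -/
theorem mem_of_logDeriv {N : Subgroup (unitary M)} (hN : IsClosed (N : Set (unitary M)))
    {w : ℝ → unitary M} {c : ℝ → selfAdjoint M}
    (hw : ∀ t, HasDerivAt (fun s => (w s : M)) (Complex.I • (c t : M) * w t) t)
    (hc : ∀ t s : ℝ, expUnitary (s • c t) ∈ N) (h0 : w 0 ∈ N) : w 1 ∈ N := by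
  let S : Set M := (fun u : unitary M => (u : M)) '' N
  have hS : IsClosed S := by
    have : IsClosed (unitary M : Set M) := by
      have e : (unitary M : Set M) = {x | star x * x = 1} ∩ {x | x * star x = 1} := by
        ext x; exact Unitary.mem_iff
      rw [e]
      exact (isClosed_eq (continuous_star.mul continuous_id) continuous_const).inter
        (isClosed_eq (continuous_id.mul continuous_star) continuous_const)
    exact this.isClosedEmbedding_subtypeVal.isClosedMap _ hN
  have hSne : S.Nonempty := ⟨1, 1, N.one_mem, rfl⟩
  let f : ℝ → ℝ := fun t => Metric.infDist (w t : M) S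
  have hfc : Continuous f := (Metric.continuous_infDist_pt S).comp
    (continuous_iff_continuousAt.2 fun t => (hw t).continuousAt)
  -- Left multiplication by the one-parameter subgroup is isometric and preserves `S`, so the
  -- distance to `S` grows by at most the error of the first-order approximation of `w`.
  have hstep : ∀ t z : ℝ, f z ≤ f t +
      ‖(w z : M) - NormedSpace.exp ((z - t) • Complex.I • (c t : M)) * w t‖ := by
    intro t z
    rw [← sub_le_iff_le_add]
    refine (Metric.le_infDist hSne).2 ?_
    rintro _ ⟨g, hg, rfl⟩
    rw [sub_le_iff_le_add]
    have hmem : ((expUnitary ((z - t) • c t) * g : unitary M) : M) ∈ S :=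
      ⟨_, N.mul_mem (hc t _) hg, rfl⟩
    refine (Metric.infDist_le_dist_of_mem hmem).trans ?_
    rw [dist_eq_norm, dist_eq_norm, ← coe_expUnitary_smul]
    have e : (w z : M) - ((expUnitary ((z - t) • c t) * g : unitary M) : M) =
        ((expUnitary ((z - t) • c t) : unitary M) : M) * ((w t : M) - g) +
        ((w z : M) - ((expUnitary ((z - t) • c t) : unitary M) : M) * w t) := by
      rw [Submonoid.coe_mul]; noncomm_ring
    rw [e]
    refine (norm_add_le _ _).trans ?_
    rw [CStarRing.norm_coe_unitary_mul]
  have hder : ∀ t, HasDerivAt (fun z =>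
      (w z : M) - NormedSpace.exp ((z - t) • Complex.I • (c t : M)) * w t) 0 t := by
    intro t
    have h1 : HasDerivAt (fun z : ℝ => NormedSpace.exp ((z - t) • Complex.I • (c t : M)))
        (Complex.I • (c t : M)) t := by
      have h2 := hasDerivAt_exp_smul_zero (Complex.I • (c t : M))
      rw [← sub_self t] at h2
      exact h2.comp_sub_const t t
    have := (hw t).fun_sub (h1.mul_const (w t : M))
    rwa [sub_self] at this
  -- That error is `o(z - t)`, so the upper right derivative of the distance is nonpositive;
  -- starting at `0`, the distance stays there.
  have hle := image_le_of_liminf_slope_right_le_deriv_boundary (f := f) (a := 0) (b := 1)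
    (B := fun _ => 0) (B' := fun _ => 0) hfc.continuousOn
    (Metric.infDist_zero_of_mem (show (w 0 : M) ∈ S from ⟨_, h0, rfl⟩)).le continuousOn_const
    (fun x _ => hasDerivWithinAt_const _ _ _) (fun t _ r hr => by
      have h1 := (hasDerivAt_iff_tendsto_slope.1 (hder t)).norm
      rw [norm_zero] at h1
      have h2 : ∀ᶠ z in 𝓝[>] t, ‖slope (fun z => (w z : M) -
          NormedSpace.exp ((z - t) • Complex.I • (c t : M)) * w t) t z‖ < r :=
        (h1.eventually (gt_mem_nhds hr)).filter_mono
          (nhdsWithin_mono _ fun z hz => ne_of_gt hz)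
      refine Filter.Eventually.frequently ?_
      filter_upwards [h2, self_mem_nhdsWithin] with z hz hzt
      refine lt_of_le_of_lt ?_ hz
      have hzt' : 0 < z - t := sub_pos.2 hzt
      rw [slope_def_field, slope_def_module, norm_smul, norm_inv, Real.norm_eq_abs,
        abs_of_pos hzt', div_eq_inv_mul]
      refine mul_le_mul_of_nonneg_left ?_ (inv_nonneg.2 hzt'.le)
      have := hstep t z
      simp only [sub_self, zero_smul, NormedSpace.exp_zero, one_mul, sub_zero]
      linarith)
  have h1 : f 1 = 0 := le_antisymm (hle (Set.right_mem_Icc.2 zero_le_one)) Metric.infDist_nonneg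
  have h2 := (hS.mem_iff_infDist_zero hSne).2 h1
  obtain ⟨g, hg, hgw⟩ := h2
  rwa [← Subtype.ext hgw]

end UnitaryExp

/-! ### The polar decomposition modulo commutators -/

section Polar

variable {M : Type u} [CStarAlgebra M] [PartialOrder M] [StarOrderedRing M]

/-- The unitary part of an invertible element. -/
def polar (x : Mˣ) : unitary M :=
  ⟨x * NormedSpace.exp (-CFC.log (CFC.abs (x : M))), by
    have hsa : IsSelfAdjoint (CFC.log (CFC.abs (x : M))) := .log
    have he := exp_log_abs x
    set l := CFC.log (CFC.abs (x : M)) with hl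
    have hs : star (NormedSpace.exp (-l)) = NormedSpace.exp (-l) := by
      rw [NormedSpace.star_exp, star_neg, hsa.star_eq]
    have h1 : star (x : M) * x = NormedSpace.exp l * NormedSpace.exp l := by
      rw [he, CFC.abs_mul_abs]
    have h2 : star ((x : M) * NormedSpace.exp (-l)) * (x * NormedSpace.exp (-l)) = 1 := by
      rw [star_mul, hs, mul_assoc, ← mul_assoc (star (x : M)), h1]
      simp only [mul_assoc, exp_mul_exp_neg, mul_one, exp_neg_mul_exp]
    refine Unitary.mem_iff.2 ⟨h2, ?_⟩
    -- For an invertible element a left inverse is also a right inverse, so `h2` is enough for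
    -- unitarity.
    have hu : IsUnit ((x : M) * NormedSpace.exp (-l)) := x.isUnit.mul (expUnit (-l)).isUnit
    obtain ⟨u, hu⟩ := hu
    rw [← hu] at h2 ⊢
    rw [left_inv_eq_right_inv h2 u.mul_inv, Units.mul_inv]⟩

theorem coe_polar (x : Mˣ) :
    (polar x : M) = x * NormedSpace.exp (-CFC.log (CFC.abs (x : M))) := rfl

theorem polar_mul_exp (x : Mˣ) :
    Unitary.toUnits (polar x) * expUnit (CFC.log (CFC.abs (x : M))) = x := by
  refine Units.ext ?_
  change (x : M) * NormedSpace.exp (-CFC.log (CFC.abs (x : M))) *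
    NormedSpace.exp (CFC.log (CFC.abs (x : M))) = x
  rw [mul_assoc, exp_neg_mul_exp, mul_one]

/-- Uniqueness of the polar decomposition: `e^a` is the positive square root of `(u e^a)⋆(u e^a) =
e^{2a}`. -/
theorem log_abs_unitary_mul_exp (u : unitary M) {a : M} (ha : IsSelfAdjoint a) :
    CFC.log (CFC.abs ((Unitary.toUnits u * expUnit a : Mˣ) : M)) = a := by
  have h : CFC.abs ((Unitary.toUnits u * expUnit a : Mˣ) : M) = NormedSpace.exp a := by
    refine CFC.sqrt_unique ?_ ha.exp_nonneg
    change _ = star ((u : M) * NormedSpace.exp a) * ((u : M) * NormedSpace.exp a)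
    rw [star_mul, mul_assoc, ← mul_assoc (star (u : M)), Unitary.star_mul_self_of_mem u.2, one_mul,
      NormedSpace.star_exp, ha.star_eq]
  rw [h, CFC.log_exp a ha]

theorem polar_unitary_mul_exp (u : unitary M) {a : M} (ha : IsSelfAdjoint a) :
    polar (Unitary.toUnits u * expUnit a) = u := by
  refine Subtype.ext ?_
  rw [coe_polar, log_abs_unitary_mul_exp u ha]
  change (u : M) * NormedSpace.exp a * NormedSpace.exp (-a) = u
  rw [mul_assoc, exp_mul_exp_neg, mul_one]

theorem polar_unitary (u : unitary M) : polar (Unitary.toUnits u) = u := by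
  have := polar_unitary_mul_exp u (.zero M)
  rwa [expUnit_zero, mul_one] at this

theorem polar_unitary_mul (u : unitary M) (x : Mˣ) :
    polar (Unitary.toUnits u * x) = u * polar x := by
  have hsa : IsSelfAdjoint (CFC.log (CFC.abs (x : M))) := .log
  conv_lhs => rw [← polar_mul_exp x, ← mul_assoc, ← map_mul]
  exact polar_unitary_mul_exp _ hsa

theorem continuous_log_abs : Continuous fun x : Mˣ => CFC.log (CFC.abs (x : M)) := by
  simp only [log_abs_eq]
  refine Continuous.const_smul ?_ _
  exact CFC.continuousOn_log.comp_continuous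
    ((continuous_star.comp Units.continuous_val).mul Units.continuous_val)
    fun x => ⟨.star_mul_self _, (isStrictlyPositive_star_mul_self x).isUnit⟩

theorem continuous_polar : Continuous (polar : Mˣ → unitary M) :=
  Continuous.subtype_mk (Units.continuous_val.mul (continuous_exp.comp continuous_log_abs.neg)) _

theorem polar_one : polar (1 : Mˣ) = 1 := by
  simpa using polar_unitary (1 : unitary M)

omit [PartialOrder M] [StarOrderedRing M] in
theorem IsSelfAdjoint.of_hasDerivAt {m : ℝ → M} {m' : M} {t : ℝ} (h : HasDerivAt m m' t)
    (hs : ∀ s, IsSelfAdjoint (m s)) : IsSelfAdjoint m' := by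
  have := h.star
  have e : (fun s => star (m s)) = m := funext fun s => (hs s).star_eq
  rw [e] at this
  exact this.unique h

/-- The unitary part of `e^a y`, for `a` self-adjoint, agrees with that of `y` modulo
commutators. -/
theorem polar_exp_mul_mem {a : M} (ha : IsSelfAdjoint a) (y : Mˣ) :
    polar (expUnit a * y) * (polar y)⁻¹ ∈ CG0 (unitary M) := by
  let x : ℝ → Mˣ := fun t => expUnit (t • a) * y
  have hx : ∀ t, HasDerivAt (fun t => (x t : M)) (a * x t) t := fun t => by
    have := (hasDerivAt_exp_smul_const' (𝕂 := ℝ) a t).mul_const (y : M)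
    rwa [mul_assoc] at this
  let l : ℝ → M := fun t => CFC.log (CFC.abs (x t : M))
  have hl : ∀ t, IsSelfAdjoint (l t) := fun t => .log
  have hld : ∀ t, DifferentiableAt ℝ l t := fun t => by
    have e : l = fun t => (2 : ℝ)⁻¹ • CFC.log (star (x t : M) * x t) :=
      funext fun t => log_abs_eq (x t)
    rw [e]
    refine DifferentiableAt.const_smul ?_ _
    exact ((hx t).star.mul (hx t)).differentiableAt.cfc_log (fun s => .star_mul_self _)
      (isStrictlyPositive_star_mul_self (x t))
  let m : ℝ → M := fun t => NormedSpace.exp (-(l t))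
  have hmd : ∀ t, DifferentiableAt ℝ m t := fun t =>
    (contDiff_exp.differentiable one_ne_zero _).comp t (hld t).neg
  have hms : ∀ t, IsSelfAdjoint (m t) := fun t => (hl t).neg.exp
  let m' : ℝ → M := fun t => deriv m t
  have hm' : ∀ t, IsSelfAdjoint (m' t) := fun t => .of_hasDerivAt (hmd t).hasDerivAt hms
  let w : ℝ → unitary M := fun t => polar (x t)
  -- `k` is the left logarithmic derivative `w' w⁻¹` of `w = x e^{-l}`.
  let k : ℝ → M := fun t => a + x t * (m' t * NormedSpace.exp (l t)) * ((x t)⁻¹ : Mˣ)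
  have hw : ∀ t, HasDerivAt (fun t => (w t : M)) (k t * w t) t := fun t => by
    have h1 := (hx t).fun_mul (hmd t).hasDerivAt
    suffices e : k t * (x t * m t) = a * x t * m t + x t * deriv m t by
      rw [← e] at h1
      exact h1
    simp only [k, m, m']
    rw [add_mul]
    congr 1
    · rw [mul_assoc]
    · calc _ = (x t : M) * (deriv m t * (NormedSpace.exp (l t) * ((((x t)⁻¹ : Mˣ) : M) * x t *
              NormedSpace.exp (-l t)))) := by simp only [mul_assoc]; rfl
        _ = _ := by rw [Units.inv_mul, one_mul, exp_mul_exp_neg, mul_one]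
  have hskew : ∀ t, star (k t) = -k t := fun t => by
    have h1 := (hw t).fun_mul (hw t).star
    have e : (fun s => (w s : M) * star (w s : M)) = fun _ => 1 :=
      funext fun s => Unitary.mul_star_self_of_mem (w s).2
    rw [e] at h1
    have h2 := h1.unique (hasDerivAt_const t (1 : M))
    rw [star_mul, mul_assoc, Unitary.mul_star_self_of_mem (w t).2, mul_one, ← mul_assoc,
      Unitary.mul_star_self_of_mem (w t).2, one_mul, add_comm] at h2
    exact eq_neg_of_add_eq_zero_left h2
  let c : ℝ → selfAdjoint M := fun t => ⟨-(Complex.I • k t), by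
    rw [selfAdjoint.mem_iff, star_neg, star_smul, hskew, Complex.star_def, Complex.conj_I, neg_smul,
      smul_neg, neg_neg]⟩
  have hIc : ∀ t, Complex.I • (c t : M) = k t := fun t => by
    change Complex.I • -(Complex.I • k t) = k t
    rw [smul_neg, smul_smul, Complex.I_mul_I, neg_smul, one_smul, neg_neg]
  -- A trace ignores the conjugation by `x t` and may symmetrise `m' e^l`, a product of self-adjoint
  -- elements. So `τ(k)` is real, and `c = -ik` has a value with real part zero.
  have hhat : ∀ t, hat (c t : M) = 0 := fun t => by
    refine AffT.ext fun τ => ?_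
    change ((τ : WeakDual ℂ M) (-(Complex.I • k t))).re = 0
    have h1 : (τ : WeakDual ℂ M) (k t) = (τ : WeakDual ℂ M) a +
        (τ : WeakDual ℂ M) (m' t * NormedSpace.exp (l t)) := by
      simp only [k]
      rw [map_add, τ.2.2.2, ← mul_assoc, Units.inv_mul, one_mul]
    have h2 : (τ : WeakDual ℂ M) (m' t * NormedSpace.exp (l t)) =
        (2 : ℂ)⁻¹ * (τ : WeakDual ℂ M)
          (m' t * NormedSpace.exp (l t) + NormedSpace.exp (l t) * m' t) := by
      rw [map_add, τ.2.2.2 (NormedSpace.exp (l t))]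
      ring
    have h3 : IsSelfAdjoint (m' t * NormedSpace.exp (l t) + NormedSpace.exp (l t) * m' t) := by
      rw [IsSelfAdjoint, star_add, star_mul, star_mul, (hm' t).star_eq, (hl t).exp.star_eq, add_comm]
    rw [map_neg, map_smul, h1, h2, TracialState.apply_eq_re τ ha, TracialState.apply_eq_re τ h3]
    simp
  have hmem : ∀ t s : ℝ, selfAdjoint.expUnitary (s • c t) ∈ CG0 (unitary M) := fun t s =>
    expUnitaryQuot_eq_zero_iff.1 (expUnitaryQuot_of_mem_traceNull
      (mem_traceNull_of_hat_eq_zero (c t).2 (hhat t)) s)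
  have hfin := mem_of_logDeriv (N := CG0 (unitary M)) isClosed_CG0
    (w := fun t => w t * (polar y)⁻¹) (c := c) (fun t => by
      rw [hIc]
      have := (hw t).mul_const (((polar y)⁻¹ : unitary M) : M)
      rw [mul_assoc] at this
      exact this) hmem (by
      have e : w 0 = polar y := by simp only [w, x, zero_smul, expUnit_zero, one_mul]
      change w 0 * _ ∈ _
      rw [e, mul_inv_cancel]
      exact one_mem _)
  simpa only [w, x, one_smul] using hfin

/-- In `x y = u e^a y` the unitary `u` splits off exactly, and `e^a` may be dropped by
`polar_exp_mul_mem`. -/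
theorem mk_polar_mul (x y : Mˣ) :
    (polar (x * y) : unitary M ⧸ CG0 (unitary M)) = polar x * polar y := by
  have hsa : IsSelfAdjoint (CFC.log (CFC.abs (x : M))) := .log
  have h := polar_exp_mul_mem hsa y
  conv_lhs => rw [← polar_mul_exp x, mul_assoc, polar_unitary_mul, QuotientGroup.mk_mul]
  congr 1
  rw [← QuotientGroup.eq_one_iff, QuotientGroup.mk_mul, QuotientGroup.mk_inv, mul_inv_eq_one] at h
  exact h

end Polar

/-! ### Matrices -/

section MatrixAlgebra

/-- The exponential under a non-unital homomorphism. -/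
theorem exp_map_of_mul {R S : Type*} [NormedRing R] [NormedAlgebra ℝ R] [CompleteSpace R]
    [NormedRing S] [NormedAlgebra ℝ S] [CompleteSpace S] (θ : R →L[ℝ] S)
    (hθ : ∀ x y, θ (x * y) = θ x * θ y) (a : R) :
    NormedSpace.exp (θ a) = 1 + θ (NormedSpace.exp a - 1) := by
  have h1 := NormedSpace.exp_series_hasSum_exp' (𝕂 := ℝ) a
  have h2 := NormedSpace.exp_series_hasSum_exp' (𝕂 := ℝ) (θ a)
  rw [← hasSum_nat_add_iff' 1] at h1 h2
  simp only [Finset.sum_range_one, Nat.factorial_zero, Nat.cast_one, inv_one, pow_zero,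
    one_smul] at h1 h2
  have hpow : ∀ n : ℕ, θ (a ^ (n + 1)) = θ a ^ (n + 1) := by
    intro n
    induction n with
    | zero => simp
    | succ n ih => rw [pow_succ, hθ, ih, ← pow_succ]
  have h3 := θ.hasSum h1
  simp only [map_smul, hpow] at h3
  rw [h3.unique h2]
  abel

variable {A : Type u} [CStarAlgebra A] [PartialOrder A] [StarOrderedRing A]

theorem Mat.add_apply {n : ℕ} (x y : Mat A n) (i j : Fin n) : (x + y) i j = x i j + y i j := rfl

theorem Mat.sub_apply {n : ℕ} (x y : Mat A n) (i j : Fin n) : (x - y) i j = x i j - y i j := rfl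

theorem Mat.zero_apply {n : ℕ} (i j : Fin n) : (0 : Mat A n) i j = 0 := rfl

theorem Mat.smul_apply {n : ℕ} (c : ℂ) (x : Mat A n) (i j : Fin n) : (c • x) i j = c • x i j := rfl

theorem Mat.real_smul_apply {n : ℕ} (c : ℝ) (x : Mat A n) (i j : Fin n) :
    (c • x) i j = c • x i j := rfl

theorem Mat.sum_apply {n : ℕ} {κ : Type*} (s : Finset κ) (f : κ → Mat A n) (i j : Fin n) :
    (∑ k ∈ s, f k) i j = ∑ k ∈ s, f k i j := by
  classical
  induction s using Finset.induction_on with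
  | empty => simp [Mat.zero_apply]
  | insert k s hk ih => rw [Finset.sum_insert hk, Finset.sum_insert hk, Mat.add_apply, ih]

/-- The functional on matrices induced by a tracial state. -/
def matTrace (n : ℕ) (τ : TracialState A) : StrongDual ℂ (Mat A n) where
  toFun b := (τ : WeakDual ℂ A) (∑ i, b i i)
  map_add' x y := by simp only [Mat.add_apply, Finset.sum_add_distrib, map_add]
  map_smul' c x := by simp only [Mat.smul_apply, ← Finset.smul_sum, map_smul, RingHom.id_apply]
  cont := (WeakDual.toStrongDual (τ : WeakDual ℂ A)).continuous.comp
    (continuous_finsetSum _ fun i _ => Mat.continuous_apply A i i)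

theorem matTrace_apply (n : ℕ) (τ : TracialState A) (b : Mat A n) :
    matTrace n τ b = (τ : WeakDual ℂ A) (∑ i, b i i) := rfl

theorem matTrace_mul_comm (n : ℕ) (τ : TracialState A) (x y : Mat A n) :
    matTrace n τ (x * y) = matTrace n τ (y * x) := by
  simp only [matTrace_apply, Mat.mul_apply, map_sum]
  rw [Finset.sum_comm]
  exact Finset.sum_congr rfl fun i _ => Finset.sum_congr rfl fun j _ => τ.2.2.2 _ _

theorem hatMat_add {n : ℕ} (x y : Mat A n) : hatMat (x + y) = hatMat x + hatMat y := by
  simp only [hatMat, Mat.add_apply, Finset.sum_add_distrib]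
  exact map_add hatHom _ _

theorem continuous_hatMat (n : ℕ) : Continuous (hatMat : Mat A n → AffT A) :=
  continuous_hat.comp (continuous_finsetSum _ fun i _ => Mat.continuous_apply A i i)

theorem hatLogAbs_mul {n : ℕ} (x y : GLn A n) :
    hatLogAbs (x * y) = hatLogAbs x + hatLogAbs y := by
  refine AffT.ext fun τ => ?_
  have := trace_log_abs_mul (matTrace_mul_comm n τ) x y
  exact (congrArg Complex.re this).trans (Complex.add_re _ _)

variable (A) in
/-- `x ↦ (log |x|)^` as a homomorphism. -/
def detHom (n : ℕ) : GLn A n →* Multiplicative (AffT A) :=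
  MonoidHom.mk' (fun x => Multiplicative.ofAdd (hatLogAbs x)) fun x y => by
    rw [hatLogAbs_mul]; rfl

theorem detHom_apply {n : ℕ} (x : GLn A n) :
    detHom A n x = Multiplicative.ofAdd (hatLogAbs x) := rfl

theorem continuous_detHom (n : ℕ) : Continuous (detHom A n) :=
  continuous_ofAdd.comp ((continuous_hatMat n).comp continuous_log_abs)

theorem detHom_unitary_mul_exp {n : ℕ} (u : Un A n) {a : Mat A n} (ha : IsSelfAdjoint a) :
    detHom A n (Unitary.toUnits u * expUnit a) = Multiplicative.ofAdd (hatMat a) := by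
  rw [detHom_apply, hatLogAbs, log_abs_unitary_mul_exp u ha]

/-! #### The corner embedding -/

/-- The matrix unit `e_ij ⊗ x`. -/
def matSingle {n : ℕ} (i j : Fin n) (x : A) : Mat A n :=
  Mat.of fun k l => if k = i ∧ l = j then x else 0

omit [PartialOrder A] [StarOrderedRing A] in
theorem matSingle_apply {n : ℕ} (i j : Fin n) (x : A) (k l : Fin n) :
    matSingle i j x k l = if k = i ∧ l = j then x else 0 := rfl

theorem matSingle_add {n : ℕ} (i j : Fin n) (x y : A) :
    matSingle i j (x + y) = matSingle i j x + matSingle i j y :=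
  Mat.ext fun k l => by
    rw [Mat.add_apply]; simp only [matSingle_apply]; split_ifs <;> simp

theorem matSingle_mul {n : ℕ} (i j k l : Fin n) (x y : A) :
    matSingle i j x * matSingle k l y = if j = k then matSingle i l (x * y) else 0 := by
  refine Mat.ext fun p q => ?_
  rw [Mat.mul_apply]
  by_cases h : j = k
  · subst h
    rw [if_pos rfl, Finset.sum_eq_single j]
    · simp only [matSingle_apply]
      by_cases h1 : p = i <;> by_cases h2 : q = l <;> simp [h1, h2]
    · intro r _ hr
      simp [matSingle_apply, hr]
    · intro h'
      exact absurd (Finset.mem_univ _) h'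
  · rw [if_neg h, Mat.zero_apply]
    refine Finset.sum_eq_zero fun r _ => ?_
    by_cases hr : r = j
    · subst hr; simp [matSingle_apply, h]
    · simp [matSingle_apply, hr]

theorem matSingle_star {n : ℕ} (i j : Fin n) (x : A) :
    star (matSingle i j x) = matSingle j i (star x) :=
  Mat.ext fun k l => by
    rw [Mat.star_apply]; simp only [matSingle_apply]
    by_cases h1 : k = j <;> by_cases h2 : l = i <;> simp [h1, h2]

theorem sum_matSingle {n : ℕ} (b : Mat A n) : b = ∑ i, ∑ j, matSingle i j (b i j) := by
  refine Mat.ext fun k l => ?_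
  simp only [Mat.sum_apply, matSingle_apply]
  rw [Finset.sum_eq_single k, Finset.sum_eq_single l] <;> simp +contextual [eq_comm]

/-- The embedding of `A` as the `i`-th diagonal corner of `M_n(A)`. -/
def corner {n : ℕ} (i : Fin n) : A →L[ℝ] Mat A n where
  toFun := matSingle i i
  map_add' := matSingle_add i i
  map_smul' c x := Mat.ext fun k l => by
    rw [Mat.real_smul_apply]; simp only [matSingle_apply]; split_ifs <;> simp
  cont := Mat.continuous_of_apply A fun k l => by
    simp only [matSingle_apply]
    split_ifs
    exacts [continuous_id, continuous_const]

theorem corner_apply {n : ℕ} (i : Fin n) (x : A) : corner i x = matSingle i i x := rfl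

theorem corner_mul {n : ℕ} (i : Fin n) (x y : A) : corner i (x * y) = corner i x * corner i y := by
  rw [corner_apply, corner_apply, corner_apply, matSingle_mul, if_pos rfl]

theorem corner_star {n : ℕ} (i : Fin n) (x : A) : corner i (star x) = star (corner i x) := by
  rw [corner_apply, corner_apply, matSingle_star]

theorem hatMat_corner {n : ℕ} (i : Fin n) (a : A) : hatMat (corner i a) = hat a := by
  rw [hatMat, Finset.sum_eq_single i]
  · simp [corner_apply, matSingle_apply]
  · intro j _ hj
    simp [corner_apply, matSingle_apply, hj]
  · intro h
    exact absurd (Finset.mem_univ _) h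

theorem GLone_expUnit {n : ℕ} (hn : 0 < n) (a : A) :
    GLone A n (expUnit a) = expUnit (corner (⟨0, hn⟩ : Fin n) a) := by
  refine Units.ext ?_
  change _ = NormedSpace.exp (corner (⟨0, hn⟩ : Fin n) a)
  rw [exp_map_of_mul (corner ⟨0, hn⟩) (corner_mul _) a]
  refine Mat.ext fun i j => ?_
  rw [Mat.add_apply, Mat.one_apply, corner_apply, matSingle_apply]
  change (if i = j then if (i : ℕ) = 0 then NormedSpace.exp a else 1 else 0) = _
  simp only [Fin.ext_iff]
  by_cases h1 : (i : ℕ) = 0 <;> by_cases h2 : (j : ℕ) = 0 <;> by_cases h3 : (i : ℕ) = j <;>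
    simp_all

/-- Write `e_ij ⊗ x = (e_{i i₀} ⊗ x)(e_{i₀ j} ⊗ 1)`. Exchanging the factors moves a diagonal entry
to the corner `i₀` and annihilates an off-diagonal one. -/
theorem expQuot_eq_corner {n : ℕ} (i₀ : Fin n) (b : Mat A n) :
    expQuot (Mat A n) b = expQuot (Mat A n) (corner i₀ (∑ i, b i i)) := by
  have h : ∀ (i j : Fin n) (x : A), expQuot (Mat A n) (matSingle i j x) =
      if i = j then expQuot (Mat A n) (corner i₀ x) else 0 := by
    intro i j x
    have e1 : matSingle i j x = matSingle i i₀ x * matSingle i₀ j 1 := by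
      rw [matSingle_mul, if_pos rfl, mul_one]
    rw [e1, expQuot_mul_comm, matSingle_mul, one_mul]
    by_cases hij : i = j
    · rw [if_pos hij, if_pos hij.symm]; rfl
    · rw [if_neg hij, if_neg (Ne.symm hij), map_zero]
  have e : b - corner i₀ (∑ i, b i i) =
      ∑ i, ∑ j, (matSingle i j (b i j) - if i = j then corner i₀ (b i j) else 0) := by
    simp only [Finset.sum_sub_distrib, Finset.sum_ite_eq, Finset.mem_univ, if_true]
    rw [← sum_matSingle b, map_sum]
  rw [← sub_eq_zero, ← map_sub, e, ← AddMonoidHom.mem_ker]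
  refine AddSubgroup.sum_mem _ fun i _ => AddSubgroup.sum_mem _ fun j _ => ?_
  rw [AddMonoidHom.mem_ker, map_sub, h, sub_eq_zero]
  split_ifs
  · rfl
  · rw [map_zero]

theorem expQuot_corner_of_mem_traceNull {n : ℕ} (i : Fin n) {a : A} (ha : a ∈ traceNull A) :
    expQuot (Mat A n) (corner i a) = 0 := by
  have hcl : IsClosed {b : Mat A n | expQuot (Mat A n) b = 0} := by
    simp only [expQuot_eq_zero_iff]
    exact isClosed_setOf_expUnit_mem
  have h := traceNull_induction
    (p := fun a => ∀ s : ℝ, expQuot (Mat A n) (s • (corner i a : Mat A n)) = 0)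
    (by
      simp only [Set.ofPred_forall]
      exact isClosed_iInter fun s => hcl.preimage (f := fun x : A => s • (corner i x : Mat A n))
        ((corner i : A →L[ℝ] Mat A n).continuous.const_smul s))
    (fun s => by simp) (fun x y hx hy s => by rw [map_add, smul_add, map_add, hx, hy, add_zero])
    (fun r x hx s => by rw [map_smul (corner i) r x, smul_smul, hx]) (fun x s => by
      rw [map_sub, corner_mul, corner_mul, smul_sub, map_sub, ← smul_mul_assoc, ← mul_smul_comm,
        expQuot_mul_comm, sub_self]) ha 1
  rwa [one_smul] at h

theorem expQuot_eq_zero_of_hatMat_eq_zero {n : ℕ} (i₀ : Fin n) {b : Mat A n} (hb : IsSelfAdjoint b)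
    (h : hatMat b = 0) : expQuot (Mat A n) b = 0 := by
  rw [expQuot_eq_corner i₀]
  refine expQuot_corner_of_mem_traceNull i₀ (mem_traceNull_of_hat_eq_zero ?_ h)
  rw [IsSelfAdjoint, star_sum]
  refine Finset.sum_congr rfl fun i _ => ?_
  rw [← Mat.star_apply, hb.star_eq]

/-- An invertible matrix is, modulo commutators, the product of its unitary part and of any
exponential with the same determinant. -/
theorem mk_eq_polar_mul {n : ℕ} (hn : 0 < n) (x : GLn A n) {a : A} (ha : IsSelfAdjoint a)
    (h : hat a = hatLogAbs x) : (x : GLn A n ⧸ CG0 (GLn A n)) =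
      Unitary.toUnits (polar x) * (GLone A n (expUnit a) : GLn A n) := by
  set l := CFC.log (CFC.abs (x : Mat A n)) with hl
  have hlsa : IsSelfAdjoint l := .log
  have h1 : expQuot (Mat A n) (l - corner ⟨0, hn⟩ a) = 0 := by
    refine expQuot_eq_zero_of_hatMat_eq_zero ⟨0, hn⟩ (hlsa.sub ?_) ?_
    · rw [IsSelfAdjoint, ← corner_star, ha.star_eq]
    · have := hatMat_add (l - corner ⟨0, hn⟩ a) (corner ⟨0, hn⟩ a)
      rw [sub_add_cancel, hatMat_corner, h] at this
      exact (left_eq_add.1 (this.trans (add_comm _ _)))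
  rw [map_sub, sub_eq_zero] at h1
  have h2 : (expUnit l : GLn A n ⧸ CG0 (GLn A n)) = expUnit (corner (⟨0, hn⟩ : Fin n) a) := h1
  rw [GLone_expUnit hn, ← h2, ← QuotientGroup.mk_mul, polar_mul_exp]

/-! #### Padding -/

/-- The matrix `x ⊕ 0`. -/
def padZero (m n : ℕ) : Mat A m →L[ℝ] Mat A n where
  toFun x := Mat.of fun i j => if h : (i : ℕ) < m ∧ (j : ℕ) < m then x ⟨i, h.1⟩ ⟨j, h.2⟩ else 0
  map_add' x y := Mat.ext fun i j => by
    rw [Mat.add_apply]; simp only [Mat.of_apply]; split_ifs <;> simp [Mat.add_apply]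
  map_smul' c x := Mat.ext fun i j => by
    rw [Mat.real_smul_apply]; simp only [Mat.of_apply]; split_ifs <;> simp [Mat.real_smul_apply]
  cont := Mat.continuous_of_apply A fun i j => by
    simp only [Mat.of_apply]
    split_ifs
    exacts [Mat.continuous_apply A _ _, continuous_const]

theorem padZero_apply {m n : ℕ} (x : Mat A m) (i j : Fin n) : padZero m n x i j =
    if h : (i : ℕ) < m ∧ (j : ℕ) < m then x ⟨i, h.1⟩ ⟨j, h.2⟩ else 0 := rfl

theorem padZero_eq {m n : ℕ} (h : m ≤ n) (x : Mat A m) :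
    padZero m n x = pad A m n h x - pad A m n h 0 := by
  refine Mat.ext fun i j => ?_
  rw [Mat.sub_apply, pad_apply, pad_apply, padMat_apply, padMat_apply, padZero_apply]
  by_cases hij : (i : ℕ) < m ∧ (j : ℕ) < m
  · rw [dif_pos hij, dif_pos hij, dif_pos hij, Mat.zero_apply, sub_zero]
  · rw [dif_neg hij, dif_neg hij, dif_neg hij, sub_self]

theorem padZero_mul {m n : ℕ} (h : m ≤ n) (x y : Mat A m) :
    padZero m n (x * y) = padZero m n x * padZero m n y := by
  simp only [padZero_eq h, mul_sub, sub_mul, ← map_mul, mul_zero, zero_mul]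
  abel

theorem padZero_star {m n : ℕ} (h : m ≤ n) (x : Mat A m) :
    padZero m n (star x) = star (padZero m n x) := by
  rw [padZero_eq h, padZero_eq h, star_sub, ← map_star, ← map_star, star_zero]

theorem hatMat_padZero {m n : ℕ} (h : m ≤ n) (x : Mat A m) : hatMat (padZero m n x) = hatMat x := by
  obtain ⟨d, rfl⟩ := Nat.exists_eq_add_of_le h
  rw [hatMat, hatMat, Fin.sum_univ_add]
  simp [padZero_apply]

theorem GLpad_expUnit {m n : ℕ} (h : m ≤ n) (a : Mat A m) :
    GLpad A m n h (expUnit a) = expUnit (padZero m n a) := by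
  refine Units.ext ?_
  change pad A m n h (NormedSpace.exp a) = NormedSpace.exp (padZero m n a)
  rw [exp_map_of_mul (padZero m n) (padZero_mul h) a, padZero_eq h, ← map_one (pad A m n h)]
  have e : pad A m n h (NormedSpace.exp a - 1) - pad A m n h 0 =
      pad A m n h (NormedSpace.exp a) - pad A m n h 1 := by
    rw [← padZero_eq h, map_sub, padZero_eq h, padZero_eq h]
    abel
  rw [e]
  abel

theorem GLpad_toUnits {m n : ℕ} (h : m ≤ n) (u : Un A m) :
    GLpad A m n h (Unitary.toUnits u) = Unitary.toUnits (Upad A m n h u) :=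
  Units.ext rfl

/-- Padding turns `u e^l` into `(u ⊕ 1) e^{l ⊕ 0}`, which is again a polar decomposition. -/
theorem polar_GLpad {m n : ℕ} (h : m ≤ n) (x : GLn A m) :
    polar (GLpad A m n h x) = Upad A m n h (polar x) := by
  have hsa : IsSelfAdjoint (CFC.log (CFC.abs (x : Mat A m))) := .log
  conv_lhs => rw [← polar_mul_exp x, map_mul, GLpad_toUnits, GLpad_expUnit]
  refine polar_unitary_mul_exp _ ?_
  rw [IsSelfAdjoint, ← padZero_star h, hsa.star_eq]

theorem detHom_GLpad {m n : ℕ} (h : m ≤ n) (x : GLn A m) :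
    detHom A n (GLpad A m n h x) = detHom A m x := by
  have hsa : IsSelfAdjoint (CFC.log (CFC.abs (x : Mat A m))) := .log
  conv_lhs => rw [← polar_mul_exp x, map_mul, GLpad_toUnits, GLpad_expUnit]
  rw [detHom_unitary_mul_exp, hatMat_padZero h]
  · rfl
  · rw [IsSelfAdjoint, ← padZero_star h, hsa.star_eq]

theorem GLpad_GLone {n : ℕ} (h : 1 ≤ n) (x : Aˣ) : GLpad A 1 n h (GLone A 1 x) = GLone A n x := by
  refine Units.ext (Mat.ext fun i j => ?_)
  change padMat n _ i j = if i = j then if (i : ℕ) = 0 then (x : A) else 1 else 0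
  rw [padMat_apply]
  change (if h : (i : ℕ) < 1 ∧ (j : ℕ) < 1 then if (⟨i, h.1⟩ : Fin 1) = ⟨j, h.2⟩ then
    if (i : ℕ) = 0 then (x : A) else 1 else 0 else if i = j then 1 else 0) = _
  simp only [Fin.ext_iff]
  by_cases h1 : (i : ℕ) = 0 <;> by_cases h2 : (j : ℕ) = 0 <;> by_cases h3 : (i : ℕ) = j <;>
    simp_all

end MatrixAlgebra

/-! ### Splitting off the determinant -/

section Split

open Multiplicative

variable {A : Type v} [CStarAlgebra A] [PartialOrder A] [StarOrderedRing A]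
  {U G : Type u} [Group U] [TopologicalSpace U]
  [Group G] [TopologicalSpace G]

/-- A continuous retraction `j` of `G` onto `U` that is multiplicative modulo normal subgroups, a
determinant `ℓ` and an exponential `E` that splits it make `G` a product of `U` and `Aff T(A)`,
modulo these subgroups. -/
theorem exists_split {M : Subgroup U} [M.Normal] {N : Subgroup G} [N.Normal]
    [IsTopologicalGroup (G ⧸ N)] (inc : U →* G) (hinc : Continuous inc) (j : G → U)
    (hj : Continuous j) (hjinc : ∀ u, j (inc u) = u) (ℓ : G →* Multiplicative (AffT A))
    (hℓ : Continuous ℓ) (hℓinc : ∀ u, ℓ (inc u) = 1) (E : A → G)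
    (hEc : Continuous fun a => (E a : G ⧸ N))
    (hEadd : ∀ a b, (E (a + b) : G ⧸ N) = E a * E b)
    (hℓE : ∀ a, IsSelfAdjoint a → ℓ (E a) = ofAdd (hat a))
    (hjE : ∀ a, IsSelfAdjoint a → j (E a) = 1)
    (hjmul : ∀ x y, (j (x * y) : U ⧸ M) = j x * j y)
    (hjN : ∀ x ∈ N, j x ∈ M) (hincM : ∀ u ∈ M, inc u ∈ N) (hℓN : N ≤ ℓ.ker)
    (hdec : ∀ x a, IsSelfAdjoint a → ofAdd (hat a) = ℓ x → (x : G ⧸ N) = inc (j x) * (E a : G)) :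
    ∃ (ι : U ⧸ M →* G ⧸ N) (χ : G ⧸ N →* Multiplicative (AffT A))
      (s : Multiplicative (AffT A) →* G ⧸ N) (Φ : G ⧸ N ≃ₜ* (U ⧸ M) × Multiplicative (AffT A)),
      (∀ u : U, ι u = inc u) ∧ (∀ x : G, χ x = ℓ x) ∧
      (∀ a, IsSelfAdjoint a → s (ofAdd (hat a)) = E a) ∧ IsSplitShortExact ι χ s ∧
      ∀ v f, Φ.symm (v, f) = ι v * s f := by
  let ι : U ⧸ M →* G ⧸ N := QuotientGroup.map M N inc hincM
  let r : G ⧸ N →* U ⧸ M := QuotientGroup.lift N (MonoidHom.mk' (fun x => (j x : U ⧸ M)) hjmul)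
    fun x hx => (QuotientGroup.eq_one_iff (j x)).2 (hjN x hx)
  let χ : G ⧸ N →* Multiplicative (AffT A) := QuotientGroup.lift N ℓ hℓN
  have hιc : Continuous ι := continuous_quot_lift _ (continuous_quot_mk.comp hinc)
  have hrc : Continuous r := continuous_quot_lift _ (continuous_quot_mk.comp hj)
  have hχc : Continuous χ := continuous_quot_lift _ hℓ
  have hE0 : (E 0 : G ⧸ N) = 1 := by
    have := hEadd 0 0
    rwa [add_zero, left_eq_mul] at this
  -- The splitting is well defined: decomposing `E a` by means of `E b` leaves the trivial unitary
  -- part `j (E a) = 1`.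
  have hEeq : ∀ a b, IsSelfAdjoint a → IsSelfAdjoint b → hat a = hat b →
      (E a : G ⧸ N) = E b := fun a b ha hb h => by
    rw [hdec (E a) b hb ((hℓE a ha).trans (congrArg ofAdd h)).symm, hjE a ha, map_one,
      QuotientGroup.mk_one, one_mul]
  choose α hαsa hα using fun f : AffT A => exists_hat_eq f
  have hat_add : ∀ a b : A, hat (a + b) = hat a + hat b := fun a b => map_add hatHom a b
  let s : Multiplicative (AffT A) →* G ⧸ N :=
    MonoidHom.mk' (fun f => (E (α (toAdd f)) : G ⧸ N)) fun f g => by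
      rw [← hEadd]
      refine hEeq _ _ (hαsa _) ((hαsa _).add (hαsa _)) ?_
      rw [hα, hat_add, hα, hα]
      rfl
  have hs : ∀ a, IsSelfAdjoint a → s (ofAdd (hat a)) = E a := fun a ha =>
    hEeq _ _ (hαsa _) ha (hα _)
  -- Continuity at the identity suffices. A function of norm below `δ/4` has a lift of norm below
  -- `3δ/4 + δ/4 = δ`.
  have hsc : Continuous s := by
    refine continuous_of_continuousAt_one s ?_
    rw [ContinuousAt, map_one]
    intro W hW
    have h0 : (fun a => (E a : G ⧸ N)) ⁻¹' W ∈ 𝓝 (0 : A) :=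
      hEc.continuousAt (by rw [hE0]; exact hW)
    obtain ⟨δ, hδ, hb⟩ := Metric.mem_nhds_iff.1 h0
    have h1 : Metric.ball (0 : AffT A) (δ / 4) ∈ 𝓝 (0 : AffT A) :=
      Metric.ball_mem_nhds _ (by positivity)
    refine Filter.mem_of_superset (x := ofAdd '' Metric.ball (0 : AffT A) (δ / 4)) ?_ ?_
    · exact Homeomorph.image_eq_preimage_symm (⟨ofAdd, continuous_ofAdd, continuous_toAdd⟩ :
        AffT A ≃ₜ Multiplicative (AffT A)) _ ▸ continuous_toAdd.continuousAt.preimage_mem_nhds h1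
    · rintro _ ⟨f, hf, rfl⟩
      obtain ⟨a, ha, rfl⟩ := exists_hat_eq f
      obtain ⟨b, hbsa, hba, hbn⟩ := exists_hat_eq_norm_lt ha (ε := δ / 4) (by positivity)
      have hf' : ‖hat a‖ < δ / 4 := mem_ball_zero_iff.1 hf
      rw [Set.mem_preimage, ← hba, hs b hbsa]
      refine hb ?_
      exact mem_ball_zero_iff.2 (hbn.trans (by linarith))
  have hrι : ∀ v, r (ι v) = v := by
    rintro ⟨u⟩
    exact congrArg _ (hjinc u)
  have hχι : ∀ v, χ (ι v) = 1 := by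
    rintro ⟨u⟩
    exact hℓinc u
  have hχs : ∀ f, χ (s f) = f := fun f => by
    change ℓ (E (α (toAdd f))) = f
    rw [hℓE _ (hαsa _), hα]
    rfl
  have hrs : ∀ f, r (s f) = 1 := fun f => by
    change ((j (E (α (toAdd f))) : U) : U ⧸ M) = 1
    rw [hjE _ (hαsa _), QuotientGroup.mk_one]
  have hdec' : ∀ g, ι (r g) * s (χ g) = g := by
    rintro ⟨x⟩
    exact (hdec x (α (toAdd (ℓ x))) (hαsa _) (congrArg ofAdd (hα _))).symm
  have hemb : IsEmbedding ι := Function.LeftInverse.isEmbedding hrι hrc hιc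
  let Φ : G ⧸ N ≃ₜ* (U ⧸ M) × Multiplicative (AffT A) :=
    { toFun := fun g => (r g, χ g)
      invFun := fun p => ι p.1 * s p.2
      left_inv := hdec'
      right_inv := fun p => by
        change (r (ι p.1 * s p.2), χ (ι p.1 * s p.2)) = p
        rw [map_mul, map_mul, hrι, hrs, hχι, hχs, mul_one, one_mul]
      map_mul' := fun g h => by rw [map_mul, map_mul]; rfl
      continuous_toFun := hrc.prodMk hχc
      continuous_invFun := (hιc.comp continuous_fst).mul (hsc.comp continuous_snd) }
  refine ⟨ι, χ, s, Φ, fun u => rfl, fun x => rfl, hs, ?_, fun v f => rfl⟩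
  refine ⟨hemb.isInducing.topologicalGroup ι, inferInstance, inferInstance, hemb, ?_,
    fun f => ⟨s f, hχs f⟩, hχc, ?_, hsc, hχs⟩
  · ext g
    rw [MonoidHom.mem_ker]
    constructor
    · rintro ⟨v, rfl⟩
      exact hχι v
    · intro h
      have := hdec' g
      rw [h, map_one, mul_one] at this
      exact ⟨_, this⟩
  · exact (isOpenMap_snd (X := U ⧸ M)).comp Φ.toHomeomorph.isOpenMap

/-- Although `j` is only multiplicative modulo `M`, it sends commutators into `M`; continuity and
closedness of `M` handle the closure. This applies to the polar part. -/
theorem map_mem_of_mem_closure_commutator [SeparatelyContinuousMul G] [ContinuousInv G]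
    {M : Subgroup U} [M.Normal] (hM : IsClosed (M : Set U)) {j : G → U} (hj : Continuous j)
    (hjmul : ∀ x y, (j (x * y) : U ⧸ M) = j x * j y) {S : Subgroup G} {R : Subgroup U}
    (hS : ∀ x ∈ S, j x ∈ R) (hR : ⁅R, R⁆ ≤ M) {x : G} (hx : x ∈ closureSubgroup ⁅S, S⁆) :
    j x ∈ M := by
  let r : G →* U ⧸ M := MonoidHom.mk' (fun x => (j x : U ⧸ M)) hjmul
  have h : ⁅S, S⁆ ≤ r.ker := by
    rw [Subgroup.commutator_le]
    intro x hx y hy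
    rw [MonoidHom.mem_ker, map_commutatorElement]
    exact (QuotientGroup.eq_one_iff (j x * j y * (j x)⁻¹ * (j y)⁻¹)).2
      (hR (Subgroup.commutator_mem_commutator (hS x hx) (hS y hy)))
  have h2 : ((⁅S, S⁆ : Subgroup G) : Set G) ⊆ j ⁻¹' M := fun y hy =>
    (QuotientGroup.eq_one_iff (j y)).1 (h hy)
  exact closure_minimal h2 (hM.preimage hj) hx

theorem map_mem_idComponent [SeparatelyContinuousMul G] [ContinuousInv G]
    [SeparatelyContinuousMul U] [ContinuousInv U] {j : G → U} (hj : Continuous j) (h1 : j 1 = 1)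
    {x : G} (hx : x ∈ idComponent G) : j x ∈ idComponent U := by
  have := hj.image_connectedComponent_subset 1 ⟨x, hx, rfl⟩
  rwa [h1] at this

theorem CG0_le_comap [SeparatelyContinuousMul G] [ContinuousInv G]
    [SeparatelyContinuousMul U] [ContinuousInv U] (f : G →* U) (hf : Continuous f) :
    CG0 G ≤ (CG0 U).comap f := fun _ hx =>
  map_mem_of_mem_closure_commutator (M := CG0 U) isClosed_closure hf (fun x y => by rw [map_mul]; rfl)
    (fun _ h => map_mem_idComponent hf (map_one f) h) (fun _ h => subset_closure h) hx

theorem CG0_le_CG (G : Type u) [Group G] [TopologicalSpace G] [SeparatelyContinuousMul G]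
    [ContinuousInv G] : CG0 G ≤ CG G :=
  closure_mono (Subgroup.commutator_mono le_top le_top)

theorem CG_le_ker [SeparatelyContinuousMul G] [ContinuousInv G] {C : Type*} [CommGroup C]
    [TopologicalSpace C] [T1Space C] (ℓ : G →* C) (hℓ : Continuous ℓ) : CG G ≤ ℓ.ker := by
  refine closure_minimal (fun x hx => Abelianization.commutator_subset_ker ℓ hx)
    (isClosed_singleton.preimage hℓ)

end Split

/-! ### The sequences at the finite stages and in the limit -/

section Quotients

instance quotient_separatelyContinuousMul {G : Type*} [Group G] [TopologicalSpace G]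
    [SeparatelyContinuousMul G] (N : Subgroup G) [N.Normal] : SeparatelyContinuousMul (G ⧸ N) where
  continuous_const_mul := by
    rintro ⟨g⟩
    exact continuous_quot_lift _ (continuous_quot_mk.comp (Homeomorph.mulLeft g).continuous)
  continuous_mul_const := by
    rintro ⟨g⟩
    exact continuous_quot_lift _ (continuous_quot_mk.comp (Homeomorph.mulRight g).continuous)

/-- A group whose translations are continuous is a topological group if it receives a continuous
and open homomorphism from a topological group. -/
theorem isTopologicalGroup_of_isOpenMap {Q V : Type*} [Group Q] [TopologicalSpace Q]
    [SeparatelyContinuousMul Q] [AddGroup V] [TopologicalSpace V] [IsTopologicalAddGroup V]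
    (E : V → Q) (hadd : ∀ a b, E (a + b) = E a * E b) (hc : Continuous E) (ho : IsOpenMap E) :
    IsTopologicalGroup Q := by
  have h0 : E 0 = 1 := by
    have := hadd 0 0
    rwa [add_zero, left_eq_mul] at this
  have hneg : ∀ a, (E a)⁻¹ = E (-a) := fun a => inv_eq_of_mul_eq_one_right (by
    rw [← hadd, add_neg_cancel, h0])
  -- Near the identity the topology of `Q` is the image of that of `V`, so joint continuity at `1`
  -- is inherited from addition.
  have hmap : 𝓝 (1 : Q) = Filter.map E (𝓝 0) := by
    refine le_antisymm ?_ ?_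
    · rw [← h0]
      exact ho.nhds_le 0
    · have := hc.tendsto 0
      rwa [h0] at this
  refine IsTopologicalGroup.of_nhds_one' ?_ ?_ (fun g => ?_) fun g => ?_
  · rw [hmap, Filter.prod_map_map_eq, Filter.tendsto_map'_iff, ← hmap, ← nhds_prod_eq]
    have h : Filter.Tendsto (fun p : V × V => E (p.1 + p.2)) (𝓝 (0, 0)) (𝓝 (E (0 + 0))) :=
      (hc.comp (continuous_fst.add continuous_snd)).tendsto _
    rw [add_zero, h0] at h
    exact h.congr fun p => hadd _ _
  · rw [hmap, Filter.tendsto_map'_iff, ← hmap]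
    have h : Filter.Tendsto (fun a : V => E (-a)) (𝓝 0) (𝓝 (E (-0))) :=
      (hc.comp continuous_neg).tendsto _
    rw [neg_zero, h0] at h
    exact h.congr fun a => (hneg a).symm
  · simpa using ((Homeomorph.mulLeft g).map_nhds_eq 1).symm
  · simpa using ((Homeomorph.mulRight g).map_nhds_eq 1).symm

end Quotients

section Sequences

open Multiplicative

variable {A : Type u} [CStarAlgebra A] [PartialOrder A] [StarOrderedRing A]

theorem continuous_toUnits {M : Type*} [CStarAlgebra M] :
    Continuous (Unitary.toUnits : unitary M → Mˣ) :=
  Units.continuous_iff.2 ⟨continuous_subtype_val, continuous_subtype_val.star⟩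

theorem detHom_toUnits {n : ℕ} (u : Un A n) : detHom A n (Unitary.toUnits u) = 1 := by
  have h := detHom_unitary_mul_exp u (IsSelfAdjoint.zero (Mat A n))
  rw [expUnit_zero, mul_one] at h
  rw [h, show hatMat (0 : Mat A n) = 0 by simpa using hatMat_add (0 : Mat A n) 0]
  rfl

theorem isSelfAdjoint_corner {n : ℕ} (i : Fin n) {a : A} (ha : IsSelfAdjoint a) :
    IsSelfAdjoint (corner i a : Mat A n) := by
  rw [IsSelfAdjoint, ← corner_star, ha.star_eq]

theorem continuous_GLone_expUnit {n : ℕ} (hn : 0 < n) :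
    Continuous fun a : A => GLone A n (expUnit a) := by
  simp only [GLone_expUnit hn]
  exact continuous_expUnit.comp (corner _ : A →L[ℝ] Mat A n).continuous

theorem mk_GLone_expUnit_add {n : ℕ} (hn : 0 < n) (a b : A) :
    (GLone A n (expUnit (a + b)) : GLn A n ⧸ CG0 (GLn A n)) =
      GLone A n (expUnit a) * (GLone A n (expUnit b) : GLn A n) := by
  simp only [GLone_expUnit hn, map_add]
  exact mk_expUnit_add _ _

theorem detHom_GLone_expUnit {n : ℕ} (hn : 0 < n) {a : A} (ha : IsSelfAdjoint a) :
    detHom A n (GLone A n (expUnit a)) = ofAdd (hat a) := by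
  have h := detHom_unitary_mul_exp (1 : Un A n) (isSelfAdjoint_corner ⟨0, hn⟩ ha)
  rwa [map_one, one_mul, hatMat_corner, ← GLone_expUnit hn] at h

theorem polar_GLone_expUnit {n : ℕ} (hn : 0 < n) {a : A} (ha : IsSelfAdjoint a) :
    polar (GLone A n (expUnit a)) = 1 := by
  have h := polar_unitary_mul_exp (1 : Un A n) (isSelfAdjoint_corner ⟨0, hn⟩ ha)
  rwa [map_one, one_mul, ← GLone_expUnit hn] at h

theorem polar_mem_CG0 {M : Type*} [CStarAlgebra M] [PartialOrder M] [StarOrderedRing M] {x : Mˣ}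
    (hx : x ∈ CG0 Mˣ) : polar x ∈ CG0 (unitary M) :=
  map_mem_of_mem_closure_commutator isClosed_closure continuous_polar mk_polar_mul
    (fun _ h => map_mem_idComponent continuous_polar polar_one h) (fun _ h => subset_closure h) hx

variable (A) in
theorem exists_split_finite {n : ℕ} (hn : 1 ≤ n) :
    ∃ (ι : Un A n ⧸ CG0 (Un A n) →* GLn A n ⧸ CG0 (GLn A n))
      (χ : GLn A n ⧸ CG0 (GLn A n) →* Multiplicative (AffT A))
      (s : Multiplicative (AffT A) →* GLn A n ⧸ CG0 (GLn A n))
      (Φ : GLn A n ⧸ CG0 (GLn A n) ≃ₜ* (Un A n ⧸ CG0 (Un A n)) × Multiplicative (AffT A)),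
      (∀ v : Un A n, ι v = Unitary.toUnits v) ∧ (∀ x : GLn A n, χ x = detHom A n x) ∧
      (∀ a : A, IsSelfAdjoint a → s (ofAdd (hat a)) = GLone A n (expUnit a)) ∧
      IsSplitShortExact ι χ s ∧ ∀ v f, Φ.symm (v, f) = ι v * s f :=
  exists_split Unitary.toUnits continuous_toUnits polar continuous_polar polar_unitary
    (detHom A n) (continuous_detHom n) detHom_toUnits (fun a => GLone A n (expUnit a))
    (continuous_quot_mk.comp (continuous_GLone_expUnit hn)) (mk_GLone_expUnit_add hn)
    (fun _ ha => detHom_GLone_expUnit hn ha) (fun _ ha => polar_GLone_expUnit hn ha)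
    mk_polar_mul (fun _ hx => polar_mem_CG0 hx) (CG0_le_comap _ continuous_toUnits)
    ((CG0_le_CG _).trans (CG_le_ker _ (continuous_detHom n)))
    fun x _ ha h => mk_eq_polar_mul hn x ha (ofAdd.injective h)

/-! #### The limit -/

variable (A) in
/-- The inclusion of `U_∞(A)` in `GL_∞(A)`. -/
def UinfInclusion : Uinf A →* GLinf A :=
  limitMap (Upad A) (GLpad A) (fun _ => Unitary.toUnits) fun _ _ h u => GLpad_toUnits h u

/-- The unitary part of an element of `GL_∞(A)`. -/
def polarInf : GLinf A → Uinf A :=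
  DirectLimit.map (GLpad A) (Upad A) (fun _ => polar) fun _ _ h x => (polar_GLpad h x).symm

variable (A) in
/-- `x ↦ (log |x|)^` on `GL_∞(A)`. -/
def detInf : GLinf A →* Multiplicative (AffT A) :=
  MonoidHom.mk' (DirectLimit.lift (GLpad A) (fun n x => detHom A n x)
    fun _ _ h x => (detHom_GLpad h x).symm) fun x y => by
      obtain ⟨n, a, b, rfl, rfl⟩ := DirectLimit.exists_eq_mk₂ (GLpad A) x y
      rw [DirectLimit.mul_def]
      simp only [DirectLimit.lift_def, map_mul]

theorem continuous_UinfInclusion : Continuous (UinfInclusion A) :=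
  continuous_limitMap _ _ _ _ fun _ => continuous_toUnits

theorem continuous_polarInf : Continuous (polarInf (A := A)) :=
  continuous_limit_dom _ fun n => (continuous_limitOf _ n).comp continuous_polar

theorem continuous_detInf : Continuous (detInf A) :=
  continuous_limit_dom _ fun n => continuous_detHom n

theorem polarInf_GLof {n : ℕ} (x : GLn A n) : polarInf (GLof A n x) = Uof A n (polar x) := rfl

theorem UinfInclusion_Uof {n : ℕ} (u : Un A n) :
    UinfInclusion A (Uof A n u) = GLof A n (Unitary.toUnits u) := rfl

theorem exists_GLof_eq (x : GLinf A) : ∃ n, 0 < n ∧ ∃ y : GLn A n, GLof A n y = x := by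
  obtain ⟨n, y, rfl⟩ := exists_limitOf (GLpad A) x
  exact ⟨n + 1, n.succ_pos, GLpad A n (n + 1) n.le_succ y, limitOf_map _ _ _ _ _⟩

theorem exists_GLof_eq₂ (x y : GLinf A) :
    ∃ n, ∃ x' y' : GLn A n, GLof A n x' = x ∧ GLof A n y' = y := by
  obtain ⟨n, x', y', h1, h2⟩ := DirectLimit.exists_eq_mk₂ (GLpad A) x y
  exact ⟨n, x', y', h1.symm, h2.symm⟩

theorem GLof_GLone {n : ℕ} (hn : 0 < n) (x : Aˣ) :
    GLof A n (GLone A n x) = GLof A 1 (GLone A 1 x) := by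
  rw [← GLpad_GLone hn, limitOf_map]

/-- The homomorphism from a stage `GL_n(A) / C(GL_n(A)⁰)` to a quotient of `GL_∞(A)`. -/
def GLofQuot (N : Subgroup (GLinf A)) [N.Normal] (hN : CG0 (GLinf A) ≤ N) (n : ℕ) :
    GLn A n ⧸ CG0 (GLn A n) →* GLinf A ⧸ N :=
  QuotientGroup.map _ _ (GLof A n)
    ((CG0_le_comap (GLof A n) (continuous_limitOf _ n)).trans (Subgroup.comap_mono hN))

/-- The homomorphism from a stage `U_n(A) / C(U_n(A)⁰)` to a quotient of `U_∞(A)`. -/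
def UofQuot (M : Subgroup (Uinf A)) [M.Normal] (hM : CG0 (Uinf A) ≤ M) (n : ℕ) :
    Un A n ⧸ CG0 (Un A n) →* Uinf A ⧸ M :=
  QuotientGroup.map _ _ (Uof A n)
    ((CG0_le_comap (Uof A n) (continuous_limitOf _ n)).trans (Subgroup.comap_mono hM))

section

variable (N : Subgroup (GLinf A)) [N.Normal] (hN : CG0 (GLinf A) ≤ N)

/-- The exponential, in the quotient of the limit. -/
def expInf (a : A) : GLinf A := GLof A 1 (GLone A 1 (expUnit a))

theorem expInf_eq {n : ℕ} (hn : 0 < n) (a : A) : expInf a = GLof A n (GLone A n (expUnit a)) :=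
  (GLof_GLone hn _).symm

theorem continuous_expInf : Continuous (expInf (A := A)) :=
  (continuous_limitOf _ 1).comp (continuous_GLone_expUnit one_pos)

include hN

theorem mk_expInf_add (a b : A) :
    (expInf (a + b) : GLinf A ⧸ N) = expInf a * (expInf b : GLinf A) := by
  have := congrArg (GLofQuot N hN 1) (mk_GLone_expUnit_add (A := A) one_pos a b)
  rwa [map_mul] at this

theorem mk_GLof_expUnit {n : ℕ} (hn : 0 < n) (b : Mat A n) :
    (GLof A n (expUnit b) : GLinf A ⧸ N) = expInf (∑ i, b i i) := by
  have h : (expUnit b : GLn A n ⧸ CG0 (GLn A n)) =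
      expUnit (corner (⟨0, hn⟩ : Fin n) (∑ i, b i i)) := expQuot_eq_corner ⟨0, hn⟩ b
  rw [← GLone_expUnit hn] at h
  rw [expInf_eq hn]
  exact congrArg (GLofQuot N hN n) h

/-- Openness in the limit can be tested at each stage. There, the elements near `g` are `g e^b` with
`b` small, and the class of `e^b` depends only on the sum of the diagonal entries of `b`; this sum
is small in `A`. -/
theorem isOpenMap_mk_expInf : IsOpenMap fun a : A => (expInf a : GLinf A ⧸ N) := by
  intro V hV
  have key : ∀ n, 0 < n →
      IsOpen {g : GLn A n | (GLof A n g : GLinf A ⧸ N) ∈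
        (fun a => (expInf a : GLinf A ⧸ N)) '' V} := by
    intro n hn
    rw [isOpen_iff_mem_nhds]
    rintro g ⟨a, ha, hag⟩
    have htr : Continuous fun b : Mat A n => a + ∑ i, b i i :=
      continuous_const.add (continuous_finsetSum _ fun i _ => Mat.continuous_apply A i i)
    have hV' : (fun b : Mat A n => a + ∑ i, b i i) ⁻¹' V ∈ 𝓝 (0 : Mat A n) := by
      refine htr.continuousAt (hV.mem_nhds ?_)
      simpa [Mat.zero_apply] using ha
    have h1 : Units.val ⁻¹' (NormedSpace.exp '' ((fun b : Mat A n => a + ∑ i, b i i) ⁻¹' V)) ∈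
        𝓝 (1 : GLn A n) :=
      Units.continuous_val.continuousAt (exp_image_mem_nhds hV')
    have h2 := (Homeomorph.mulLeft g⁻¹).continuous.continuousAt (x := g)
      (show _ ∈ 𝓝 (g⁻¹ * g) by rw [inv_mul_cancel]; exact h1)
    refine Filter.mem_of_superset h2 ?_
    rintro x ⟨b, hb, hbx⟩
    have hx : x = g * expUnit b := by
      rw [← inv_mul_eq_iff_eq_mul]
      exact Units.ext hbx.symm
    refine ⟨a + ∑ i, b i i, hb, ?_⟩
    change (expInf (a + ∑ i, b i i) : GLinf A ⧸ N) = GLof A n x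
    rw [mk_expInf_add N hN, hx, map_mul, QuotientGroup.mk_mul, mk_GLof_expUnit N hN hn]
    exact congrArg (· * _) hag
  refine (QuotientGroup.isQuotientMap_mk N).isOpen_preimage.1 ?_
  refine isQuotientMap_quotient_mk'.isOpen_preimage.1 (isOpen_sigma_iff.2 fun n => ?_)
  rcases Nat.eq_zero_or_pos n with rfl | hn
  -- Stage `0` has no diagonal corner and is treated through stage `1`.
  · have h := (key 1 one_pos).preimage
      (((continuous_pad A 0 1 zero_le_one).units_map (pad A 0 1 zero_le_one).toMonoidHom))
    convert h using 1
    ext g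
    change (GLof A 0 g : GLinf A ⧸ N) ∈ (fun a => (expInf a : GLinf A ⧸ N)) '' V ↔
      (GLof A 1 (GLpad A 0 1 zero_le_one g) : GLinf A ⧸ N) ∈
        (fun a => (expInf a : GLinf A ⧸ N)) '' V
    rw [limitOf_map]
  · exact key n hn

theorem quotient_GLinf_isTopologicalGroup : IsTopologicalGroup (GLinf A ⧸ N) :=
  isTopologicalGroup_of_isOpenMap (fun a : A => (expInf a : GLinf A ⧸ N)) (mk_expInf_add N hN)
    (continuous_quot_mk.comp continuous_expInf) (isOpenMap_mk_expInf N hN)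

omit hN

theorem mk_polarInf_mul (M : Subgroup (Uinf A)) [M.Normal] (hM : CG0 (Uinf A) ≤ M)
    (x y : GLinf A) : (polarInf (x * y) : Uinf A ⧸ M) = polarInf x * (polarInf y : Uinf A) := by
  obtain ⟨n, x, y, rfl, rfl⟩ := exists_GLof_eq₂ x y
  rw [← map_mul]
  exact (congrArg (UofQuot M hM n) (mk_polar_mul x y)).trans (map_mul _ _ _)

theorem polarInf_one : polarInf (1 : GLinf A) = 1 := by
  rw [← map_one (GLof A 0), polarInf_GLof, polar_one, map_one]

-- The subgroups are left arbitrary so that both the quotients by `CG0` and the `K₁`-groups, formed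
-- with `CG`, are covered.
include hN in
theorem exists_split_limit (M : Subgroup (Uinf A)) [M.Normal] (hM : CG0 (Uinf A) ≤ M)
    (hNM : ∀ x ∈ N, polarInf x ∈ M) (hMN : ∀ u ∈ M, UinfInclusion A u ∈ N)
    (hNdet : N ≤ (detInf A).ker) :
    ∃ (ι : Uinf A ⧸ M →* GLinf A ⧸ N) (χ : GLinf A ⧸ N →* Multiplicative (AffT A))
      (s : Multiplicative (AffT A) →* GLinf A ⧸ N)
      (Φ : GLinf A ⧸ N ≃ₜ* (Uinf A ⧸ M) × Multiplicative (AffT A)),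
      (∀ u : Uinf A, ι u = UinfInclusion A u) ∧ (∀ x : GLinf A, χ x = detInf A x) ∧
      (∀ a : A, IsSelfAdjoint a → s (ofAdd (hat a)) = expInf a) ∧
      IsSplitShortExact ι χ s ∧ ∀ v f, Φ.symm (v, f) = ι v * s f := by
  have := quotient_GLinf_isTopologicalGroup N hN
  refine exists_split (UinfInclusion A) continuous_UinfInclusion polarInf continuous_polarInf
    ?_ (detInf A) continuous_detInf ?_ expInf (continuous_quot_mk.comp continuous_expInf)
    (mk_expInf_add N hN) (fun a ha => detHom_GLone_expUnit one_pos ha) (fun a ha => ?_)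
    (mk_polarInf_mul M hM) hNM hMN hNdet ?_
  · intro u
    obtain ⟨n, u, rfl⟩ := exists_limitOf (Upad A) u
    rw [UinfInclusion_Uof, polarInf_GLof, polar_unitary]
  · intro u
    obtain ⟨n, u, rfl⟩ := exists_limitOf (Upad A) u
    exact detHom_toUnits u
  · rw [expInf, polarInf_GLof, polar_GLone_expUnit one_pos ha, map_one]
  · intro x a ha h
    obtain ⟨n, hn, x, rfl⟩ := exists_GLof_eq x
    rw [expInf_eq hn]
    exact (congrArg (GLofQuot N hN n) (mk_eq_polar_mul hn x ha (ofAdd.injective h))).trans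
      (map_mul _ _ _)

end

theorem polarInf_mem_CG0 {x : GLinf A} (hx : x ∈ CG0 (GLinf A)) : polarInf x ∈ CG0 (Uinf A) :=
  map_mem_of_mem_closure_commutator isClosed_closure continuous_polarInf
    (mk_polarInf_mul _ le_rfl)
    (fun _ h => map_mem_idComponent continuous_polarInf polarInf_one h)
    (fun _ h => subset_closure h) hx

theorem polarInf_mem_CG {x : GLinf A} (hx : x ∈ CG (GLinf A)) : polarInf x ∈ CG (Uinf A) := by
  rw [CG, commutator_def] at hx
  exact map_mem_of_mem_closure_commutator (R := ⊤) isClosed_closure continuous_polarInf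
    (mk_polarInf_mul _ (CG0_le_CG _)) (fun _ _ => Subgroup.mem_top _)
    (fun _ h => subset_closure h) hx

end Sequences

/-! ### Naturality -/

section Naturality

open Multiplicative

variable (A : Type u) [CStarAlgebra A] [PartialOrder A] [StarOrderedRing A]

theorem exists_split_CG0 :
    ∃ (ι : Uinf A ⧸ CG0 (Uinf A) →* GLinf A ⧸ CG0 (GLinf A))
      (χ : GLinf A ⧸ CG0 (GLinf A) →* Multiplicative (AffT A))
      (s : Multiplicative (AffT A) →* GLinf A ⧸ CG0 (GLinf A))
      (Φ : GLinf A ⧸ CG0 (GLinf A) ≃ₜ* (Uinf A ⧸ CG0 (Uinf A)) × Multiplicative (AffT A)),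
      (∀ u : Uinf A, ι u = UinfInclusion A u) ∧ (∀ x : GLinf A, χ x = detInf A x) ∧
      (∀ a : A, IsSelfAdjoint a → s (ofAdd (hat a)) = expInf a) ∧
      IsSplitShortExact ι χ s ∧ ∀ v f, Φ.symm (v, f) = ι v * s f :=
  exists_split_limit _ le_rfl _ le_rfl (fun _ => polarInf_mem_CG0)
    (CG0_le_comap _ continuous_UinfInclusion)
    ((CG0_le_CG _).trans (CG_le_ker _ continuous_detInf))

theorem exists_split_K1 :
    ∃ (ι : K1u A →* K1 A) (χ : K1 A →* Multiplicative (AffT A))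
      (s : Multiplicative (AffT A) →* K1 A) (Φ : K1 A ≃ₜ* K1u A × Multiplicative (AffT A)),
      (∀ u : Uinf A, ι u = UinfInclusion A u) ∧ (∀ x : GLinf A, χ x = detInf A x) ∧
      (∀ a : A, IsSelfAdjoint a → s (ofAdd (hat a)) = expInf a) ∧
      IsSplitShortExact ι χ s ∧ ∀ v f, Φ.symm (v, f) = ι v * s f :=
  exists_split_limit _ (CG0_le_CG _) _ (CG0_le_CG _) (fun _ => polarInf_mem_CG)
    (CG_le_comap _ continuous_UinfInclusion) (CG_le_ker _ continuous_detInf)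

variable {A} {B : Type u} [CStarAlgebra B] [PartialOrder B] [StarOrderedRing B] (φ : A →⋆ₐ[ℂ] B)

theorem GLinf.map_expInf (a : A) : GLinf.map φ (expInf a) = expInf (φ a) := by
  refine congrArg (GLof B 1) (Units.ext (Mat.ext fun i j => ?_))
  change φ (if i = j then if (i : ℕ) = 0 then NormedSpace.exp a else 1 else 0) =
    if i = j then if (i : ℕ) = 0 then NormedSpace.exp (φ a) else 1 else 0
  have h : φ (NormedSpace.exp a) = NormedSpace.exp (φ a) := by
    let _ : NormedAlgebra ℚ A := NormedAlgebra.restrictScalars ℚ ℂ A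
    let _ : NormedAlgebra ℚ B := NormedAlgebra.restrictScalars ℚ ℂ B
    exact NormedSpace.map_exp φ (continuous_starAlgHom φ) a
  split_ifs
  exacts [h, map_one φ, map_zero φ]

theorem GLinf.map_UinfInclusion (u : Uinf A) :
    GLinf.map φ (UinfInclusion A u) = UinfInclusion B (Uinf.map φ u) := by
  obtain ⟨n, u, rfl⟩ := exists_limitOf (Upad A) u
  exact congrArg (GLof B n) (Units.ext rfl)

end Naturality

end

/-! ### The split exact sequences and naturality. -/

theorem theoremA :
    -- every element of `Aff T(A)` is of the form `â`
    (∀ (A : Type u) [CStarAlgebra A] [PartialOrder A] [StarOrderedRing A] (f : AffT A),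
      ∃ a : A, IsSelfAdjoint a ∧ hat a = f) ∧
    -- the sequence for finite `n`
    (∀ (A : Type u) [CStarAlgebra A] [PartialOrder A] [StarOrderedRing A] (n : ℕ), 1 ≤ n →
      ∃ (ι : Un A n ⧸ CG0 (Un A n) →* GLn A n ⧸ CG0 (GLn A n))
        (χ : GLn A n ⧸ CG0 (GLn A n) →* Multiplicative (AffT A))
        (s : Multiplicative (AffT A) →* GLn A n ⧸ CG0 (GLn A n)),
        (∀ v : Un A n, ι (QuotientGroup.mk v) = QuotientGroup.mk (Unitary.toUnits v)) ∧
        (∀ x : GLn A n, χ (QuotientGroup.mk x) = Multiplicative.ofAdd (hatLogAbs x)) ∧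
        (∀ a : A, IsSelfAdjoint a →
          s (Multiplicative.ofAdd (hat a)) = QuotientGroup.mk (GLone A n (expUnit a))) ∧
        IsSplitShortExact ι χ s) ∧
    -- the sequence for `n = ∞`
    (∀ (A : Type u) [CStarAlgebra A] [PartialOrder A] [StarOrderedRing A],
      ∃ (ι : Uinf A ⧸ CG0 (Uinf A) →* GLinf A ⧸ CG0 (GLinf A))
        (χ : GLinf A ⧸ CG0 (GLinf A) →* Multiplicative (AffT A))
        (s : Multiplicative (AffT A) →* GLinf A ⧸ CG0 (GLinf A)),
        (∀ (n : ℕ) (v : Un A n),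
          ι (QuotientGroup.mk (Uof A n v)) = QuotientGroup.mk (GLof A n (Unitary.toUnits v))) ∧
        (∀ (n : ℕ) (x : GLn A n),
          χ (QuotientGroup.mk (GLof A n x)) = Multiplicative.ofAdd (hatLogAbs x)) ∧
        (∀ a : A, IsSelfAdjoint a →
          s (Multiplicative.ofAdd (hat a)) =
            QuotientGroup.mk (GLof A 1 (GLone A 1 (expUnit a)))) ∧
        IsSplitShortExact ι χ s) ∧
    -- the sequence for the Hausdorffized `K₁`-groups, and the natural isomorphism
    (∃ (ι : ∀ (A : Type u) [CStarAlgebra A] [PartialOrder A] [StarOrderedRing A], K1u A →* K1 A)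
      (χ : ∀ (A : Type u) [CStarAlgebra A] [PartialOrder A] [StarOrderedRing A],
        K1 A →* Multiplicative (AffT A))
      (s : ∀ (A : Type u) [CStarAlgebra A] [PartialOrder A] [StarOrderedRing A],
        Multiplicative (AffT A) →* K1 A)
      (Φ : ∀ (A : Type u) [CStarAlgebra A] [PartialOrder A] [StarOrderedRing A],
        K1 A ≃ₜ* K1u A × Multiplicative (AffT A)),
      (∀ (A : Type u) [CStarAlgebra A] [PartialOrder A] [StarOrderedRing A],
        (∀ (n : ℕ) (v : Un A n),
          ι A (QuotientGroup.mk (Uof A n v)) = QuotientGroup.mk (GLof A n (Unitary.toUnits v))) ∧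
        (∀ (n : ℕ) (x : GLn A n),
          χ A (QuotientGroup.mk (GLof A n x)) = Multiplicative.ofAdd (hatLogAbs x)) ∧
        (∀ a : A, IsSelfAdjoint a →
          s A (Multiplicative.ofAdd (hat a)) =
            QuotientGroup.mk (GLof A 1 (GLone A 1 (expUnit a)))) ∧
        IsSplitShortExact (ι A) (χ A) (s A) ∧
        ∀ (v : K1u A) (f : Multiplicative (AffT A)), (Φ A).symm (v, f) = ι A v * s A f) ∧
      ∀ (A B : Type u) [CStarAlgebra A] [PartialOrder A] [StarOrderedRing A]
        [CStarAlgebra B] [PartialOrder B] [StarOrderedRing B] (φ : A →⋆ₐ[ℂ] B) (x : K1 A),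
        Φ B (K1.map φ x) =
          (K1u.map φ (Φ A x).1,
            Multiplicative.ofAdd (AffT.map φ (Multiplicative.toAdd (Φ A x).2)))) := by
  refine ⟨fun A _ _ _ f => exists_hat_eq f, fun A _ _ _ n hn => ?_, fun A _ _ _ => ?_, ?_⟩
  · obtain ⟨ι, χ, s, Φ, hι, hχ, hs, hsplit, -⟩ := exists_split_finite A hn
    exact ⟨ι, χ, s, hι, hχ, hs, hsplit⟩
  · obtain ⟨ι, χ, s, Φ, hι, hχ, hs, hsplit, -⟩ := exists_split_CG0 A
    exact ⟨ι, χ, s, fun n v => hι _, fun n x => hχ _, hs, hsplit⟩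
  · choose ι χ s Φ hι hχ hs hsplit hΦ using
      fun (A : Type u) [CStarAlgebra A] [PartialOrder A] [StarOrderedRing A] => exists_split_K1 A
    refine ⟨ι, χ, s, Φ, fun A _ _ _ => ⟨fun n v => hι A _, fun n x => hχ A _, hs A, hsplit A,
      hΦ A⟩, fun A B _ _ _ _ _ _ φ x => ?_⟩
    -- On `ι(v) s(â)` naturality can be checked factor by factor: entrywise application of `φ`
    -- commutes with the inclusion of unitaries and sends `e^a` to `e^{φ(a)}`.
    obtain ⟨⟨v, f⟩, rfl⟩ := (Φ A).symm.surjective x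
    obtain ⟨a, ha, rfl⟩ : ∃ a : A, IsSelfAdjoint a ∧ Multiplicative.ofAdd (hat a) = f :=
      exists_hat_eq (Multiplicative.toAdd f)
    rw [ContinuousMulEquiv.apply_symm_apply, ← ContinuousMulEquiv.eq_symm_apply, hΦ, hΦ, map_mul]
    obtain ⟨v, rfl⟩ := QuotientGroup.mk_surjective v
    congr 1
    · refine (congrArg (K1.map φ) (hι A v)).trans ?_
      refine Eq.trans ?_ (hι B (Uinf.map φ v)).symm
      exact congrArg _ (GLinf.map_UinfInclusion φ v)
    · rw [hs A a ha]
      refine Eq.trans ?_ (hs B (φ a) (ha.map φ)).symm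
      exact congrArg _ (GLinf.map_expInf φ a)
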